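/- **Setting.** Let $n\ge 2$, $-1\le d_0\le d_\infty<\frac1{n-1}$, $r_{0,i}=1-(n-i)d_0$, $r_{\infty,i}=1-(n-i)d_\infty$ for $1\le i\le n+1$, and write $\lceil s\rfloor^p=|s|^p\,\mathrm{sign}(s)$, where $\lceil 0\rfloor^0=[-1,1]$. For arbitrary $\kappa_i,\theta_i>0$ ($1\le i\le n$) put $$\varphi_i(s)=\kappa_i\lceil s\rfloor^{r_{0,i+1}/r_{0,i}}+\theta_i\lceil s\rfloor^{r_{\infty,i+1}/r_{\infty,i}},\qquad \phi_i=\varphi_i\circ\cdots\circ\varphi_1 .$$ Let $\Delta\ge 0$, with $\Delta=0$ if $d_0\ne-1$. For positive gains $k_1,\dots,k_n$ let $k_0=1$ and $\tilde k_i=k_i/k_{i-1}$, so $k_i=\tilde k_1\cdots\tilde k_i$. The noise-free error dynamics of the differentiator is the differential inclusion $$\dot z_i=-\tilde k_i\big(\phi_i(z_1)-z_{i+1}\big)\ (1\le i\le n-1),\qquad \dot z_n\in-\tilde k_n\Big(\phi_n(z_1)-\tfrac{\Delta}{k_n}[-1,1]\Big),$$ whose solutions are absolutely continuous functions that satisfy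 it almost everywhere. Let $p_0,p_\infty>0$ satisfy, for all $i\in\{1,\dots,n\}$, $$p_0\ge\tfrac{r_{0,i}}{r_{\infty,i}}(2r_{\infty,i}+d_\infty),\qquad p_\infty\ge 2r_{\infty,i}+d_\infty,\qquad \tfrac{p_0}{r_{0,i}}<\tfrac{p_\infty}{r_{\infty,i}},$$ let $\beta_{0,i},\beta_{\infty,i}>0$ be arbitrary, and let $V(z)=\sum_{i=1}^{n}Z_i(z_i,z_{i+1})$ with $z_{n+1}=0$ and $$Z_i(z_i,z_{i+1})=\sum_{j\in\{0,\infty\}}\beta_{j,i}\Big[\tfrac{r_{j,i}}{p_j}|z_i|^{p_j/r_{j,i}}-z_i\lceil\xi_i\rfloor^{(p_j-r_{j,i})/r_{j,i}}+\tfrac{p_j-r_{j,i}}{p_j}|\xi_i|^{p_j/r_{j,i}}\Big],$$ where $\xi_i=\varphi_i^{-1}(z_{i+1})$ for $i<n$ and $\xi_n=0$. Put $\sigma_i=\partial Z_i/\partial z_i$ and $s_i=\partial Z_i/\partial z_{i+1}$. For a number $K$ with $K\kappa_n>\Delta$, used as the value of $k_n$, and $1\le i\le n-1$, define $$\omega_i(\tilde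 k_{i+1},\dots,\tilde k_n)=\sup\ \frac{\sum_{j=i+1}^{n}\tilde k_j\,\big[s_{j-1}(z_{j-1},z_j)+\sigma_j(z_j,z_{j+1})\big]\,\big(z_{j+1}-\varphi_j\circ\cdots\circ\varphi_i(z_i)\big)}{\sigma_i(z_i,z_{i+1})\,\big(\varphi_i(z_i)-z_{i+1}\big)} ,$$ where the supremum is over all $(z_i,\dots,z_n)\in\mathbb R^{n-i+1}$ with $\varphi_i(z_i)\ne z_{i+1}$, and where $\varphi_n(s)$ stands for $\varphi_n(s)-\frac{\Delta}{K}[-1,1]$ and the supremum is also over all values of this set-valued term. **Claim.** Stabilizing gains can be computed backwards as follows: (a) choose $K$ with $K\kappa_n>\Delta$ and $\tilde k_n>0$; (b) for $i=n-1,n-2,\dots,1$ choose $\tilde k_i>\omega_i(\tilde k_{i+1},\dots,\tilde k_n)$. More precisely: 1. (Well-posedness.) If $K\kappa_n>\Delta$, $\tilde k_n>0$, $1\le i\le n-1$, and $\tilde k_j>\omega_j(\tilde k_{j+1},\dots,\tilde k_n)$ for $i<j\le n-1$, then the supremum defining $\omega_i(\tilde k_{i+1},\dots,\tilde k_n)$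 is over a nonempty set and is finite. 2. (The gains are stabilizing.) Let $K,\tilde k_1,\dots,\tilde k_n$ satisfy (a) and (b) and let $k_n=\tilde k_1\cdots\tilde k_n\ge K$ (in particular, this covers $K=k_n$). Then all $k_i$ are positive, and - $V$ is $C^1$, $V(0)=0$, $V(z)>0$ for $z\ne0$, $V$ is radially unbounded, and $\nabla V(z)\cdot v<0$ for all $z\neq 0$ and all admissible velocities $v$ of the error dynamics at $z$. If moreover $d_0/p_0\le d_\infty/p_\infty$ (for example if $d_0\le 0$), there are $\eta_0,\eta_\infty>0$ such that $\nabla V(z)\cdot v\le-\eta_0V(z)^{(p_0+d_0)/p_0}-\eta_\infty V(z)^{(p_\infty+d_\infty)/p_\infty}$ for all $z$ and all such $v$; - $z=0$ is globally asymptotically stable for the error dynamics: it is Lyapunov stable, solutions starting in a bounded set stay in a bounded set (so none escapes in finite time), and every solution on $[0,\infty)$ converges to $0$; - if $d_0<0<d_\infty$, convergence is in fixed time: there is $\overline T$, independent of the initial state, such that every solution vanishes for $t\ge\overline T$. 3. (The procedure can be carried out.) For every $K$ with $K\kappa_n>\Delta$ and every $c>0$ there are $\tilde k_1,\dots,\tilde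 k_n$ with $\tilde k_n=c$ and $k_n=\tilde k_1\cdots\tilde k_n\ge K$ that satisfy (a) and (b), both with $K$ itself and with $k_n$ in place of $K$. -/

import Mathlib

open Set Filter Topology MeasureTheory

noncomputable section

/-- Signed power `|s|^p sign s`. -/
def spow (p s : ℝ) : ℝ := Real.sign s * |s| ^ p

/-- Signed power as a set-valued map: single-valued, except that the signed power with exponent
`0` (the sign function) takes at `0` the whole interval `[-1, 1]` as its value. -/
def spowSet (p s : ℝ) : Set ℝ := if p = 0 ∧ s = 0 then Icc (-1) 1 else {spow p s}

/-- Parameters of the differentiator and of the Lyapunov function. Sequences are indexed by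
`1, …, n`; their values at other indices are irrelevant. -/
structure DiffParams where
  /-- order -/
  n : ℕ
  /-- homogeneity degree near the origin -/
  d0 : ℝ
  /-- homogeneity degree at infinity -/
  dInf : ℝ
  /-- internal gains of the low-power terms -/
  kappa : ℕ → ℝ
  /-- internal gains of the high-power terms -/
  theta : ℕ → ℝ
  /-- degree of `V` near the origin -/
  p0 : ℝ
  /-- degree of `V` at infinity -/
  pInf : ℝ
  /-- coefficients of the degree `p0` part of `V` -/
  beta0 : ℕ → ℝ
  /-- coefficients of the degree `pInf` part of `V` -/
  betaInf : ℕ → ℝ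

namespace DiffParams

variable (P : DiffParams)

/-- The weights `r_{0,i} = 1 - (n - i) d₀`. -/
def r0 (i : ℕ) : ℝ := 1 - ((P.n : ℝ) - (i : ℝ)) * P.d0

/-- The weights `r_{∞,i} = 1 - (n - i) d_∞`. -/
def rInf (i : ℕ) : ℝ := 1 - ((P.n : ℝ) - (i : ℝ)) * P.dInf

/-- Standing assumptions on the parameters and on the bound `Δ` of the `n`-th derivative. -/
structure Valid (Δ : ℝ) : Prop where
  two_le_n : 2 ≤ P.n
  neg_one_le_d0 : -1 ≤ P.d0
  d0_le_dInf : P.d0 ≤ P.dInf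
  dInf_lt : P.dInf < 1 / ((P.n : ℝ) - 1)
  kappa_pos : ∀ i ∈ Finset.Icc 1 P.n, 0 < P.kappa i
  theta_pos : ∀ i ∈ Finset.Icc 1 P.n, 0 < P.theta i
  beta0_pos : ∀ i ∈ Finset.Icc 1 P.n, 0 < P.beta0 i
  betaInf_pos : ∀ i ∈ Finset.Icc 1 P.n, 0 < P.betaInf i
  p0_pos : 0 < P.p0
  pInf_pos : 0 < P.pInf
  le_p0 : ∀ i ∈ Finset.Icc 1 P.n, P.r0 i / P.rInf i * (2 * P.rInf i + P.dInf) ≤ P.p0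
  le_pInf : ∀ i ∈ Finset.Icc 1 P.n, 2 * P.rInf i + P.dInf ≤ P.pInf
  p0_lt_pInf : ∀ i ∈ Finset.Icc 1 P.n, P.p0 / P.r0 i < P.pInf / P.rInf i
  Delta_nonneg : 0 ≤ Δ
  Delta_eq_zero : P.d0 ≠ -1 → Δ = 0

/-- The function `φ_i`. -/
def phi (i : ℕ) (s : ℝ) : ℝ :=
  P.kappa i * spow (P.r0 (i + 1) / P.r0 i) s + P.theta i * spow (P.rInf (i + 1) / P.rInf i) s

/-- The composition `φ_j ∘ ⋯ ∘ φ_i` (the identity if `j < i`). -/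
def chain (i : ℕ) : ℕ → ℝ → ℝ
  | 0, s => s
  | j + 1, s => if i ≤ j + 1 then P.phi (j + 1) (chain i j s) else s

/-- Set-valued version of `φ_i`, where, for `i = n`, the function `φ_n(s)` is replaced by
`φ_n(s) - (Δ / K) [-1, 1]`. -/
def phiSet (Δ K : ℝ) (i : ℕ) (s : ℝ) : Set ℝ :=
  {u | ∃ a ∈ spowSet (P.r0 (i + 1) / P.r0 i) s, ∃ b ∈ spowSet (P.rInf (i + 1) / P.rInf i) s,
    ∃ d ∈ Icc (-1 : ℝ) 1,
      u = P.kappa i * a + P.theta i * b - (if i = P.n then Δ / K * d else 0)}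

/-- Set-valued version of `φ_j ∘ ⋯ ∘ φ_i`, for `i ≤ j`, with the same replacement for `j = n`. -/
def chainSet (Δ K : ℝ) (i j : ℕ) (s : ℝ) : Set ℝ := P.phiSet Δ K j (P.chain i (j - 1) s)

/-- `ξ_i = φ_i⁻¹(y)` for `i < n` (where `φ_i` is a bijection of `ℝ`) and `ξ_n = 0`. -/
def xi (i : ℕ) (y : ℝ) : ℝ := if i < P.n then Function.invFun (P.phi i) y else 0

/-- One of the two summands of `Z_i`. -/
def Zterm (β p r x ξ : ℝ) : ℝ :=
  β * (r / p * |x| ^ (p / r) - x * spow ((p - r) / r) ξ + (p - r) / p * |ξ| ^ (p / r))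

/-- The function `Z_i(z_i, z_{i+1})`. -/
def Z (i : ℕ) (x y : ℝ) : ℝ :=
  Zterm (P.beta0 i) P.p0 (P.r0 i) x (P.xi i y) +
    Zterm (P.betaInf i) P.pInf (P.rInf i) x (P.xi i y)

/-- `σ_i = ∂Z_i/∂z_i`. -/
def sigma (i : ℕ) (x y : ℝ) : ℝ := deriv (fun t => P.Z i t y) x

/-- `s_i = ∂Z_i/∂z_{i+1}`. -/
def sPart (i : ℕ) (x y : ℝ) : ℝ := deriv (fun t => P.Z i x t) y

variable {P} in
/-- The coordinate `z_i`, `1 ≤ i ≤ n`, with `z_{n+1} = 0`. -/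
def coord (z : Fin P.n → ℝ) (i : ℕ) : ℝ :=
  if h : 1 ≤ i ∧ i ≤ P.n then z ⟨i - 1, by omega⟩ else 0

/-- The Lyapunov function candidate. -/
def V (z : Fin P.n → ℝ) : ℝ := ∑ i ∈ Finset.Icc 1 P.n, P.Z i (coord z i) (coord z (i + 1))

/-- The gains `k_i = k̃_1 ⋯ k̃_i` belonging to the ratios `k̃_i = k_i / k_{i-1}`, `k_0 = 1`. -/
def gain (kt : ℕ → ℝ) (i : ℕ) : ℝ := ∏ j ∈ Finset.Icc 1 i, kt j

/-- All values of the ratio whose maximization defines `ω_i`, over all points at which the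
denominator does not vanish (that is `φ_i(z_i) ≠ z_{i+1}`) and over all selections of the
set-valued term. Only `k̃_{i+1}, …, k̃_n` and `z_i, …, z_n` enter; `K` is the value used
for `k_n`. -/
def ratioSet (Δ K : ℝ) (kt : ℕ → ℝ) (i : ℕ) : Set ℝ :=
  {q | ∃ (z : Fin P.n → ℝ) (u : ℕ → ℝ), P.phi i (coord z i) ≠ coord z (i + 1) ∧
    (∀ j ∈ Finset.Icc (i + 1) P.n, u j ∈ P.chainSet Δ K i j (coord z i)) ∧
    q = (∑ j ∈ Finset.Icc (i + 1) P.n,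
          kt j * (P.sPart (j - 1) (coord z (j - 1)) (coord z j) +
              P.sigma j (coord z j) (coord z (j + 1))) * (coord z (j + 1) - u j)) /
        (P.sigma i (coord z i) (coord z (i + 1)) * (P.phi i (coord z i) - coord z (i + 1)))}

/-- `ω_i(k̃_{i+1}, …, k̃_n)`. -/
def omega (Δ K : ℝ) (kt : ℕ → ℝ) (i : ℕ) : ℝ := sSup (P.ratioSet Δ K kt i)

/-- The backward selection of the gains, with `K` as the value of `k_n` in step (a). -/
structure Selection (Δ K : ℝ) (kt : ℕ → ℝ) : Prop where
  lt_last : Δ < K * P.kappa P.n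
  last_pos : 0 < kt P.n
  omega_lt : ∀ i ∈ Finset.Icc 1 (P.n - 1), P.omega Δ K kt i < kt i

/-- Right-hand side of the noise-free error dynamics
`ż_i = -k̃_i (φ_i ∘ ⋯ ∘ φ_1 (z_1) - z_{i+1})` for `i < n`,
`ż_n ∈ -k̃_n (φ_n ∘ ⋯ ∘ φ_1 (z_1) - (Δ / k_n) [-1, 1])`. -/
def errorField (Δ : ℝ) (kt : ℕ → ℝ) (z : Fin P.n → ℝ) : Set (Fin P.n → ℝ) :=
  {v | ∀ i : Fin P.n, ∃ u ∈ P.chainSet Δ (gain kt P.n) 1 (i + 1) (coord z 1),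
    v i = -kt (i + 1) * (u - coord z (i + 2))}

/-- Absolutely continuous solutions of the error inclusion on `[0, T]`. -/
def IsSolution (Δ : ℝ) (kt : ℕ → ℝ) (T : ℝ) (z : ℝ → Fin P.n → ℝ) : Prop :=
  AbsolutelyContinuousOnInterval z 0 T ∧
    ∀ᵐ t ∂volume, t ∈ Icc 0 T → ∃ v ∈ P.errorField Δ kt (z t), HasDerivAt z v t

/-- `V` is a `C¹` strict, proper Lyapunov function for the error inclusion, with the decay
estimate of the two powers of `V` (which needs `d₀ / p₀ ≤ d_∞ / p_∞`, true when `d₀ ≤ 0`). -/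
structure IsLyapunov (Δ : ℝ) (kt : ℕ → ℝ) : Prop where
  contDiff : ContDiff ℝ 1 P.V
  zero : P.V 0 = 0
  pos : ∀ z, z ≠ 0 → 0 < P.V z
  proper : Tendsto P.V (cocompact (Fin P.n → ℝ)) atTop
  decrease : ∀ z, z ≠ 0 → ∀ v ∈ P.errorField Δ kt z, fderiv ℝ P.V z v < 0
  decay : P.d0 * P.pInf ≤ P.dInf * P.p0 → ∃ η0 > 0, ∃ ηInf > 0,
    ∀ z, ∀ v ∈ P.errorField Δ kt z, fderiv ℝ P.V z v ≤
      -η0 * P.V z ^ ((P.p0 + P.d0) / P.p0) - ηInf * P.V z ^ ((P.pInf + P.dInf) / P.pInf)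

/-- The origin is globally asymptotically stable for the error inclusion (all solutions):
Lyapunov stability, bounds uniform on bounded sets of initial states (in particular no escape in
finite time), and convergence of every solution defined for all times. -/
structure IsGAS (Δ : ℝ) (kt : ℕ → ℝ) : Prop where
  stable : ∀ ε > 0, ∃ δ > 0, ∀ T > 0, ∀ z, P.IsSolution Δ kt T z → ‖z 0‖ < δ →
    ∀ t ∈ Icc 0 T, ‖z t‖ < ε
  bounded : ∀ R > 0, ∃ M, ∀ T > 0, ∀ z, P.IsSolution Δ kt T z → ‖z 0‖ ≤ R →
    ∀ t ∈ Icc 0 T, ‖z t‖ ≤ M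
  attractive : ∀ z, (∀ T > 0, P.IsSolution Δ kt T z) → Tendsto z atTop (𝓝 0)

/-- Every solution vanishes from a time on which does not depend on the initial state. -/
def ConvergesInFixedTime (Δ : ℝ) (kt : ℕ → ℝ) : Prop :=
  ∃ Tbar > 0, ∀ T > 0, ∀ z, P.IsSolution Δ kt T z → ∀ t ∈ Icc Tbar T, z t = 0

/-- The gains are stabilizing. -/
structure Stabilizing (Δ : ℝ) (kt : ℕ → ℝ) : Prop where
  lyapunov : P.IsLyapunov Δ kt
  gas : P.IsGAS Δ kt
  fixedTime : P.d0 < 0 → 0 < P.dInf → P.ConvergesInFixedTime Δ kt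

end DiffParams

end

theorem spow_zero_right (p : ℝ) : spow p 0 = 0 := by simp [spow]

theorem spow_of_pos (p : ℝ) {s : ℝ} (hs : 0 < s) : spow p s = s ^ p := by
  simp [spow, Real.sign_of_pos hs, abs_of_pos hs]

theorem spow_neg (p s : ℝ) : spow p (-s) = -spow p s := by
  simp [spow, Real.sign_neg]

theorem spow_of_neg (p : ℝ) {s : ℝ} (hs : s < 0) : spow p s = -(-s) ^ p := by
  rw [← spow_of_pos p (neg_pos.2 hs), spow_neg, neg_neg]

theorem spow_mul_of_pos (p : ℝ) {ρ : ℝ} (hρ : 0 < ρ) (s : ℝ) :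
    spow p (ρ * s) = ρ ^ p * spow p s := by
  rcases lt_trichotomy s 0 with hs | rfl | hs
  · rw [spow_of_neg p hs, spow_of_neg p (mul_neg_of_pos_of_neg hρ hs), ← mul_neg,
      Real.mul_rpow hρ.le (neg_pos.2 hs).le, mul_neg]
  · simp [spow_zero_right]
  · rw [spow_of_pos p hs, spow_of_pos p (mul_pos hρ hs), Real.mul_rpow hρ.le hs.le]

theorem spow_pos (p : ℝ) {s : ℝ} (hs : 0 < s) : 0 < spow p s := by
  rw [spow_of_pos p hs]; positivity

theorem spow_neg_of_neg (p : ℝ) {s : ℝ} (hs : s < 0) : spow p s < 0 := by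
  rw [spow_of_neg p hs]; have : 0 < -s := by linarith
  have := Real.rpow_pos_of_pos this p
  linarith

theorem spow_eq_max_sub_max {p : ℝ} (hp : 0 < p) (s : ℝ) :
    spow p s = (max s 0) ^ p - (max (-s) 0) ^ p := by
  rcases lt_trichotomy s 0 with hs | rfl | hs
  · rw [spow_of_neg p hs, max_eq_right hs.le, max_eq_left (neg_pos.2 hs).le,
      Real.zero_rpow hp.ne', zero_sub]
  · simp [spow_zero_right]
  · rw [spow_of_pos p hs, max_eq_left hs.le, max_eq_right (by linarith), Real.zero_rpow hp.ne',
      sub_zero]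

theorem continuous_spow {p : ℝ} (hp : 0 < p) : Continuous (spow p) := by
  rw [funext (spow_eq_max_sub_max hp)]
  refine Continuous.sub ?_ ?_
  · exact (continuous_id.max continuous_const).rpow_const fun _ => Or.inr hp.le
  · exact (continuous_neg.max continuous_const).rpow_const fun _ => Or.inr hp.le

theorem strictMono_spow {p : ℝ} (hp : 0 < p) : StrictMono (spow p) := by
  intro s t hst
  rcases lt_or_ge s 0 with hs | hs
  · rcases lt_or_ge t 0 with ht | ht
    · rw [spow_of_neg p hs, spow_of_neg p ht]
      exact neg_lt_neg (Real.rpow_lt_rpow (by linarith) (by linarith) hp)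
    · refine (spow_neg_of_neg p hs).trans_le ?_
      rcases ht.eq_or_lt with rfl | ht
      · rw [spow_zero_right]
      · exact (spow_pos p ht).le
  · rcases hs.eq_or_lt with rfl | hs
    · rw [spow_zero_right]; exact spow_pos p hst
    · rw [spow_of_pos p hs, spow_of_pos p (hs.trans hst)]
      exact Real.rpow_lt_rpow hs.le hst hp

theorem hasDerivAt_spow (p : ℝ) {s : ℝ} (hs : s ≠ 0) :
    HasDerivAt (spow p) (p * |s| ^ (p - 1)) s := by
  rcases lt_or_gt_of_ne hs with hs | hs
  · have h : HasDerivAt (fun t : ℝ => -(-t) ^ p) (p * |s| ^ (p - 1)) s := by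
      have h1 := (Real.hasDerivAt_rpow_const (x := -s) (p := p) (Or.inl (by linarith))).comp s
        (hasDerivAt_neg s)
      rw [abs_of_neg hs]
      have h2 := h1.neg
      rw [mul_neg_one, neg_neg] at h2
      exact h2
    refine h.congr_of_eventuallyEq ?_
    filter_upwards [eventually_lt_nhds hs] with t ht using spow_of_neg p ht
  · have h1 := Real.hasDerivAt_rpow_const (x := s) (p := p) (Or.inl hs.ne')
    rw [abs_of_pos hs]
    refine h1.congr_of_eventuallyEq ?_
    filter_upwards [eventually_gt_nhds hs] with t ht using spow_of_pos p ht

theorem mul_spow_self {p : ℝ} (hp : 0 < p) (s : ℝ) : s * spow p s = |s| ^ (p + 1) := by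
  rcases lt_trichotomy s 0 with hs | rfl | hs
  · rw [spow_of_neg p hs, abs_of_neg hs, Real.rpow_add_one (by linarith)]; ring
  · rw [zero_mul, abs_zero, Real.zero_rpow (by linarith)]
  · rw [spow_of_pos p hs, abs_of_pos hs, Real.rpow_add_one hs.ne']; ring

theorem abs_rpow_mul_self (p s : ℝ) : |s| ^ (p - 1) * s = spow p s := by
  rcases lt_trichotomy s 0 with hs | rfl | hs
  · rw [spow_of_neg p hs, abs_of_neg hs, Real.rpow_sub_one (by linarith)]
    have := hs.ne
    field_simp
  · rw [mul_zero, spow_zero_right]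
  · rw [spow_of_pos p hs, abs_of_pos hs, Real.rpow_sub_one hs.ne']
    field_simp

theorem hasDerivAt_abs_rpow_add_one {q : ℝ} (hq : 0 < q) (x : ℝ) :
    HasDerivAt (fun t : ℝ => |t| ^ (q + 1)) ((q + 1) * spow q x) x := by
  have h := hasDerivAt_abs_rpow x (p := q + 1) (by linarith)
  convert h using 1
  rw [mul_assoc, show q + 1 - 2 = q - 1 by ring, abs_rpow_mul_self q x]

theorem continuous_abs_rpow {q : ℝ} (hq : 0 ≤ q) : Continuous fun t : ℝ => |t| ^ q :=
  continuous_abs.rpow_const fun _ => Or.inr hq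

theorem spowSet_of_ne {p s : ℝ} (h : s ≠ 0 ∨ p ≠ 0) : spowSet p s = {spow p s} := by
  rw [spowSet, if_neg (by tauto)]

theorem spowSet_eq_of_zero (s : ℝ) : spowSet 0 s = {e | |e| ≤ 1 ∧ e * s = |s|} := by
  ext e
  rcases lt_trichotomy s 0 with hs | rfl | hs
  · rw [spowSet_of_ne (Or.inl hs.ne), spow_of_neg 0 hs, Real.rpow_zero, mem_singleton_iff,
      mem_ofPred_eq, abs_of_neg hs]
    constructor
    · rintro rfl; simp
    · rintro ⟨-, h⟩; exact mul_right_cancel₀ hs.ne (by linarith)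
  · simp [spowSet, abs_le]
  · rw [spowSet_of_ne (Or.inl hs.ne'), spow_of_pos 0 hs, Real.rpow_zero, mem_singleton_iff,
      mem_ofPred_eq, abs_of_pos hs]
    constructor
    · rintro rfl; simp
    · rintro ⟨-, h⟩; exact mul_right_cancel₀ hs.ne' (by linarith)

namespace DiffParams

variable (P : DiffParams)

/-- Exponent of the low-power term of `φ_i`. -/
noncomputable abbrev e0 (i : ℕ) : ℝ := P.r0 (i + 1) / P.r0 i

/-- Exponent of the high-power term of `φ_i`. -/
noncomputable abbrev eInf (i : ℕ) : ℝ := P.rInf (i + 1) / P.rInf i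

/-- Exponent of the low-power term of `σ_i`. -/
noncomputable abbrev m0 (i : ℕ) : ℝ := (P.p0 - P.r0 i) / P.r0 i

/-- Exponent of the high-power term of `σ_i`. -/
noncomputable abbrev mInf (i : ℕ) : ℝ := (P.pInf - P.rInf i) / P.rInf i

/-- The relations between the exponents that make `V` continuously differentiable. -/
structure Exponents : Prop where
  two_le_n : 2 ≤ P.n
  r0_pos : ∀ i, 1 ≤ i → i ≤ P.n → 0 < P.r0 i
  rInf_pos : ∀ i, 1 ≤ i → i ≤ P.n → 0 < P.rInf i
  e0_pos : ∀ i, 1 ≤ i → i < P.n → 0 < P.e0 i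
  e0_nonneg : ∀ i, 1 ≤ i → i ≤ P.n → 0 ≤ P.e0 i
  e0_le : ∀ i, 1 ≤ i → i ≤ P.n → P.e0 i ≤ P.eInf i
  le_m0 : ∀ i, 1 ≤ i → i ≤ P.n → P.eInf i ≤ P.m0 i
  m0_pos : ∀ i, 1 ≤ i → i ≤ P.n → 0 < P.m0 i
  m0_lt : ∀ i, 1 ≤ i → i ≤ P.n → P.m0 i < P.mInf i
  p0_pos : 0 < P.p0
  pInf_pos : 0 < P.pInf

/-- Admissible exponents together with nonnegative coefficients, not both zero. Besides the given
parameters this covers their homogeneous limits at the origin and at infinity. -/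
structure Regular : Prop extends P.Exponents where
  kappa_nonneg : ∀ i, 1 ≤ i → i ≤ P.n → 0 ≤ P.kappa i
  theta_nonneg : ∀ i, 1 ≤ i → i ≤ P.n → 0 ≤ P.theta i
  gain_pos : ∀ i, 1 ≤ i → i ≤ P.n → 0 < P.kappa i + P.theta i
  beta0_nonneg : ∀ i, 1 ≤ i → i ≤ P.n → 0 ≤ P.beta0 i
  betaInf_nonneg : ∀ i, 1 ≤ i → i ≤ P.n → 0 ≤ P.betaInf i
  beta_pos : ∀ i, 1 ≤ i → i ≤ P.n → 0 < P.beta0 i + P.betaInf i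

variable {P}

theorem r0_succ (i : ℕ) : P.r0 (i + 1) = P.r0 i + P.d0 := by simp only [r0]; push_cast; ring

theorem rInf_succ (i : ℕ) : P.rInf (i + 1) = P.rInf i + P.dInf := by
  simp only [rInf]; push_cast; ring

theorem Exponents.eInf_pos (h : P.Exponents) {i : ℕ} (h1 : 1 ≤ i) (hn : i < P.n) :
    0 < P.eInf i := (h.e0_pos i h1 hn).trans_le (h.e0_le i h1 hn.le)

theorem Exponents.mInf_pos (h : P.Exponents) {i : ℕ} (h1 : 1 ≤ i) (hn : i ≤ P.n) :
    0 < P.mInf i := (h.m0_pos i h1 hn).trans (h.m0_lt i h1 hn)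

theorem weight_pos {n i : ℕ} {d : ℝ} (hn : 2 ≤ n) (hd : d < 1 / ((n : ℝ) - 1)) (h1 : 1 ≤ i)
    (hi : i ≤ n) : 0 < 1 - ((n : ℝ) - i) * d := by
  have hn' : (2 : ℝ) ≤ n := by exact_mod_cast hn
  have h1' : (1 : ℝ) ≤ i := by exact_mod_cast h1
  have hi' : (i : ℝ) ≤ n := by exact_mod_cast hi
  rw [lt_div_iff₀ (by linarith)] at hd
  rcases le_or_gt d 0 with h | h
  · nlinarith
  · nlinarith

theorem Valid.exponents {Δ : ℝ} (hP : P.Valid Δ) : P.Exponents := by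
  have hn := hP.two_le_n
  have hn' : (2 : ℝ) ≤ P.n := by exact_mod_cast hn
  have hr0 : ∀ i, 1 ≤ i → i ≤ P.n → 0 < P.r0 i := fun i h1 hi =>
    weight_pos hn (hP.d0_le_dInf.trans_lt hP.dInf_lt) h1 hi
  have hrI : ∀ i, 1 ≤ i → i ≤ P.n → 0 < P.rInf i := fun i h1 hi =>
    weight_pos hn hP.dInf_lt h1 hi
  have hle : ∀ i, 1 ≤ i → i ≤ P.n → P.eInf i ≤ P.m0 i := by
    intro i h1 hi
    have h := hP.le_p0 i (Finset.mem_Icc.2 ⟨h1, hi⟩)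
    have a := hr0 i h1 hi
    have b := hrI i h1 hi
    simp only [m0, eInf, rInf_succ]
    rw [div_mul_eq_mul_div, div_le_iff₀ b] at h
    rw [div_le_div_iff₀ b a]
    nlinarith
  have he : ∀ i, 1 ≤ i → i ≤ P.n → P.e0 i ≤ P.eInf i := by
    intro i h1 hi
    have a := hr0 i h1 hi
    have b := hrI i h1 hi
    simp only [e0, eInf, rInf_succ, r0_succ]
    rw [div_le_div_iff₀ a b]
    have := hP.d0_le_dInf
    simp only [r0, rInf]
    nlinarith
  have he0 : ∀ i, 1 ≤ i → i ≤ P.n → 0 ≤ P.e0 i := by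
    intro i h1 hi
    refine div_nonneg ?_ (hr0 i h1 hi).le
    rcases hi.eq_or_lt with rfl | hi
    · rw [r0_succ]; simp only [r0]; linarith [hP.neg_one_le_d0]
    · exact (hr0 _ (by omega) hi).le
  have hm0 : ∀ i, 1 ≤ i → i ≤ P.n → 0 < P.m0 i := by
    intro i h1 hi
    refine lt_of_le_of_ne ((he0 i h1 hi).trans ((he i h1 hi).trans (hle i h1 hi))) fun h0 => ?_
    have a := hr0 i h1 hi
    have b := hrI i h1 hi
    have h2 : P.eInf i = 0 := le_antisymm ((hle i h1 hi).trans h0.symm.le)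
      ((he0 i h1 hi).trans (he i h1 hi))
    have h3 : P.e0 i = 0 := le_antisymm ((he i h1 hi).trans h2.le) (he0 i h1 hi)
    rcases hi.eq_or_lt with rfl | hi
    · have e1 : P.dInf = -1 := by
        have := (div_eq_zero_iff.1 h2).resolve_right b.ne'
        rw [rInf_succ] at this
        simp only [rInf] at this
        linarith
      have e2 : P.d0 = -1 := by
        have := (div_eq_zero_iff.1 h3).resolve_right a.ne'
        rw [r0_succ] at this
        simp only [r0] at this
        linarith
      have e3 := (div_eq_zero_iff.1 h0.symm).resolve_right a.ne'
      have h4 := hP.le_p0 1 (Finset.mem_Icc.2 ⟨le_rfl, by omega⟩)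
      have h5 : P.r0 1 = P.n := by simp only [r0, e2]; push_cast; ring
      have h6 : P.rInf 1 = P.n := by simp only [rInf, e1]; push_cast; ring
      have h7 : P.r0 P.n = 1 := by simp [r0]
      rw [h5, h6, e1, div_self (by linarith)] at h4
      linarith
    · exact (div_pos (hrI (i + 1) (by omega) hi) b).ne' h2
  refine ⟨hn, hr0, hrI, fun i h1 hi => div_pos (hr0 _ (by omega) hi) (hr0 i h1 hi.le), he0, he,
    hle, hm0, ?_, hP.p0_pos, hP.pInf_pos⟩
  intro i h1 hi
  have h := hP.p0_lt_pInf i (Finset.mem_Icc.2 ⟨h1, hi⟩)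
  simp only [m0, mInf]
  rw [sub_div, sub_div, div_self (hr0 i h1 hi).ne', div_self (hrI i h1 hi).ne']
  linarith

theorem Valid.regular {Δ : ℝ} (hP : P.Valid Δ) : P.Regular where
  toExponents := hP.exponents
  kappa_nonneg i h1 hi := (hP.kappa_pos i (Finset.mem_Icc.2 ⟨h1, hi⟩)).le
  theta_nonneg i h1 hi := (hP.theta_pos i (Finset.mem_Icc.2 ⟨h1, hi⟩)).le
  gain_pos i h1 hi := add_pos (hP.kappa_pos i (Finset.mem_Icc.2 ⟨h1, hi⟩))
    (hP.theta_pos i (Finset.mem_Icc.2 ⟨h1, hi⟩))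
  beta0_nonneg i h1 hi := (hP.beta0_pos i (Finset.mem_Icc.2 ⟨h1, hi⟩)).le
  betaInf_nonneg i h1 hi := (hP.betaInf_pos i (Finset.mem_Icc.2 ⟨h1, hi⟩)).le
  beta_pos i h1 hi := add_pos (hP.beta0_pos i (Finset.mem_Icc.2 ⟨h1, hi⟩))
    (hP.betaInf_pos i (Finset.mem_Icc.2 ⟨h1, hi⟩))

theorem phi_zero (i : ℕ) : P.phi i 0 = 0 := by simp [phi, spow_zero_right]

theorem phi_neg (i : ℕ) (s : ℝ) : P.phi i (-s) = -P.phi i s := by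
  simp only [phi, spow_neg]; ring

/-- A combination of two functions with nonnegative weights, not both zero, is strictly
increasing if both functions are. -/
theorem strictMono_combination {f g : ℝ → ℝ} (hf : StrictMono f) (hg : StrictMono g) {u v : ℝ}
    (hu : 0 ≤ u) (hv : 0 ≤ v) (huv : 0 < u + v) : StrictMono fun s => u * f s + v * g s := by
  intro s t hst
  have h1 := hf hst
  have h2 := hg hst
  rcases hu.eq_or_lt with rfl | hu
  · have hv : 0 < v := by linarith
    simp only [zero_mul, zero_add]
    exact mul_lt_mul_of_pos_left h2 hv
  · exact add_lt_add_of_lt_of_le (mul_lt_mul_of_pos_left h1 hu)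
      (mul_le_mul_of_nonneg_left h2.le hv)

namespace Regular

variable (h : P.Regular) {i : ℕ} (h1 : 1 ≤ i) (hn : i < P.n)
include h h1 hn

theorem strictMono_phi : StrictMono (P.phi i) :=
  strictMono_combination (strictMono_spow (h.e0_pos i h1 hn))
    (strictMono_spow (h.eInf_pos h1 hn)) (h.kappa_nonneg i h1 hn.le) (h.theta_nonneg i h1 hn.le)
    (h.gain_pos i h1 hn.le)

theorem continuous_phi : Continuous (P.phi i) :=
  ((continuous_spow (h.e0_pos i h1 hn)).const_mul _).add
    ((continuous_spow (h.eInf_pos h1 hn)).const_mul _)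

theorem surjective_phi : Function.Surjective (P.phi i) := by
  have key : ∀ y, 0 ≤ y → ∃ s, P.phi i s = y := by
    intro y hy
    have ha := h.e0_pos i h1 hn
    have hg := h.gain_pos i h1 hn.le
    set S : ℝ := (1 + y / (P.kappa i + P.theta i)) ^ (1 / P.e0 i) with hS
    have hb : 0 ≤ y / (P.kappa i + P.theta i) := by positivity
    have hS1 : 1 ≤ S := Real.one_le_rpow (by linarith) (by positivity)
    have hSa : S ^ P.e0 i = 1 + y / (P.kappa i + P.theta i) := by
      rw [hS, ← Real.rpow_mul (by linarith), one_div_mul_cancel ha.ne', Real.rpow_one]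
    have hSb : S ^ P.e0 i ≤ S ^ P.eInf i :=
      Real.rpow_le_rpow_of_exponent_le hS1 (h.e0_le i h1 hn.le)
    have hφ : y ≤ P.phi i S := by
      have hS0 : 0 < S := by linarith
      rw [phi, spow_of_pos _ hS0, spow_of_pos _ hS0]
      have : (P.kappa i + P.theta i) * S ^ P.e0 i = P.kappa i + P.theta i + y := by
        rw [hSa]; field_simp
      have := mul_le_mul_of_nonneg_left hSb (h.theta_nonneg i h1 hn.le)
      change y ≤ P.kappa i * S ^ P.e0 i + P.theta i * S ^ P.eInf i
      linarith
    obtain ⟨s, -, hs⟩ := intermediate_value_Icc (by linarith : (0 : ℝ) ≤ S)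
      (h.continuous_phi h1 hn).continuousOn ⟨(phi_zero i).trans_le hy, hφ⟩
    exact ⟨s, hs⟩
  intro y
  rcases le_total 0 y with hy | hy
  · exact key y hy
  · obtain ⟨s, hs⟩ := key (-y) (by linarith)
    exact ⟨-s, by rw [phi_neg, hs, neg_neg]⟩

theorem phi_xi (y : ℝ) : P.phi i (P.xi i y) = y := by
  rw [xi, if_pos hn]
  exact Function.rightInverse_invFun (h.surjective_phi h1 hn) y

theorem xi_phi (s : ℝ) : P.xi i (P.phi i s) = s :=
  (h.strictMono_phi h1 hn).injective (h.phi_xi h1 hn _)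

theorem phi_eq_zero {s : ℝ} : P.phi i s = 0 ↔ s = 0 :=
  ⟨fun hs => (h.strictMono_phi h1 hn).injective (hs.trans (phi_zero i).symm),
    by rintro rfl; exact phi_zero i⟩

theorem continuous_xi : Continuous (P.xi i) := by
  have : P.xi i = ((h.strictMono_phi h1 hn).orderIsoOfSurjective _
      (h.surjective_phi h1 hn)).symm := by
    funext y
    obtain ⟨s, rfl⟩ := h.surjective_phi h1 hn y
    rw [h.xi_phi h1 hn, StrictMono.orderIsoOfSurjective_symm_apply_self]
  rw [this]
  exact OrderIso.continuous _

theorem mul_phi_sub_pos {x ξ : ℝ} (hx : x ≠ ξ) : 0 < (x - ξ) * (P.phi i x - P.phi i ξ) := by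
  rcases lt_or_gt_of_ne hx with h' | h'
  · exact mul_pos_of_neg_of_neg (by linarith) (by linarith [h.strictMono_phi h1 hn h'])
  · exact mul_pos (by linarith) (by linarith [h.strictMono_phi h1 hn h'])

end Regular

variable (P) in
/-- The partial derivative `σ_i`, as a function of `z_i` and `ξ_i`. -/
noncomputable def sg (i : ℕ) (x ξ : ℝ) : ℝ :=
  P.beta0 i * (spow (P.m0 i) x - spow (P.m0 i) ξ) +
    P.betaInf i * (spow (P.mInf i) x - spow (P.mInf i) ξ)

variable (P) in
/-- The derivative of `β_{0,i} ⌈ξ_i⌋^{m₀} + β_{∞,i} ⌈ξ_i⌋^{m_∞}` with respect to `z_{i+1}`. -/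
noncomputable def slope (i : ℕ) (ξ : ℝ) : ℝ :=
  (P.beta0 i * (P.m0 i * |ξ| ^ (P.m0 i - P.e0 i)) +
    P.betaInf i * (P.mInf i * |ξ| ^ (P.mInf i - P.e0 i))) /
    (P.kappa i * P.e0 i + P.theta i * P.eInf i * |ξ| ^ (P.eInf i - P.e0 i))

variable (P) in
/-- The partial derivative `s_i`, as a function of `z_i` and `ξ_i`. -/
noncomputable def sp (i : ℕ) (x ξ : ℝ) : ℝ := -(x - ξ) * P.slope i ξ

theorem sg_self (i : ℕ) (x : ℝ) : P.sg i x x = 0 := by simp [sg]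

theorem sp_self (i : ℕ) (x : ℝ) : P.sp i x x = 0 := by simp [sp]

theorem Regular.strictMono_sg (h : P.Regular) {i : ℕ} (h1 : 1 ≤ i) (hn : i ≤ P.n) (ξ : ℝ) :
    StrictMono fun x => P.sg i x ξ := by
  have := strictMono_combination (strictMono_spow (h.m0_pos i h1 hn))
    (strictMono_spow (h.mInf_pos h1 hn)) (h.beta0_nonneg i h1 hn) (h.betaInf_nonneg i h1 hn)
    (h.beta_pos i h1 hn)
  intro x y hxy
  have := this hxy
  simp only [sg] at this ⊢
  linarith

theorem Regular.mul_sg_pos (h : P.Regular) {i : ℕ} (h1 : 1 ≤ i) (hn : i ≤ P.n) {x ξ : ℝ}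
    (hx : x ≠ ξ) : 0 < (x - ξ) * P.sg i x ξ := by
  rcases lt_or_gt_of_ne hx with h' | h'
  · have := h.strictMono_sg h1 hn ξ h'
    simp only [sg_self] at this
    exact mul_pos_of_neg_of_neg (by linarith) this
  · have := h.strictMono_sg h1 hn ξ h'
    simp only [sg_self] at this
    exact mul_pos (by linarith) this

theorem Regular.den_pos (h : P.Regular) {i : ℕ} (h1 : 1 ≤ i) (hn : i < P.n) {x ξ : ℝ}
    (hx : x ≠ ξ) : 0 < P.sg i x ξ * (P.phi i x - P.phi i ξ) := by
  have a := h.mul_sg_pos h1 hn.le hx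
  have b := h.mul_phi_sub_pos h1 hn hx
  have c : 0 < (x - ξ) ^ 2 := by have := sub_ne_zero.2 hx; positivity
  have : 0 < (x - ξ) ^ 2 * (P.sg i x ξ * (P.phi i x - P.phi i ξ)) := by
    calc 0 < ((x - ξ) * P.sg i x ξ) * ((x - ξ) * (P.phi i x - P.phi i ξ)) := mul_pos a b
      _ = _ := by ring
  exact (pos_iff_pos_of_mul_pos this).1 c


/-! ### Partial derivatives of `Z_i` -/

theorem Zterm_eq {p r : ℝ} (hr : 0 < r) (β x ξ : ℝ) :
    Zterm β p r x ξ = β * (1 / ((p - r) / r + 1) * |x| ^ ((p - r) / r + 1) -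
      x * spow ((p - r) / r) ξ +
      (p - r) / r / ((p - r) / r + 1) * |ξ| ^ ((p - r) / r + 1)) := by
  have h1 : (p - r) / r + 1 = p / r := by field_simp; ring
  rw [Zterm, h1, one_div_div, div_div_div_cancel_right₀ hr.ne']

theorem hasDerivAt_Zterm_left {p r : ℝ} (hr : 0 < r) (hq : 0 < (p - r) / r)
    (β x ξ : ℝ) : HasDerivAt (fun t => Zterm β p r t ξ)
      (β * (spow ((p - r) / r) x - spow ((p - r) / r) ξ)) x := by
  simp only [Zterm_eq hr]
  set q := (p - r) / r
  have h := ((hasDerivAt_abs_rpow_add_one hq x).const_mul (1 / (q + 1))).sub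
    ((hasDerivAt_id x).mul_const (spow q ξ))
  have h' := (h.add_const (q / (q + 1) * |ξ| ^ (q + 1))).const_mul β
  have hq1 : q + 1 ≠ 0 := by linarith
  refine h'.congr_deriv ?_
  field_simp

theorem Zterm_self {p r : ℝ} (hr : 0 < r) (hq : 0 < (p - r) / r) (β x : ℝ) :
    Zterm β p r x x = 0 := by
  rw [Zterm_eq hr, mul_spow_self hq]
  have hq1 : (p - r) / r + 1 ≠ 0 := by linarith
  set q := (p - r) / r
  field_simp
  ring

variable (P) in
/-- The function `Z_i`, as a function of `z_i` and `ξ_i`. -/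
noncomputable def Zxi (i : ℕ) (x ξ : ℝ) : ℝ :=
  Zterm (P.beta0 i) P.p0 (P.r0 i) x ξ + Zterm (P.betaInf i) P.pInf (P.rInf i) x ξ

theorem Exponents.hasDerivAt_Zxi (h : P.Exponents) {i : ℕ} (h1 : 1 ≤ i) (hn : i ≤ P.n) (x ξ : ℝ) :
    HasDerivAt (fun t => P.Zxi i t ξ) (P.sg i x ξ) x :=
  (hasDerivAt_Zterm_left (h.r0_pos i h1 hn) (h.m0_pos i h1 hn) _ _ _).add
    (hasDerivAt_Zterm_left (h.rInf_pos i h1 hn) (h.mInf_pos h1 hn) _ _ _)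

theorem Exponents.Zxi_self (h : P.Exponents) {i : ℕ} (h1 : 1 ≤ i) (hn : i ≤ P.n) (x : ℝ) :
    P.Zxi i x x = 0 := by
  rw [Zxi, Zterm_self (h.r0_pos i h1 hn) (h.m0_pos i h1 hn),
    Zterm_self (h.rInf_pos i h1 hn) (h.mInf_pos h1 hn), add_zero]

theorem Regular.Zxi_pos (h : P.Regular) {i : ℕ} (h1 : 1 ≤ i) (hn : i ≤ P.n) {x ξ : ℝ}
    (hx : x ≠ ξ) : 0 < P.Zxi i x ξ := by
  have hd := fun t => h.hasDerivAt_Zxi h1 hn t ξ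
  have hc : Continuous fun t => P.Zxi i t ξ :=
    continuous_iff_continuousAt.2 fun t => (hd t).continuousAt
  rw [← h.Zxi_self h1 hn ξ]
  rcases lt_or_gt_of_ne hx with h' | h'
  · refine strictAntiOn_of_deriv_neg (convex_Iic ξ) hc.continuousOn ?_ h'.le self_mem_Iic h'
    intro t ht
    rw [interior_Iic] at ht
    rw [(hd t).deriv]
    have := h.strictMono_sg h1 hn ξ ht
    simpa only [sg_self] using this
  · refine strictMonoOn_of_deriv_pos (convex_Ici ξ) hc.continuousOn ?_ self_mem_Ici h'.le h'
    intro t ht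
    rw [interior_Ici] at ht
    rw [(hd t).deriv]
    have := h.strictMono_sg h1 hn ξ ht
    simpa only [sg_self] using this

theorem Regular.Zxi_nonneg (h : P.Regular) {i : ℕ} (h1 : 1 ≤ i) (hn : i ≤ P.n) (x ξ : ℝ) :
    0 ≤ P.Zxi i x ξ := by
  rcases eq_or_ne x ξ with rfl | hx
  · rw [h.Zxi_self h1 hn]
  · exact (h.Zxi_pos h1 hn hx).le

theorem Exponents.hasDerivAt_Z_left (h : P.Exponents) {i : ℕ} (h1 : 1 ≤ i) (hn : i ≤ P.n)
    (x y : ℝ) : HasDerivAt (fun t => P.Z i t y) (P.sg i x (P.xi i y)) x :=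
  h.hasDerivAt_Zxi h1 hn x (P.xi i y)

theorem Exponents.sigma_eq (h : P.Exponents) {i : ℕ} (h1 : 1 ≤ i) (hn : i ≤ P.n) (x y : ℝ) :
    P.sigma i x y = P.sg i x (P.xi i y) := (h.hasDerivAt_Z_left h1 hn x y).deriv

section xiDeriv

variable {Δ : ℝ} (hP : P.Valid Δ) {i : ℕ} (h1 : 1 ≤ i) (hn : i < P.n)
include hP h1 hn

theorem Valid.slope_denom_pos (ξ : ℝ) :
    0 < P.kappa i * P.e0 i + P.theta i * P.eInf i * |ξ| ^ (P.eInf i - P.e0 i) := by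
  have a := hP.kappa_pos i (Finset.mem_Icc.2 ⟨h1, hn.le⟩)
  have b := hP.theta_pos i (Finset.mem_Icc.2 ⟨h1, hn.le⟩)
  have c := hP.exponents.e0_pos i h1 hn
  have d := hP.exponents.eInf_pos h1 hn
  positivity

theorem Valid.hasDerivAt_xi {y : ℝ} (hy : y ≠ 0) :
    HasDerivAt (P.xi i) (|P.xi i y| ^ (1 - P.e0 i) /
      (P.kappa i * P.e0 i + P.theta i * P.eInf i * |P.xi i y| ^ (P.eInf i - P.e0 i))) y := by
  have hR := hP.regular
  have hξ : P.xi i y ≠ 0 := fun h0 => hy (by rw [← hR.phi_xi h1 hn y, h0, phi_zero])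
  have hpos : 0 < |P.xi i y| := abs_pos.2 hξ
  have hφ : HasDerivAt (P.phi i) (P.kappa i * (P.e0 i * |P.xi i y| ^ (P.e0 i - 1)) +
      P.theta i * (P.eInf i * |P.xi i y| ^ (P.eInf i - 1))) (P.xi i y) :=
    ((hasDerivAt_spow (P.e0 i) hξ).const_mul _).add ((hasDerivAt_spow (P.eInf i) hξ).const_mul _)
  have hD := hP.slope_denom_pos h1 hn (P.xi i y)
  have e1 : P.kappa i * (P.e0 i * |P.xi i y| ^ (P.e0 i - 1)) +
      P.theta i * (P.eInf i * |P.xi i y| ^ (P.eInf i - 1)) =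
      (P.kappa i * P.e0 i + P.theta i * P.eInf i * |P.xi i y| ^ (P.eInf i - P.e0 i)) *
        |P.xi i y| ^ (P.e0 i - 1) := by
    have : |P.xi i y| ^ (P.eInf i - 1) =
        |P.xi i y| ^ (P.eInf i - P.e0 i) * |P.xi i y| ^ (P.e0 i - 1) := by
      rw [← Real.rpow_add hpos]; congr 1; ring
    rw [this]; ring
  rw [e1] at hφ
  have := HasDerivAt.of_local_left_inverse (hR.continuous_xi h1 hn).continuousAt hφ
    (mul_pos hD (Real.rpow_pos_of_pos hpos _)).ne' (Eventually.of_forall (hR.phi_xi h1 hn))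
  refine this.congr_deriv ?_
  rw [mul_inv, ← Real.rpow_neg hpos.le, div_eq_mul_inv, mul_comm, neg_sub]

theorem Valid.continuous_xiPowDeriv {q : ℝ} (hq : P.eInf i ≤ q) :
    Continuous fun y => q * |P.xi i y| ^ (q - P.e0 i) /
      (P.kappa i * P.e0 i + P.theta i * P.eInf i * |P.xi i y| ^ (P.eInf i - P.e0 i)) := by
  have hξ := (hP.regular.continuous_xi h1 hn)
  have hle := hP.exponents.e0_le i h1 hn.le
  refine Continuous.div (((continuous_abs_rpow (by linarith)).comp hξ).const_mul _) ?_
    fun y => (hP.slope_denom_pos h1 hn _).ne'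
  exact continuous_const.add (((continuous_abs_rpow (by linarith)).comp hξ).const_mul _)

theorem Valid.hasDerivAt_spow_xi {q : ℝ} (hq : P.eInf i ≤ q) (y : ℝ) :
    HasDerivAt (fun y => spow q (P.xi i y)) (q * |P.xi i y| ^ (q - P.e0 i) /
      (P.kappa i * P.e0 i + P.theta i * P.eInf i * |P.xi i y| ^ (P.eInf i - P.e0 i))) y := by
  have hξ := (hP.regular.continuous_xi h1 hn)
  have hq0 : 0 < q := (hP.exponents.eInf_pos h1 hn).trans_le hq
  refine hasDerivAt_of_hasDerivAt_of_ne' (x := 0)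
    (g := fun y => q * |P.xi i y| ^ (q - P.e0 i) /
      (P.kappa i * P.e0 i + P.theta i * P.eInf i * |P.xi i y| ^ (P.eInf i - P.e0 i))) ?_
    ((continuous_spow hq0).comp hξ).continuousAt
    (hP.continuous_xiPowDeriv h1 hn hq).continuousAt y
  intro y hy
  have hξ0 : P.xi i y ≠ 0 := fun h0 => hy (by rw [← hP.regular.phi_xi h1 hn y, h0, phi_zero])
  refine ((hasDerivAt_spow q hξ0).comp y (hP.hasDerivAt_xi h1 hn hy)).congr_deriv ?_
  rw [show q - P.e0 i = (q - 1) + (1 - P.e0 i) by ring, Real.rpow_add (abs_pos.2 hξ0)]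
  ring

theorem Valid.hasDerivAt_abs_xi_rpow {q : ℝ} (hq : P.eInf i ≤ q) (y : ℝ) :
    HasDerivAt (fun y => |P.xi i y| ^ (q + 1)) ((q + 1) * (P.xi i y *
      (|P.xi i y| ^ (q - P.e0 i) /
      (P.kappa i * P.e0 i + P.theta i * P.eInf i * |P.xi i y| ^ (P.eInf i - P.e0 i))))) y := by
  have hξ := (hP.regular.continuous_xi h1 hn)
  have hq0 : 0 < q := (hP.exponents.eInf_pos h1 hn).trans_le hq
  refine hasDerivAt_of_hasDerivAt_of_ne' (x := 0)
    (g := fun y => (q + 1) * (P.xi i y * (|P.xi i y| ^ (q - P.e0 i) /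
      (P.kappa i * P.e0 i + P.theta i * P.eInf i * |P.xi i y| ^ (P.eInf i - P.e0 i))))) ?_
    ((continuous_abs_rpow (by linarith)).comp hξ).continuousAt ?_ y
  · intro y hy
    have hξ0 : P.xi i y ≠ 0 := fun h0 => hy (by rw [← hP.regular.phi_xi h1 hn y, h0, phi_zero])
    refine ((hasDerivAt_abs_rpow_add_one hq0 (P.xi i y)).comp y
      (hP.hasDerivAt_xi h1 hn hy)).congr_deriv ?_
    rw [show q - P.e0 i = (q - 1) + (1 - P.e0 i) by ring, Real.rpow_add (abs_pos.2 hξ0),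
      ← abs_rpow_mul_self q]
    ring
  · have := (hP.continuous_xiPowDeriv h1 hn hq).const_mul ((q + 1) / q)
    refine (((hξ.mul this).congr fun y => ?_).continuousAt)
    rw [Pi.mul_apply]
    field_simp

theorem Valid.hasDerivAt_Zterm_right {β p r : ℝ} (hr : 0 < r)
    (hq : P.eInf i ≤ (p - r) / r) (x y : ℝ) :
    HasDerivAt (fun t => Zterm β p r x (P.xi i t)) (-(x - P.xi i y) *
      (β * ((p - r) / r * |P.xi i y| ^ ((p - r) / r - P.e0 i)) /
      (P.kappa i * P.e0 i + P.theta i * P.eInf i * |P.xi i y| ^ (P.eInf i - P.e0 i)))) y := by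
  simp only [Zterm_eq hr]
  have hq0 : 0 < (p - r) / r := (hP.exponents.eInf_pos h1 hn).trans_le hq
  set q := (p - r) / r
  have h := (((hP.hasDerivAt_spow_xi h1 hn hq y).const_mul x).const_sub
    (1 / (q + 1) * |x| ^ (q + 1))).add
    ((hP.hasDerivAt_abs_xi_rpow h1 hn hq y).const_mul (q / (q + 1)))
  refine (h.const_mul β).congr_deriv ?_
  have hq1 : q + 1 ≠ 0 := by linarith
  have hD := (hP.slope_denom_pos h1 hn (P.xi i y)).ne'
  field_simp
  ring

theorem Valid.hasDerivAt_Z_right (x y : ℝ) :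
    HasDerivAt (fun t => P.Z i x t) (P.sp i x (P.xi i y)) y := by
  have hE := hP.exponents
  refine ((hP.hasDerivAt_Zterm_right h1 hn (β := P.beta0 i) (hE.r0_pos i h1 hn.le)
    (hE.le_m0 i h1 hn.le) x y).add (hP.hasDerivAt_Zterm_right h1 hn (β := P.betaInf i)
    (hE.rInf_pos i h1 hn.le)
    ((hE.le_m0 i h1 hn.le).trans (hE.m0_lt i h1 hn.le).le) x y)).congr_deriv ?_
  rw [sp, slope]
  ring

theorem Valid.sPart_eq (x y : ℝ) : P.sPart i x y = P.sp i x (P.xi i y) :=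
  (hP.hasDerivAt_Z_right h1 hn x y).deriv

theorem Valid.contDiff_spow_xi {q : ℝ} (hq : P.eInf i ≤ q) :
    ContDiff ℝ 1 fun y => spow q (P.xi i y) := by
  rw [contDiff_one_iff_deriv]
  refine ⟨fun y => (hP.hasDerivAt_spow_xi h1 hn hq y).differentiableAt, ?_⟩
  rw [funext fun y => (hP.hasDerivAt_spow_xi h1 hn hq y).deriv]
  exact hP.continuous_xiPowDeriv h1 hn hq

theorem Valid.contDiff_abs_xi_rpow {q : ℝ} (hq : P.eInf i ≤ q) :
    ContDiff ℝ 1 fun y => |P.xi i y| ^ (q + 1) := by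
  have hq0 : 0 < q := (hP.exponents.eInf_pos h1 hn).trans_le hq
  rw [contDiff_one_iff_deriv]
  refine ⟨fun y => (hP.hasDerivAt_abs_xi_rpow h1 hn hq y).differentiableAt, ?_⟩
  rw [funext fun y => (hP.hasDerivAt_abs_xi_rpow h1 hn hq y).deriv]
  have := (hP.continuous_xiPowDeriv h1 hn hq).const_mul ((q + 1) / q)
  refine ((hP.regular.continuous_xi h1 hn).mul this).congr fun y => ?_
  rw [Pi.mul_apply]
  field_simp

end xiDeriv

theorem contDiff_abs_rpow_add_one {q : ℝ} (hq : 0 < q) :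
    ContDiff ℝ 1 fun x : ℝ => |x| ^ (q + 1) := by
  rw [contDiff_one_iff_deriv]
  refine ⟨fun y => (hasDerivAt_abs_rpow_add_one hq y).differentiableAt, ?_⟩
  rw [funext fun y => (hasDerivAt_abs_rpow_add_one hq y).deriv]
  exact (continuous_spow hq).const_mul _

theorem xi_last (y : ℝ) : P.xi P.n y = 0 := by simp [xi]

theorem Valid.contDiff_Zterm {Δ : ℝ} (hP : P.Valid Δ) {i : ℕ} (h1 : 1 ≤ i) (hn : i ≤ P.n)
    {β p r : ℝ} (hr : 0 < r) (hq : P.eInf i ≤ (p - r) / r) (hq0 : 0 < (p - r) / r) :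
    ContDiff ℝ 1 fun w : ℝ × ℝ => Zterm β p r w.1 (P.xi i w.2) := by
  simp only [Zterm_eq hr]
  have hx := ((contDiff_abs_rpow_add_one hq0).comp (contDiff_fst (𝕜 := ℝ) (E := ℝ) (F := ℝ)))
  rcases hn.eq_or_lt with rfl | hn
  · simp only [xi_last, spow_zero_right, mul_zero, sub_zero]
    exact contDiff_const.mul ((contDiff_const.mul hx).add contDiff_const)
  · refine contDiff_const.mul (((contDiff_const.mul hx).sub (contDiff_fst.mul ?_)).add
      (contDiff_const.mul ?_))
    · exact (hP.contDiff_spow_xi h1 hn hq).comp contDiff_snd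
    · exact (hP.contDiff_abs_xi_rpow h1 hn hq).comp contDiff_snd

theorem Valid.contDiff_Z {Δ : ℝ} (hP : P.Valid Δ) {i : ℕ} (h1 : 1 ≤ i) (hn : i ≤ P.n) :
    ContDiff ℝ 1 fun w : ℝ × ℝ => P.Z i w.1 w.2 := by
  have hE := hP.exponents
  exact (hP.contDiff_Zterm h1 hn (hE.r0_pos i h1 hn) (hE.le_m0 i h1 hn)
    (hE.m0_pos i h1 hn)).add (hP.contDiff_Zterm h1 hn (hE.rInf_pos i h1 hn)
    ((hE.le_m0 i h1 hn).trans (hE.m0_lt i h1 hn).le) (hE.mInf_pos h1 hn))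

end DiffParams

/-- Single-valued parametrization of the set-valued signed power by a number `w ∈ [-1, 1]` that
matters only for the exponent `0`. -/
noncomputable def ssel (p s w : ℝ) : ℝ := if p = 0 then w else spow p s

theorem mem_spowSet_iff {p s e : ℝ} : e ∈ spowSet p s ↔
    ∃ w ∈ Icc (-1 : ℝ) 1, (p = 0 → w * s = |s|) ∧ e = ssel p s w := by
  by_cases hp : p = 0
  · subst hp
    rw [spowSet_eq_of_zero]
    simp only [ssel, if_true, forall_const, mem_ofPred_eq, mem_Icc, ← abs_le]
    constructor
    · rintro ⟨h1, h2⟩; exact ⟨e, h1, h2, rfl⟩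
    · rintro ⟨w, h1, h2, rfl⟩; exact ⟨h1, h2⟩
  · rw [spowSet_of_ne (Or.inr hp)]
    simp only [ssel, mem_singleton_iff, hp, false_imp_iff, true_and]
    constructor
    · rintro rfl; exact ⟨0, by norm_num, rfl⟩
    · rintro ⟨w, -, rfl⟩; rfl

theorem ssel_mul_of_pos (p : ℝ) {ρ : ℝ} (hρ : 0 < ρ) (s w : ℝ) :
    ssel p (ρ * s) w = ρ ^ p * ssel p s w := by
  unfold ssel
  split_ifs with h
  · rw [h, Real.rpow_zero, one_mul]
  · exact spow_mul_of_pos p hρ s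

theorem abs_mul_rpow {ρ : ℝ} (hρ : 0 < ρ) (x q : ℝ) : |ρ * x| ^ q = ρ ^ q * |x| ^ q := by
  rw [abs_mul, abs_of_pos hρ, Real.mul_rpow hρ.le (abs_nonneg _)]

namespace DiffParams

variable {P : DiffParams}

theorem chain_of_lt {i j : ℕ} (h : j < i) (s : ℝ) : P.chain i j s = s := by
  cases j with
  | zero => rfl
  | succ j => rw [chain, if_neg (by omega)]

theorem chain_succ {i j : ℕ} (h : i ≤ j + 1) (s : ℝ) :
    P.chain i (j + 1) s = P.phi (j + 1) (P.chain i j s) := by rw [chain, if_pos h]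

theorem chain_self {i : ℕ} (h : 1 ≤ i) (s : ℝ) : P.chain i i s = P.phi i s := by
  obtain ⟨k, rfl⟩ := Nat.exists_eq_add_of_le' h
  rw [chain_succ le_rfl, chain_of_lt (by omega)]

theorem chain_head {i j : ℕ} (h : 1 ≤ i) (hij : i ≤ j) (s : ℝ) :
    P.chain i j s = P.chain (i + 1) j (P.phi i s) := by
  induction j, hij using Nat.le_induction with
  | base => rw [chain_self h, chain_of_lt (by omega)]
  | succ j hj ih => rw [chain_succ (by omega), chain_succ (by omega), ih]

theorem chain_zero (i j : ℕ) : P.chain i j 0 = 0 := by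
  induction j with
  | zero => rfl
  | succ j ih => rw [chain, ih, phi_zero, ite_self]

theorem Regular.strictMono_chain (h : P.Regular) (i : ℕ) {j : ℕ} (hj : j < P.n) :
    StrictMono (P.chain i j) := by
  induction j with
  | zero => exact strictMono_id
  | succ j ih =>
    rcases lt_or_ge (j + 1) i with hi | hi
    · intro s t hst
      rwa [chain_of_lt hi, chain_of_lt hi]
    · intro s t hst
      rw [chain_succ hi, chain_succ hi]
      exact h.strictMono_phi (by omega) hj (ih (by omega) hst)

theorem Regular.mul_abs_chain_iff (h : P.Regular) (i : ℕ) {j : ℕ} (hj : j < P.n) (w s : ℝ) :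
    w * P.chain i j s = |P.chain i j s| ↔ w * s = |s| := by
  have hm := h.strictMono_chain i hj
  rcases lt_trichotomy s 0 with hs | rfl | hs
  · have hc := hm hs
    rw [chain_zero] at hc
    rw [abs_of_neg hs, abs_of_neg hc, ← neg_one_mul, ← neg_one_mul s, mul_left_inj' hc.ne,
      mul_left_inj' hs.ne]
  · simp [chain_zero]
  · have hc := hm hs
    rw [chain_zero] at hc
    have e1 := mul_left_inj' (a := w) (b := 1) hc.ne'
    have e2 := mul_left_inj' (a := w) (b := 1) hs.ne'
    rw [one_mul] at e1 e2
    rw [abs_of_pos hs, abs_of_pos hc, e1, e2]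

variable (P) in
/-- The selection of the set-valued term `φ_n(s) - D [-1, 1]` belonging to the parameters `w`. -/
noncomputable def lastVal (D s : ℝ) (w : ℝ × ℝ × ℝ) : ℝ :=
  P.kappa P.n * ssel (P.e0 P.n) s w.1 + P.theta P.n * ssel (P.eInf P.n) s w.2.1 - D * w.2.2

variable (P) in
/-- The value of `φ_j ∘ ⋯ ∘ φ_i`, with the selection `w` for `j = n`. -/
noncomputable def sel (D : ℝ) (i : ℕ) (s : ℝ) (w : ℝ × ℝ × ℝ) (j : ℕ) : ℝ :=
  if j = P.n then P.lastVal D (P.chain i (P.n - 1) s) w else P.chain i j s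

variable (P) in
/-- The sum of the terms with index larger than `i` of `dV/dt`, where `φ_j ∘ ⋯ ∘ φ_i (z_i)`
replaces `φ_j ∘ ⋯ ∘ φ_1 (z_1)`. -/
noncomputable def num (D : ℝ) (kt : ℕ → ℝ) (i : ℕ) (z ξ : ℕ → ℝ) (w : ℝ × ℝ × ℝ) : ℝ :=
  ∑ j ∈ Finset.Icc (i + 1) P.n, kt j * (P.sp (j - 1) (z (j - 1)) (ξ (j - 1)) +
    P.sg j (z j) (ξ j)) * (z (j + 1) - P.sel D i (z i) w j)

variable (P) in
/-- The factor of `-k̃_i` in `dV/dt`. -/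
noncomputable def den (i : ℕ) (z ξ : ℕ → ℝ) : ℝ :=
  P.sg i (z i) (ξ i) * (P.phi i (z i) - z (i + 1))

variable (P) in
/-- The derivative of `∑_{j ≥ i} Z_j` along the tail of the error dynamics that starts at the
index `i`. -/
noncomputable def full (D : ℝ) (kt : ℕ → ℝ) (i : ℕ) (z ξ : ℕ → ℝ) (w : ℝ × ℝ × ℝ) : ℝ :=
  ∑ j ∈ Finset.Icc i P.n, kt j * ((if j = i then 0 else P.sp (j - 1) (z (j - 1)) (ξ (j - 1))) +
    P.sg j (z j) (ξ j)) * (z (j + 1) - P.sel D i (z i) w j)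

variable (P) in
/-- The variables `ξ_j = φ_j⁻¹(z_{j+1})` belong to the tail `z_i, …, z_n`, and `w` is an
admissible selection at `z_i`. -/
structure IsState (i : ℕ) (z ξ : ℕ → ℝ) (w : ℝ × ℝ × ℝ) : Prop where
  xi_last : ξ P.n = 0
  z_last : z (P.n + 1) = 0
  eq_phi : ∀ j, i ≤ j → j < P.n → z (j + 1) = P.phi j (ξ j)
  w1 : w.1 ∈ Icc (-1 : ℝ) 1
  w2 : w.2.1 ∈ Icc (-1 : ℝ) 1
  w3 : w.2.2 ∈ Icc (-1 : ℝ) 1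
  sel0 : P.e0 P.n = 0 → w.1 * z i = |z i|
  selInf : P.eInf P.n = 0 → w.2.1 * z i = |z i|

theorem full_eq (D : ℝ) (kt : ℕ → ℝ) {i : ℕ} (h1 : 1 ≤ i) (hn : i < P.n) (z ξ : ℕ → ℝ)
    (w : ℝ × ℝ × ℝ) : P.full D kt i z ξ w = P.num D kt i z ξ w - kt i * P.den i z ξ := by
  have hI : Finset.Icc i P.n = insert i (Finset.Icc (i + 1) P.n) := by
    ext j; simp only [Finset.mem_Icc, Finset.mem_insert]; omega
  rw [full, hI, Finset.sum_insert (by simp), if_pos rfl, num, den, sel, if_neg hn.ne,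
    chain_self h1]
  rw [Finset.sum_congr rfl fun j hj => by
    rw [if_neg (show j ≠ i by rw [Finset.mem_Icc] at hj; omega)]]
  ring

theorem full_last (D : ℝ) (kt : ℕ → ℝ) (z ξ : ℕ → ℝ) (w : ℝ × ℝ × ℝ) (h : 1 ≤ P.n) :
    P.full D kt P.n z ξ w =
      kt P.n * P.sg P.n (z P.n) (ξ P.n) * (z (P.n + 1) - P.lastVal D (z P.n) w) := by
  simp [full, sel, chain_of_lt (show P.n - 1 < P.n by omega)]

theorem num_eq_full_succ (D : ℝ) (kt : ℕ → ℝ) {i : ℕ} (h1 : 1 ≤ i) {z ξ : ℕ → ℝ}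
    (w : ℝ × ℝ × ℝ) (hz : z i = ξ i) (hξ : z (i + 1) = P.phi i (ξ i)) :
    P.num D kt i z ξ w = P.full D kt (i + 1) z ξ w := by
  refine Finset.sum_congr rfl fun j hj => ?_
  rw [Finset.mem_Icc] at hj
  have hs : P.sel D i (z i) w j = P.sel D (i + 1) (z (i + 1)) w j := by
    rw [sel, sel, hξ, ← hz]
    split_ifs with hjn
    · rw [chain_head h1 (by omega)]
    · rw [chain_head h1 (by omega)]
  rw [hs]
  split_ifs with hji
  · subst hji
    rw [Nat.add_sub_cancel, hz, sp_self]
  · rfl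

theorem IsState.succ (hR : P.Regular) {i : ℕ} (h1 : 1 ≤ i) (hn : i < P.n) {z ξ : ℕ → ℝ}
    {w : ℝ × ℝ × ℝ} (h : P.IsState i z ξ w) (hz : z i = ξ i) : P.IsState (i + 1) z ξ w := by
  have key : ∀ a, a * z i = |z i| → a * z (i + 1) = |z (i + 1)| := by
    intro a ha
    rw [h.eq_phi i le_rfl hn, ← hz, ← chain_self h1]
    exact (hR.mul_abs_chain_iff i hn _ _).2 ha
  exact ⟨h.xi_last, h.z_last, fun j hj => h.eq_phi j (by omega), h.w1, h.w2, h.w3,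
    fun h0 => key _ (h.sel0 h0), fun h0 => key _ (h.selInf h0)⟩

theorem IsState.den_eq {i : ℕ} (hn : i < P.n) {z ξ : ℕ → ℝ}
    {w : ℝ × ℝ × ℝ} (h : P.IsState i z ξ w) :
    P.den i z ξ = P.sg i (z i) (ξ i) * (P.phi i (z i) - P.phi i (ξ i)) := by
  rw [den, h.eq_phi i le_rfl hn]

theorem IsState.den_nonneg (hR : P.Regular) {i : ℕ} (h1 : 1 ≤ i) (hn : i < P.n) {z ξ : ℕ → ℝ}
    {w : ℝ × ℝ × ℝ} (h : P.IsState i z ξ w) : 0 ≤ P.den i z ξ := by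
  rw [h.den_eq hn]
  rcases eq_or_ne (z i) (ξ i) with hz | hz
  · rw [hz, sg_self, zero_mul]
  · exact (hR.den_pos h1 hn hz).le

theorem IsState.eq_of_den_eq_zero (hR : P.Regular) {i : ℕ} (h1 : 1 ≤ i) (hn : i < P.n)
    {z ξ : ℕ → ℝ} {w : ℝ × ℝ × ℝ} (h : P.IsState i z ξ w) (h0 : P.den i z ξ = 0) :
    z i = ξ i := by
  by_contra hz
  rw [h.den_eq hn] at h0
  exact (hR.den_pos h1 hn hz).ne' h0

theorem IsState.xi_eq_zero (hR : P.Regular) {i : ℕ} (h1 : 1 ≤ i) {z ξ : ℕ → ℝ}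
    {w : ℝ × ℝ × ℝ} (h : P.IsState i z ξ w) (hz : ∀ j, i ≤ j → j ≤ P.n → z j = 0) :
    ∀ j, i ≤ j → j ≤ P.n → ξ j = 0 := by
  intro j hij hj
  rcases hj.eq_or_lt with rfl | hj
  · exact h.xi_last
  · rw [← hR.phi_eq_zero (by omega) hj, ← h.eq_phi j hij hj, hz (j + 1) (by omega) hj]

end DiffParams

namespace DiffParams

/-- The coefficients of the error dynamics and of the Lyapunov function, with `D` in the role of
`Δ / k_n`. -/
structure Coeffs where
  kappa : ℕ → ℝ
  theta : ℕ → ℝ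
  beta0 : ℕ → ℝ
  betaInf : ℕ → ℝ
  D : ℝ

/-- The same exponents with other coefficients. -/
def withCoeffs (P : DiffParams) (C : Coeffs) : DiffParams :=
  { P with kappa := C.kappa, theta := C.theta, beta0 := C.beta0, betaInf := C.betaInf }

/-- The coefficients of `P`. -/
def coeffs (P : DiffParams) (D : ℝ) : Coeffs := ⟨P.kappa, P.theta, P.beta0, P.betaInf, D⟩

/-- The coefficients `C'` arise from `C` by the change of variables `z_j = ρ_j x_j`. -/
structure Scaling (P : DiffParams) (C C' : Coeffs) (ρ : ℕ → ℝ) (l c : ℝ) : Prop where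
  rho_pos : ∀ j, 0 < ρ j
  l_pos : 0 < l
  c_pos : 0 < c
  rho_succ : ∀ j, ρ (j + 1) = c * ρ j
  kappa : ∀ j, 1 ≤ j → j ≤ P.n → C.kappa j * ρ j ^ P.e0 j = ρ (j + 1) * C'.kappa j
  theta : ∀ j, 1 ≤ j → j ≤ P.n → C.theta j * ρ j ^ P.eInf j = ρ (j + 1) * C'.theta j
  beta0 : ∀ j, 1 ≤ j → j ≤ P.n → C.beta0 j * ρ j ^ P.m0 j * ρ j = l * C'.beta0 j
  betaInf : ∀ j, 1 ≤ j → j ≤ P.n → C.betaInf j * ρ j ^ P.mInf j * ρ j = l * C'.betaInf j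
  D_eq : C.D = ρ (P.n + 1) * C'.D

namespace Scaling

variable {P : DiffParams} {C C' : Coeffs} {ρ : ℕ → ℝ} {l c : ℝ}

theorem symm (h : Scaling P C C' ρ l c) : Scaling P C' C (fun j => (ρ j)⁻¹) l⁻¹ c⁻¹ := by
  have hρ := h.rho_pos
  refine ⟨fun j => inv_pos.2 (hρ j), inv_pos.2 h.l_pos, inv_pos.2 h.c_pos, fun j => ?_, ?_, ?_,
    ?_, ?_, ?_⟩
  · rw [h.rho_succ, mul_inv]
  · intro j h1 hn
    have := h.kappa j h1 hn
    have h2 := (Real.rpow_pos_of_pos (hρ j) (P.e0 j)).ne'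
    have h3 := (hρ (j + 1)).ne'
    rw [Real.inv_rpow (hρ j).le]
    field_simp
    linarith
  · intro j h1 hn
    have := h.theta j h1 hn
    have h2 := (Real.rpow_pos_of_pos (hρ j) (P.eInf j)).ne'
    have h3 := (hρ (j + 1)).ne'
    rw [Real.inv_rpow (hρ j).le]
    field_simp
    linarith
  · intro j h1 hn
    have := h.beta0 j h1 hn
    have h2 := (Real.rpow_pos_of_pos (hρ j) (P.m0 j)).ne'
    have h3 := (hρ j).ne'
    have h4 := h.l_pos.ne'
    rw [Real.inv_rpow (hρ j).le]
    field_simp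
    linarith
  · intro j h1 hn
    have := h.betaInf j h1 hn
    have h2 := (Real.rpow_pos_of_pos (hρ j) (P.mInf j)).ne'
    have h3 := (hρ j).ne'
    have h4 := h.l_pos.ne'
    rw [Real.inv_rpow (hρ j).le]
    field_simp
    linarith
  · have h3 := (hρ (P.n + 1)).ne'
    rw [h.D_eq]
    field_simp

variable (h : Scaling P C C' ρ l c)
include h

theorem phi {j : ℕ} (h1 : 1 ≤ j) (hn : j ≤ P.n) (s : ℝ) :
    (P.withCoeffs C).phi j (ρ j * s) = ρ (j + 1) * (P.withCoeffs C').phi j s := by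
  change C.kappa j * spow (P.e0 j) _ + C.theta j * spow (P.eInf j) _ =
    ρ (j + 1) * (C'.kappa j * spow (P.e0 j) s + C'.theta j * spow (P.eInf j) s)
  rw [spow_mul_of_pos _ (h.rho_pos j), spow_mul_of_pos _ (h.rho_pos j), mul_add, ← mul_assoc,
    ← mul_assoc, ← mul_assoc, ← mul_assoc, h.kappa j h1 hn, h.theta j h1 hn]

theorem chain {i j : ℕ} (h1 : 1 ≤ i) (hij : i ≤ j + 1) (hn : j ≤ P.n) (s : ℝ) :
    (P.withCoeffs C).chain i j (ρ i * s) = ρ (j + 1) * (P.withCoeffs C').chain i j s := by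
  induction j with
  | zero =>
    obtain rfl : i = 0 + 1 := by omega
    rfl
  | succ j ih =>
    rcases hij.eq_or_lt with rfl | hij
    · rw [chain_of_lt (by omega), chain_of_lt (by omega)]
    · rw [chain_succ (by omega), chain_succ (by omega), ih (by omega) (by omega),
        h.phi (by omega) hn]

theorem lastVal (hn : 1 ≤ P.n) (s : ℝ) (w : ℝ × ℝ × ℝ) :
    (P.withCoeffs C).lastVal C.D (ρ P.n * s) w =
      ρ (P.n + 1) * (P.withCoeffs C').lastVal C'.D s w := by
  change C.kappa P.n * ssel (P.e0 P.n) _ _ + C.theta P.n * ssel (P.eInf P.n) _ _ - C.D * w.2.2 =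
    ρ (P.n + 1) * (C'.kappa P.n * ssel (P.e0 P.n) s _ + C'.theta P.n * ssel (P.eInf P.n) s _ -
      C'.D * w.2.2)
  rw [ssel_mul_of_pos _ (h.rho_pos _), ssel_mul_of_pos _ (h.rho_pos _)]
  linear_combination ssel (P.e0 P.n) s w.1 * h.kappa _ hn le_rfl +
    ssel (P.eInf P.n) s w.2.1 * h.theta _ hn le_rfl - w.2.2 * h.D_eq

theorem sel (hn : 1 ≤ P.n) {i j : ℕ} (h1 : 1 ≤ i) (hij : i ≤ j) (hj : j ≤ P.n) (s : ℝ)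
    (w : ℝ × ℝ × ℝ) : (P.withCoeffs C).sel C.D i (ρ i * s) w j =
      ρ (j + 1) * (P.withCoeffs C').sel C'.D i s w j := by
  change (if j = P.n then (P.withCoeffs C).lastVal C.D ((P.withCoeffs C).chain i (P.n - 1) _) w
      else _) = _ * (if j = P.n then
        (P.withCoeffs C').lastVal C'.D ((P.withCoeffs C').chain i (P.n - 1) s) w else _)
  split_ifs with hjn
  · rw [h.chain h1 (by omega) (by omega), Nat.sub_add_cancel hn, h.lastVal hn, hjn]
  · exact h.chain h1 (by omega) hj s

theorem sg {j : ℕ} (h1 : 1 ≤ j) (hn : j ≤ P.n) (x ξ : ℝ) :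
    (P.withCoeffs C).sg j (ρ j * x) (ρ j * ξ) = l / ρ j * (P.withCoeffs C').sg j x ξ := by
  change C.beta0 j * (spow (P.m0 j) _ - spow (P.m0 j) _) +
    C.betaInf j * (spow (P.mInf j) _ - spow (P.mInf j) _) = l / ρ j *
    (C'.beta0 j * (spow (P.m0 j) x - spow (P.m0 j) ξ) +
      C'.betaInf j * (spow (P.mInf j) x - spow (P.mInf j) ξ))
  have h3 := (h.rho_pos j).ne'
  simp only [spow_mul_of_pos _ (h.rho_pos j)]
  have a : C.beta0 j * ρ j ^ P.m0 j = l / ρ j * C'.beta0 j := by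
    rw [div_mul_eq_mul_div, eq_div_iff h3, h.beta0 j h1 hn]
  have b : C.betaInf j * ρ j ^ P.mInf j = l / ρ j * C'.betaInf j := by
    rw [div_mul_eq_mul_div, eq_div_iff h3, h.betaInf j h1 hn]
  linear_combination (spow (P.m0 j) x - spow (P.m0 j) ξ) * a +
    (spow (P.mInf j) x - spow (P.mInf j) ξ) * b

theorem slope {j : ℕ} (h1 : 1 ≤ j) (hn : j ≤ P.n) (ξ : ℝ) :
    (P.withCoeffs C).slope j (ρ j * ξ) =
      l / (ρ j * ρ (j + 1)) * (P.withCoeffs C').slope j ξ := by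
  change (C.beta0 j * (P.m0 j * |ρ j * ξ| ^ (P.m0 j - P.e0 j)) +
      C.betaInf j * (P.mInf j * |ρ j * ξ| ^ (P.mInf j - P.e0 j))) /
      (C.kappa j * P.e0 j + C.theta j * P.eInf j * |ρ j * ξ| ^ (P.eInf j - P.e0 j)) =
    l / (ρ j * ρ (j + 1)) * ((C'.beta0 j * (P.m0 j * |ξ| ^ (P.m0 j - P.e0 j)) +
      C'.betaInf j * (P.mInf j * |ξ| ^ (P.mInf j - P.e0 j))) /
      (C'.kappa j * P.e0 j + C'.theta j * P.eInf j * |ξ| ^ (P.eInf j - P.e0 j)))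
  have hρ := h.rho_pos j
  have hρ1 := (h.rho_pos (j + 1)).ne'
  have hR := Real.rpow_pos_of_pos hρ (P.e0 j)
  simp only [abs_mul_rpow hρ, Real.rpow_sub hρ]
  have a := h.beta0 j h1 hn
  have b := h.betaInf j h1 hn
  have k := h.kappa j h1 hn
  have t := h.theta j h1 hn
  have hρ0 := hρ.ne'
  have hR0 := hR.ne'
  generalize |ξ| ^ (P.m0 j - P.e0 j) = X at *
  generalize |ξ| ^ (P.mInf j - P.e0 j) = Y at *
  generalize |ξ| ^ (P.eInf j - P.e0 j) = W at *
  generalize ρ j ^ P.e0 j = R at *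
  generalize ρ j ^ P.eInf j = S at *
  generalize ρ j ^ P.m0 j = M at *
  generalize ρ j ^ P.mInf j = N at *
  generalize P.m0 j = m0, P.mInf j = mI, P.e0 j = a0, P.eInf j = aI at *
  have e1 : C.beta0 j * (m0 * (M / R * X)) + C.betaInf j * (mI * (N / R * Y)) =
      l / (ρ j * R) * (C'.beta0 j * (m0 * X) + C'.betaInf j * (mI * Y)) := by
    field_simp
    linear_combination m0 * X * a + mI * Y * b
  have e2 : C.kappa j * a0 + C.theta j * aI * (S / R * W) =
      ρ (j + 1) / R * (C'.kappa j * a0 + C'.theta j * aI * W) := by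
    field_simp
    linear_combination a0 * k + aI * W * t
  rw [e1, e2, mul_div_mul_comm]
  congr 1
  field_simp

theorem sp {j : ℕ} (h1 : 1 ≤ j) (hn : j ≤ P.n) (x ξ : ℝ) :
    (P.withCoeffs C).sp j (ρ j * x) (ρ j * ξ) = l / ρ (j + 1) * (P.withCoeffs C').sp j x ξ := by
  rw [DiffParams.sp, DiffParams.sp, h.slope h1 hn]
  have h3 := (h.rho_pos j).ne'
  have h4 := (h.rho_pos (j + 1)).ne'
  field_simp

theorem Zxi (hE : P.Exponents) {j : ℕ} (h1 : 1 ≤ j) (hn : j ≤ P.n) (x ξ : ℝ) :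
    (P.withCoeffs C).Zxi j (ρ j * x) (ρ j * ξ) = l * (P.withCoeffs C').Zxi j x ξ := by
  change Zterm (C.beta0 j) P.p0 (P.r0 j) _ _ + Zterm (C.betaInf j) P.pInf (P.rInf j) _ _ =
    l * (Zterm (C'.beta0 j) P.p0 (P.r0 j) _ _ + Zterm (C'.betaInf j) P.pInf (P.rInf j) _ _)
  have a := h.beta0 j h1 hn
  have b := h.betaInf j h1 hn
  have hρ := h.rho_pos j
  simp only [Zterm_eq (hE.r0_pos j h1 hn), Zterm_eq (hE.rInf_pos j h1 hn), abs_mul_rpow hρ,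
    Real.rpow_add_one hρ.ne', spow_mul_of_pos _ hρ]
  linear_combination (1 / (P.m0 j + 1) * |x| ^ (P.m0 j + 1) - x * spow (P.m0 j) ξ +
    P.m0 j / (P.m0 j + 1) * |ξ| ^ (P.m0 j + 1)) * a + (1 / (P.mInf j + 1) * |x| ^ (P.mInf j + 1) -
    x * spow (P.mInf j) ξ + P.mInf j / (P.mInf j + 1) * |ξ| ^ (P.mInf j + 1)) * b

variable (hn : 1 ≤ P.n) {i : ℕ} (h1 : 1 ≤ i) {z ξ z' ξ' : ℕ → ℝ}
  (hz : ∀ j, i ≤ j → j ≤ P.n + 1 → z j = ρ j * z' j)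
  (hξ : ∀ j, i ≤ j → j ≤ P.n → ξ j = ρ j * ξ' j)
include hz hξ h1

theorem den (hi : i ≤ P.n) :
    (P.withCoeffs C).den i z ξ = l * c * (P.withCoeffs C').den i z' ξ' := by
  rw [DiffParams.den, DiffParams.den, hz i le_rfl (by omega), hξ i le_rfl hi,
    hz (i + 1) (by omega) (by omega), h.sg h1 hi, h.phi h1 hi, h.rho_succ i]
  have := (h.rho_pos i).ne'
  field_simp

omit h h1 in
theorem isState_of (h : Scaling P C C' ρ l c) (h1 : 1 ≤ i) (hi : i ≤ P.n) {w : ℝ × ℝ × ℝ}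
    (hs : (P.withCoeffs C').IsState i z' ξ' w) : (P.withCoeffs C).IsState i z ξ w := by
  have key : ∀ a, a * z' i = |z' i| → a * z i = |z i| := by
    intro a ha
    rw [hz i le_rfl (by omega), abs_mul, abs_of_pos (h.rho_pos i), ← ha]; ring
  refine ⟨?_, ?_, ?_, hs.w1, hs.w2, hs.w3, fun h0 => key _ (hs.sel0 h0),
    fun h0 => key _ (hs.selInf h0)⟩
  · have := hs.xi_last
    change ξ' P.n = 0 at this
    change ξ P.n = 0
    rw [hξ _ hi le_rfl, this, mul_zero]
  · have := hs.z_last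
    change z' (P.n + 1) = 0 at this
    change z (P.n + 1) = 0
    rw [hz _ (by omega) le_rfl, this, mul_zero]
  · intro j hij hj
    change j < P.n at hj
    rw [hz _ (by omega) (by omega), hξ j hij hj.le, hs.eq_phi j hij hj, h.phi (by omega) hj.le]

include hn

theorem num (kt : ℕ → ℝ) (hi : i ≤ P.n) (w : ℝ × ℝ × ℝ) : (P.withCoeffs C).num C.D kt i z ξ w =
    l * c * (P.withCoeffs C').num C'.D kt i z' ξ' w := by
  rw [DiffParams.num, DiffParams.num, Finset.mul_sum]
  refine Finset.sum_congr rfl fun j hj => ?_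
  obtain ⟨h2, h3⟩ := Finset.mem_Icc.1 hj
  change j ≤ P.n at h3
  rw [hz i le_rfl (by omega), hz j (by omega) (by omega), hz (j - 1) (by omega) (by omega),
    hξ (j - 1) (by omega) (by omega), hξ j (by omega) h3, hz (j + 1) (by omega) (by omega),
    h.sg (by omega) h3, h.sp (by omega) (by omega), Nat.sub_add_cancel (by omega),
    h.sel hn h1 (by omega) h3, h.rho_succ j]
  have := (h.rho_pos j).ne'
  field_simp

theorem full (kt : ℕ → ℝ) (hi : i ≤ P.n) (w : ℝ × ℝ × ℝ) : (P.withCoeffs C).full C.D kt i z ξ w =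
    l * c * (P.withCoeffs C').full C'.D kt i z' ξ' w := by
  rw [DiffParams.full, DiffParams.full, Finset.mul_sum]
  refine Finset.sum_congr rfl fun j hj => ?_
  obtain ⟨h2, h3⟩ := Finset.mem_Icc.1 hj
  change j ≤ P.n at h3
  have hρ := (h.rho_pos j).ne'
  rw [hz i le_rfl (by omega), h.sel hn h1 h2 h3, hz (j + 1) (by omega) (by omega), h.rho_succ j,
    hz j h2 (by omega), hξ j h2 h3, h.sg (by omega) h3]
  split_ifs with hji
  · field_simp
    ring
  · rw [hz (j - 1) (by omega) (by omega), hξ (j - 1) (by omega) (by omega),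
      h.sp (by omega) (by omega), Nat.sub_add_cancel (by omega)]
    field_simp

end Scaling

end DiffParams

namespace DiffParams

/-- A cut-off function: `0` for `τ ≤ -1`, `1` for `τ ≥ 0`, affine in between. -/
noncomputable def lo (τ : ℝ) : ℝ := max 0 (min 1 (1 + τ))

theorem lo_nonneg (τ : ℝ) : 0 ≤ lo τ := le_max_left _ _

theorem lo_of_nonneg {τ : ℝ} (h : 0 ≤ τ) : lo τ = 1 := by
  rw [lo, min_eq_left (by linarith), max_eq_right zero_le_one]

theorem lo_of_mem {τ : ℝ} (h1 : -1 ≤ τ) (h2 : τ ≤ 0) : lo τ = 1 + τ := by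
  rw [lo, min_eq_right (by linarith), max_eq_right (by linarith)]

theorem continuous_lo : Continuous lo :=
  continuous_const.max (continuous_const.min (continuous_const.add continuous_id))

theorem pos_of_lo_neg_eq_zero {τ : ℝ} (h : lo (-τ) = 0) : 0 < τ := by
  by_contra hτ
  rw [lo_of_nonneg (by linarith)] at h
  exact one_ne_zero h

/-- A path of coefficients from the homogeneous limit at the origin (`τ = -1`) through the given
coefficients (`τ = 0`) to the homogeneous limit at infinity (`τ = 1`). -/
noncomputable def blend (P : DiffParams) (D τ : ℝ) : Coeffs where
  kappa j := P.kappa j * lo (-τ) ^ (P.rInf j * (P.eInf j - P.e0 j))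
  theta j := P.theta j * lo τ ^ (P.r0 j * (P.eInf j - P.e0 j))
  beta0 j := P.beta0 j * lo (-τ) ^ (P.rInf j * (P.mInf j - P.m0 j))
  betaInf j := P.betaInf j * lo τ ^ (P.r0 j * (P.mInf j - P.m0 j))
  D := D * lo (-τ) ^ (P.rInf P.n * (P.eInf P.n - P.e0 P.n))

/-- The member of the path of systems with parameter `τ`. -/
noncomputable abbrev path (P : DiffParams) (D τ : ℝ) : DiffParams := P.withCoeffs (P.blend D τ)

variable {P : DiffParams}

theorem Exponents.withCoeffs (h : P.Exponents) (C : Coeffs) : (P.withCoeffs C).Exponents :=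
  ⟨h.two_le_n, h.r0_pos, h.rInf_pos, h.e0_pos, h.e0_nonneg, h.e0_le, h.le_m0, h.m0_pos, h.m0_lt,
    h.p0_pos, h.pInf_pos⟩

theorem mul_rpow_add_pos {u v a b : ℝ} (hu : 0 < u) (hv : 0 < v) (τ : ℝ) :
    0 < u * lo (-τ) ^ a + v * lo τ ^ b := by
  have h1 := lo_nonneg τ
  have h2 := lo_nonneg (-τ)
  rcases le_total 0 τ with h | h
  · rw [lo_of_nonneg h, Real.one_rpow]; positivity
  · rw [lo_of_nonneg (neg_nonneg.2 h), Real.one_rpow]; positivity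

theorem Valid.regular_path {Δ : ℝ} (hP : P.Valid Δ) (D τ : ℝ) : (P.path D τ).Regular where
  toExponents := hP.exponents.withCoeffs _
  kappa_nonneg i h1 hi := mul_nonneg (hP.kappa_pos i (Finset.mem_Icc.2 ⟨h1, hi⟩)).le
    (Real.rpow_nonneg (lo_nonneg _) _)
  theta_nonneg i h1 hi := mul_nonneg (hP.theta_pos i (Finset.mem_Icc.2 ⟨h1, hi⟩)).le
    (Real.rpow_nonneg (lo_nonneg _) _)
  gain_pos i h1 hi := mul_rpow_add_pos (hP.kappa_pos i (Finset.mem_Icc.2 ⟨h1, hi⟩))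
    (hP.theta_pos i (Finset.mem_Icc.2 ⟨h1, hi⟩)) τ
  beta0_nonneg i h1 hi := mul_nonneg (hP.beta0_pos i (Finset.mem_Icc.2 ⟨h1, hi⟩)).le
    (Real.rpow_nonneg (lo_nonneg _) _)
  betaInf_nonneg i h1 hi := mul_nonneg (hP.betaInf_pos i (Finset.mem_Icc.2 ⟨h1, hi⟩)).le
    (Real.rpow_nonneg (lo_nonneg _) _)
  beta_pos i h1 hi := mul_rpow_add_pos (hP.beta0_pos i (Finset.mem_Icc.2 ⟨h1, hi⟩))
    (hP.betaInf_pos i (Finset.mem_Icc.2 ⟨h1, hi⟩)) τ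

theorem mul_ssel {p s w : ℝ} (hp : 0 ≤ p) (hw : p = 0 → w * s = |s|) :
    s * ssel p s w = |s| * |s| ^ p := by
  rcases hp.eq_or_lt with rfl | hp
  · rw [ssel, if_pos rfl, Real.rpow_zero, mul_one, mul_comm, hw rfl]
  · rw [ssel, if_neg hp.ne', mul_spow_self hp, Real.rpow_add_one' (abs_nonneg s) (by linarith)]
    ring

/-- The admissible values `D` of `Δ / k_n`. -/
structure Admissible (P : DiffParams) (D : ℝ) : Prop where
  nonneg : 0 ≤ D
  lt : D < P.kappa P.n
  eq_zero : P.d0 ≠ -1 → D = 0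

theorem Admissible.mul_lastVal_pos {Δ D : ℝ} (hD : P.Admissible D) (hP : P.Valid Δ) (τ : ℝ)
    {s : ℝ} (hs : s ≠ 0) {w : ℝ × ℝ × ℝ} (h0 : P.e0 P.n = 0 → w.1 * s = |s|)
    (hI : P.eInf P.n = 0 → w.2.1 * s = |s|) (hw : w.2.2 ∈ Icc (-1 : ℝ) 1) :
    0 < s * (P.path D τ).lastVal (P.blend D τ).D s w := by
  have hn : 1 ≤ P.n := (by norm_num : 1 ≤ 2).trans hP.two_le_n
  have hE := hP.exponents
  have he0 := hE.e0_nonneg _ hn le_rfl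
  have heI := he0.trans (hE.e0_le _ hn le_rfl)
  have hθ := hP.theta_pos _ (Finset.mem_Icc.2 ⟨hn, le_rfl⟩)
  have hpos : 0 < |s| := abs_pos.2 hs
  have a := mul_ssel he0 h0
  have b := mul_ssel heI hI
  change 0 < s * (P.kappa P.n * lo (-τ) ^ (P.rInf P.n * (P.eInf P.n - P.e0 P.n)) *
    ssel (P.e0 P.n) s w.1 + P.theta P.n * lo τ ^ (P.r0 P.n * (P.eInf P.n - P.e0 P.n)) *
    ssel (P.eInf P.n) s w.2.1 -
    D * lo (-τ) ^ (P.rInf P.n * (P.eInf P.n - P.e0 P.n)) * w.2.2)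
  have hD1 : D < P.kappa P.n * |s| ^ P.e0 P.n := by
    by_cases hd : P.d0 = -1
    · have : P.e0 P.n = 0 := by simp [e0, r0, hd]
      rw [this, Real.rpow_zero, mul_one]
      exact hD.lt
    · rw [hD.eq_zero hd]
      have := hD.nonneg.trans_lt hD.lt
      positivity
  have hm := mul_rpow_add_pos (a := P.rInf P.n * (P.eInf P.n - P.e0 P.n))
    (b := P.r0 P.n * (P.eInf P.n - P.e0 P.n)) (sub_pos.2 hD1)
    (mul_pos hθ (Real.rpow_pos_of_pos hpos (P.eInf P.n))) τ
  have h2 := Real.rpow_nonneg (lo_nonneg (-τ)) (P.rInf P.n * (P.eInf P.n - P.e0 P.n))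
  generalize lo (-τ) ^ (P.rInf P.n * (P.eInf P.n - P.e0 P.n)) = A at *
  generalize lo τ ^ (P.r0 P.n * (P.eInf P.n - P.e0 P.n)) = B at *
  have hsw : s * w.2.2 ≤ |s| := by
    calc s * w.2.2 ≤ |s * w.2.2| := le_abs_self _
      _ = |s| * |w.2.2| := abs_mul _ _
      _ ≤ |s| * 1 := by gcongr; exact abs_le.2 hw
      _ = |s| := mul_one _
  calc 0 < |s| * ((P.kappa P.n * |s| ^ P.e0 P.n - D) * A +
        P.theta P.n * |s| ^ P.eInf P.n * B) := mul_pos hpos hm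
    _ = P.kappa P.n * A * (s * ssel (P.e0 P.n) s w.1) +
        P.theta P.n * B * (s * ssel (P.eInf P.n) s w.2.1) - D * A * |s| := by rw [a, b]; ring
    _ ≤ P.kappa P.n * A * (s * ssel (P.e0 P.n) s w.1) +
        P.theta P.n * B * (s * ssel (P.eInf P.n) s w.2.1) - D * A * (s * w.2.2) := by
        have := mul_le_mul_of_nonneg_left hsw (mul_nonneg hD.nonneg h2)
        linarith
    _ = _ := by ring

/-! ### The path of systems consists of rescaled systems -/

section scaling

variable {D : ℝ} (hE : P.Exponents) (hD : P.d0 ≠ -1 → D = 0) {t : ℝ}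
include hE hD

theorem scaling_blend_of_le_one (ht : 0 < t) (ht1 : t ≤ 1) :
    Scaling P (P.coeffs D) (P.blend D (t - 1)) (fun j => t ^ P.r0 j) (t ^ P.p0) (t ^ P.d0) := by
  have h1 : lo (-(t - 1)) = 1 := lo_of_nonneg (by linarith)
  have h2 : lo (t - 1) = t := by rw [lo_of_mem (by linarith) (by linarith)]; ring
  refine ⟨fun j => Real.rpow_pos_of_pos ht _, Real.rpow_pos_of_pos ht _,
    Real.rpow_pos_of_pos ht _, fun j => ?_, fun j a b => ?_, fun j a b => ?_, fun j a b => ?_,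
    fun j a b => ?_, ?_⟩
  · rw [r0_succ, Real.rpow_add ht, mul_comm]
  · have := (hE.r0_pos j a b).ne'
    simp only [blend, coeffs, h1, Real.one_rpow, ← Real.rpow_mul ht.le, mul_one]
    rw [e0, mul_div_cancel₀ _ this, mul_comm]
  · have := (hE.r0_pos j a b).ne'
    simp only [blend, coeffs, h2, ← Real.rpow_mul ht.le]
    rw [mul_left_comm, ← Real.rpow_add ht, mul_sub, e0, mul_div_cancel₀ _ this,
      add_sub_cancel]
  · have := (hE.r0_pos j a b).ne'
    simp only [blend, coeffs, h1, Real.one_rpow, ← Real.rpow_mul ht.le, mul_one]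
    rw [mul_assoc, ← Real.rpow_add ht, m0, mul_div_cancel₀ _ this, sub_add_cancel, mul_comm]
  · have := (hE.r0_pos j a b).ne'
    simp only [blend, coeffs, h2, ← Real.rpow_mul ht.le]
    rw [mul_assoc, ← Real.rpow_add ht, mul_left_comm, ← Real.rpow_add ht, mul_sub _ _ (P.m0 j),
      m0, mul_div_cancel₀ _ this]
    congr 2; ring
  · simp only [blend, coeffs, h1, Real.one_rpow, mul_one]
    by_cases hd : P.d0 = -1
    · have : P.r0 (P.n + 1) = 0 := by simp [r0, hd]
      rw [this, Real.rpow_zero, one_mul]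
    · rw [hD hd, mul_zero]

theorem scaling_blend_of_one_le (ht1 : 1 ≤ t) :
    Scaling P (P.coeffs D) (P.blend D (1 - t⁻¹)) (fun j => t ^ P.rInf j) (t ^ P.pInf)
      (t ^ P.dInf) := by
  have ht : 0 < t := by linarith
  have hi := inv_le_one_of_one_le₀ ht1
  have hi0 := inv_pos.2 ht
  have h1 : lo (1 - t⁻¹) = 1 := lo_of_nonneg (by linarith)
  have h2 : lo (-(1 - t⁻¹)) = t⁻¹ := by rw [lo_of_mem (by linarith) (by linarith)]; ring
  refine ⟨fun j => Real.rpow_pos_of_pos ht _, Real.rpow_pos_of_pos ht _,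
    Real.rpow_pos_of_pos ht _, fun j => ?_, fun j a b => ?_, fun j a b => ?_, fun j a b => ?_,
    fun j a b => ?_, ?_⟩
  · rw [rInf_succ, Real.rpow_add ht, mul_comm]
  · have := (hE.rInf_pos j a b).ne'
    simp only [blend, coeffs, h2, ← Real.rpow_mul ht.le, Real.inv_rpow ht.le, ← Real.rpow_neg ht.le]
    rw [mul_left_comm, ← Real.rpow_add ht, mul_sub, eInf, mul_div_cancel₀ _ this, neg_sub,
      add_sub_cancel]
  · have := (hE.rInf_pos j a b).ne'
    simp only [blend, coeffs, h1, Real.one_rpow, ← Real.rpow_mul ht.le, mul_one]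
    rw [eInf, mul_div_cancel₀ _ this, mul_comm]
  · have := (hE.rInf_pos j a b).ne'
    simp only [blend, coeffs, h2, ← Real.rpow_mul ht.le, Real.inv_rpow ht.le, ← Real.rpow_neg ht.le]
    rw [mul_assoc, ← Real.rpow_add ht, mul_left_comm, ← Real.rpow_add ht, mul_sub _ (P.mInf j),
      mInf, mul_div_cancel₀ _ this]
    congr 2; ring
  · have := (hE.rInf_pos j a b).ne'
    simp only [blend, coeffs, h1, Real.one_rpow, ← Real.rpow_mul ht.le, mul_one]
    rw [mul_assoc, ← Real.rpow_add ht, mInf, mul_div_cancel₀ _ this, sub_add_cancel, mul_comm]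
  · simp only [blend, coeffs, h2, Real.inv_rpow ht.le, ← Real.rpow_neg ht.le]
    by_cases hd : P.d0 = -1
    · have a : P.e0 P.n = 0 := by simp [e0, r0, hd]
      have b : P.rInf P.n = 1 := by simp [rInf]
      have c : P.rInf (P.n + 1) = P.eInf P.n := by simp [eInf, b]
      rw [a, b, c, one_mul, sub_zero, mul_left_comm, ← Real.rpow_add ht, add_neg_cancel,
        Real.rpow_zero, mul_one]
    · rw [hD hd, zero_mul, mul_zero]

theorem exists_scaling_blend {τ : ℝ} (h : τ ∈ Ioo (-1 : ℝ) 1) :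
    ∃ ρ l c, Scaling P (P.coeffs D) (P.blend D τ) ρ l c := by
  rcases le_total τ 0 with h0 | h0
  · have := scaling_blend_of_le_one hE hD (t := 1 + τ) (by linarith [h.1]) (by linarith)
    rw [add_sub_cancel_left] at this
    exact ⟨_, _, _, this⟩
  · have := scaling_blend_of_one_le hE hD (t := (1 - τ)⁻¹)
      ((one_le_inv₀ (by linarith [h.2])).2 (by linarith))
    rw [inv_inv, sub_sub_cancel] at this
    exact ⟨_, _, _, this⟩

end scaling

end DiffParams

theorem continuous_ssel {p : ℝ} (hp : 0 ≤ p) : Continuous fun x : ℝ × ℝ => ssel p x.1 x.2 := by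
  unfold ssel
  rcases hp.eq_or_lt with rfl | hp
  · simpa using continuous_snd
  · simp only [if_neg hp.ne']
    exact (continuous_spow hp).comp continuous_fst

namespace DiffParams

variable {P : DiffParams}

theorem continuous_lo_rpow {a : ℝ} (ha : 0 ≤ a) : Continuous fun τ => lo τ ^ a :=
  continuous_lo.rpow_const fun _ => Or.inr ha

theorem continuous_lo_neg_rpow {a : ℝ} (ha : 0 ≤ a) : Continuous fun τ => lo (-τ) ^ a :=
  (continuous_lo.comp continuous_neg).rpow_const fun _ => Or.inr ha

section

variable {Δ : ℝ} (hP : P.Valid Δ) (D : ℝ) {j : ℕ} (h1 : 1 ≤ j) (hn : j ≤ P.n)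
include hP h1 hn

theorem Valid.rInf_mul_nonneg : 0 ≤ P.rInf j * (P.eInf j - P.e0 j) :=
  mul_nonneg (hP.exponents.rInf_pos j h1 hn).le (sub_nonneg.2 (hP.exponents.e0_le j h1 hn))

theorem Valid.r0_mul_nonneg : 0 ≤ P.r0 j * (P.eInf j - P.e0 j) :=
  mul_nonneg (hP.exponents.r0_pos j h1 hn).le (sub_nonneg.2 (hP.exponents.e0_le j h1 hn))

theorem Valid.rInf_mul_pos : 0 < P.rInf j * (P.mInf j - P.m0 j) :=
  mul_pos (hP.exponents.rInf_pos j h1 hn) (sub_pos.2 (hP.exponents.m0_lt j h1 hn))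

theorem Valid.r0_mul_pos : 0 < P.r0 j * (P.mInf j - P.m0 j) :=
  mul_pos (hP.exponents.r0_pos j h1 hn) (sub_pos.2 (hP.exponents.m0_lt j h1 hn))

theorem Valid.continuous_blend_kappa : Continuous fun τ => (P.blend D τ).kappa j :=
  continuous_const.mul (continuous_lo_neg_rpow (hP.rInf_mul_nonneg h1 hn))

theorem Valid.continuous_blend_theta : Continuous fun τ => (P.blend D τ).theta j :=
  continuous_const.mul (continuous_lo_rpow (hP.r0_mul_nonneg h1 hn))

theorem Valid.continuous_blend_beta0 : Continuous fun τ => (P.blend D τ).beta0 j :=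
  continuous_const.mul (continuous_lo_neg_rpow (hP.rInf_mul_pos h1 hn).le)

theorem Valid.continuous_blend_betaInf : Continuous fun τ => (P.blend D τ).betaInf j :=
  continuous_const.mul (continuous_lo_rpow (hP.r0_mul_pos h1 hn).le)

theorem Valid.continuous_path_sg :
    Continuous fun x : ℝ × ℝ × ℝ => (P.path D x.1).sg j x.2.1 x.2.2 := by
  have a := continuous_spow (hP.exponents.m0_pos j h1 hn)
  have b := continuous_spow (hP.exponents.mInf_pos h1 hn)
  have c := hP.continuous_blend_beta0 D h1 hn
  have d := hP.continuous_blend_betaInf D h1 hn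
  change Continuous fun x : ℝ × ℝ × ℝ => (P.blend D x.1).beta0 j *
    (spow (P.m0 j) x.2.1 - spow (P.m0 j) x.2.2) + (P.blend D x.1).betaInf j *
    (spow (P.mInf j) x.2.1 - spow (P.mInf j) x.2.2)
  have f1 : Continuous fun x : ℝ × ℝ × ℝ => x.2.1 := by fun_prop
  have f2 : Continuous fun x : ℝ × ℝ × ℝ => x.2.2 := by fun_prop
  exact ((c.comp continuous_fst).mul ((a.comp f1).sub (a.comp f2))).add
    ((d.comp continuous_fst).mul ((b.comp f1).sub (b.comp f2)))

theorem Valid.continuous_path_Zxi :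
    Continuous fun x : ℝ × ℝ × ℝ => (P.path D x.1).Zxi j x.2.1 x.2.2 := by
  have hE := hP.exponents
  have hm0 := hE.m0_pos j h1 hn
  have hmI := hE.mInf_pos h1 hn
  have a := continuous_spow hm0
  have b := continuous_spow hmI
  have c := hP.continuous_blend_beta0 D h1 hn
  have d := hP.continuous_blend_betaInf D h1 hn
  have e := continuous_abs_rpow (show 0 ≤ P.m0 j + 1 by linarith)
  have f := continuous_abs_rpow (show 0 ≤ P.mInf j + 1 by linarith)
  change Continuous fun x : ℝ × ℝ × ℝ =>
    Zterm ((P.blend D x.1).beta0 j) P.p0 (P.r0 j) x.2.1 x.2.2 +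
    Zterm ((P.blend D x.1).betaInf j) P.pInf (P.rInf j) x.2.1 x.2.2
  simp only [Zterm_eq (hE.r0_pos j h1 hn), Zterm_eq (hE.rInf_pos j h1 hn)]
  have e1 := e.comp (continuous_fst.comp continuous_snd : Continuous fun x : ℝ × ℝ × ℝ => x.2.1)
  have e2 := e.comp (continuous_snd.comp continuous_snd : Continuous fun x : ℝ × ℝ × ℝ => x.2.2)
  have f1 := f.comp (continuous_fst.comp continuous_snd : Continuous fun x : ℝ × ℝ × ℝ => x.2.1)
  have f2 := f.comp (continuous_snd.comp continuous_snd : Continuous fun x : ℝ × ℝ × ℝ => x.2.2)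
  simp only [Function.comp_def] at e1 e2 f1 f2
  refine Continuous.add (Continuous.mul (c.comp continuous_fst) ?_)
    (Continuous.mul (d.comp continuous_fst) ?_)
  · exact ((e1.const_mul _).sub ((continuous_fst.comp continuous_snd).mul
      (a.comp (continuous_snd.comp continuous_snd)))).add (e2.const_mul _)
  · exact ((f1.const_mul _).sub ((continuous_fst.comp continuous_snd).mul
      (b.comp (continuous_snd.comp continuous_snd)))).add (f2.const_mul _)

end

section

variable {Δ : ℝ} (hP : P.Valid Δ) (D : ℝ) {j : ℕ} (h1 : 1 ≤ j) (hn : j < P.n)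
include hP h1 hn

theorem Valid.continuous_path_phi :
    Continuous fun x : ℝ × ℝ => (P.path D x.1).phi j x.2 := by
  have a := continuous_spow (hP.exponents.e0_pos j h1 hn)
  have b := continuous_spow (hP.exponents.eInf_pos h1 hn)
  have c := hP.continuous_blend_kappa D h1 hn.le
  have d := hP.continuous_blend_theta D h1 hn.le
  change Continuous fun x : ℝ × ℝ => (P.blend D x.1).kappa j * spow (P.e0 j) x.2 +
    (P.blend D x.1).theta j * spow (P.eInf j) x.2
  exact ((c.comp continuous_fst).mul (a.comp continuous_snd)).add
    ((d.comp continuous_fst).mul (b.comp continuous_snd))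

theorem Valid.continuous_path_slope :
    Continuous fun x : ℝ × ℝ => (P.path D x.1).slope j x.2 := by
  have hE := hP.exponents
  have ha := hE.e0_pos j h1 hn
  have hb := hE.eInf_pos h1 hn
  have hab := hE.e0_le j h1 hn.le
  have hbm := hE.le_m0 j h1 hn.le
  have hm := hE.m0_lt j h1 hn.le
  have hR := fun τ => hP.regular_path D τ
  have hk : ∀ τ, 0 ≤ (P.blend D τ).kappa j := fun τ => (hR τ).kappa_nonneg j h1 hn.le
  have ht : ∀ τ, 0 ≤ (P.blend D τ).theta j := fun τ => (hR τ).theta_nonneg j h1 hn.le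
  have hb0 : ∀ τ, 0 ≤ (P.blend D τ).beta0 j := fun τ => (hR τ).beta0_nonneg j h1 hn.le
  have hbI : ∀ τ, 0 ≤ (P.blend D τ).betaInf j := fun τ => (hR τ).betaInf_nonneg j h1 hn.le
  have ck := hP.continuous_blend_kappa D h1 hn.le
  have ct := hP.continuous_blend_theta D h1 hn.le
  have c0 := hP.continuous_blend_beta0 D h1 hn.le
  have cI := hP.continuous_blend_betaInf D h1 hn.le
  have cpow : ∀ q : ℝ, 0 ≤ q → Continuous fun x : ℝ × ℝ => |x.2| ^ q := fun q hq =>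
    (continuous_abs_rpow hq).comp continuous_snd
  set N : ℝ × ℝ → ℝ := fun x => (P.blend D x.1).beta0 j * (P.m0 j * |x.2| ^ (P.m0 j - P.e0 j)) +
    (P.blend D x.1).betaInf j * (P.mInf j * |x.2| ^ (P.mInf j - P.e0 j)) with hN
  set M : ℝ × ℝ → ℝ := fun x => (P.blend D x.1).kappa j * P.e0 j +
    (P.blend D x.1).theta j * P.eInf j * |x.2| ^ (P.eInf j - P.e0 j) with hM
  change Continuous fun x : ℝ × ℝ => N x / M x
  have cN : Continuous N := ((c0.comp continuous_fst).mul ((cpow _ (by linarith)).const_mul _)).add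
    ((cI.comp continuous_fst).mul ((cpow _ (by linarith)).const_mul _))
  have cM : Continuous M := ((ck.comp continuous_fst).mul continuous_const).add
    (((ct.comp continuous_fst).mul continuous_const).mul (cpow _ (by linarith)))
  rw [continuous_iff_continuousAt]
  rintro ⟨τ, ξ⟩
  by_cases h0 : M (τ, ξ) = 0
  swap
  · exact cN.continuousAt.div cM.continuousAt h0
  have hx : ∀ ξ : ℝ, 0 ≤ |ξ| ^ (P.eInf j - P.e0 j) := fun ξ => Real.rpow_nonneg (abs_nonneg _) _
  have hkt := (add_eq_zero_iff_of_nonneg (mul_nonneg (hk τ) ha.le)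
    (mul_nonneg (mul_nonneg (ht τ) hb.le) (hx ξ))).1 h0
  have hk0 := (mul_eq_zero.1 hkt.1).resolve_right ha.ne'
  have hlo := (mul_eq_zero.1 hk0).resolve_left
    (hP.kappa_pos j (Finset.mem_Icc.2 ⟨h1, hn.le⟩)).ne'
  rw [Real.rpow_eq_zero_iff_of_nonneg (lo_nonneg _)] at hlo
  have hτ : 0 < τ := pos_of_lo_neg_eq_zero hlo.1
  have hlt : P.e0 j < P.eInf j := lt_of_le_of_ne hab fun h => hlo.2 (by rw [h]; ring)
  have hθ := hP.theta_pos j (Finset.mem_Icc.2 ⟨h1, hn.le⟩)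
  have hθτ : ∀ τ, 0 < τ → (P.blend D τ).theta j = P.theta j := by
    intro τ hτ
    change P.theta j * lo τ ^ _ = _
    rw [lo_of_nonneg hτ.le, Real.one_rpow, mul_one]
  have hξ : ξ = 0 := by
    have := hkt.2
    change (P.blend D τ).theta j * _ * _ = 0 at this
    rw [hθτ τ hτ] at this
    have := (mul_eq_zero.1 this).resolve_left (mul_pos hθ hb).ne'
    exact abs_eq_zero.1 ((Real.rpow_eq_zero_iff_of_nonneg (abs_nonneg _)).1 this).1
  subst hξ
  have hb00 : (P.blend D τ).beta0 j = 0 := by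
    change P.beta0 j * lo (-τ) ^ _ = 0
    rw [hlo.1, Real.zero_rpow (hP.rInf_mul_pos h1 hn.le).ne', mul_zero]
  set G : ℝ × ℝ → ℝ := fun x => ((P.blend D x.1).beta0 j * (P.m0 j * |x.2| ^ (P.m0 j - P.eInf j)) +
    (P.blend D x.1).betaInf j * (P.mInf j * |x.2| ^ (P.mInf j - P.eInf j))) /
    (P.theta j * P.eInf j) with hG
  have cG : Continuous G := (((c0.comp continuous_fst).mul
    ((cpow _ (by linarith)).const_mul _)).add
    ((cI.comp continuous_fst).mul ((cpow _ (by linarith)).const_mul _))).div_const _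
  have hG0 : G (τ, 0) = 0 := by
    simp only [hG, hb00, abs_zero, Real.zero_rpow (show P.mInf j - P.eInf j ≠ 0 by linarith)]
    simp
  have hf0 : N (τ, 0) / M (τ, 0) = 0 := by rw [h0, div_zero]
  have hNnn : ∀ x, 0 ≤ N x := fun x => by
    have := hb0 x.1
    have := hbI x.1
    have := hb.le.trans hbm
    have := this.trans hm.le
    positivity
  have hMnn : ∀ x, 0 ≤ M x := fun x =>
    add_nonneg (mul_nonneg (hk _) ha.le) (mul_nonneg (mul_nonneg (ht _) hb.le) (hx _))
  have hGnn : ∀ x, 0 ≤ G x := fun x => by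
    have := hb0 x.1
    have := hbI x.1
    have := hb.le.trans hbm
    have := this.trans hm.le
    positivity
  have hGt := cG.tendsto (τ, 0)
  rw [hG0] at hGt
  rw [ContinuousAt, hf0]
  refine squeeze_zero' (g := G) (Eventually.of_forall fun x => div_nonneg (hNnn x) (hMnn x)) ?_
    hGt
  have hev : ∀ᶠ x : ℝ × ℝ in 𝓝 (τ, 0), 0 < x.1 :=
    continuous_fst.continuousAt.eventually (lt_mem_nhds hτ)
  filter_upwards [hev] with x hx1
  rcases eq_or_ne x.2 0 with hx2 | hx2
  · have : N x = 0 := by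
      simp only [hN, hx2, abs_zero, Real.zero_rpow (show P.mInf j - P.e0 j ≠ 0 by linarith),
        Real.zero_rpow (show P.m0 j - P.e0 j ≠ 0 by linarith)]
      simp
    rw [this, zero_div]
    exact hGnn x
  · have hpos := abs_pos.2 hx2
    have hpos' := Real.rpow_pos_of_pos hpos (P.eInf j - P.e0 j)
    have e : ∀ m : ℝ, |x.2| ^ (m - P.e0 j) =
        |x.2| ^ (m - P.eInf j) * |x.2| ^ (P.eInf j - P.e0 j) := fun m => by
      rw [← Real.rpow_add hpos]; congr 1; ring
    calc N x / M x ≤ N x / (P.theta j * P.eInf j * |x.2| ^ (P.eInf j - P.e0 j)) := by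
          refine div_le_div_of_nonneg_left (hNnn x) (by positivity) ?_
          change _ ≤ (P.blend D x.1).kappa j * P.e0 j +
            (P.blend D x.1).theta j * P.eInf j * |x.2| ^ (P.eInf j - P.e0 j)
          rw [hθτ _ hx1]
          have := mul_nonneg (hk x.1) ha.le
          linarith
      _ = G x := by
          simp only [hN, hG]
          rw [e (P.m0 j), e (P.mInf j), ← mul_div_mul_right _ (P.theta j * P.eInf j) hpos'.ne']
          congr 1
          ring

theorem Valid.continuous_path_sp :
    Continuous fun x : ℝ × ℝ × ℝ => (P.path D x.1).sp j x.2.1 x.2.2 := by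
  have := (hP.continuous_path_slope D h1 hn).comp
    (continuous_fst.prodMk (continuous_snd.comp continuous_snd) :
      Continuous fun x : ℝ × ℝ × ℝ => (x.1, x.2.2))
  exact (((continuous_fst.comp continuous_snd).sub (continuous_snd.comp continuous_snd)).neg).mul
    this

omit h1 in
theorem Valid.continuous_path_chain {i : ℕ} :
    Continuous fun x : ℝ × ℝ => (P.path D x.1).chain i j x.2 := by
  induction j with
  | zero => exact continuous_snd
  | succ j ih =>
    rcases lt_or_ge (j + 1) i with hij | hij
    · simpa only [chain_of_lt hij] using continuous_snd
    · simp only [chain_succ hij]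
      exact (hP.continuous_path_phi D (by omega) hn).comp
        (continuous_fst.prodMk (ih (by omega)))

end

section

variable {Δ : ℝ} (hP : P.Valid Δ) (D : ℝ)
include hP

theorem Valid.continuous_path_lastVal : Continuous fun x : ℝ × ℝ × ℝ × ℝ × ℝ =>
    (P.path D x.1).lastVal (P.blend D x.1).D x.2.1 x.2.2 := by
  have hn : 1 ≤ P.n := (by norm_num : 1 ≤ 2).trans hP.two_le_n
  have he0 := hP.exponents.e0_nonneg _ hn le_rfl
  have heI := he0.trans (hP.exponents.e0_le _ hn le_rfl)
  have a := continuous_ssel he0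
  have b := continuous_ssel heI
  have c := hP.continuous_blend_kappa D hn le_rfl
  have d := hP.continuous_blend_theta D hn le_rfl
  have e : Continuous fun τ => (P.blend D τ).D :=
    continuous_const.mul (continuous_lo_neg_rpow (hP.rInf_mul_nonneg hn le_rfl))
  have a' := a.comp (show Continuous fun x : ℝ × ℝ × ℝ × ℝ × ℝ => (x.2.1, x.2.2.1) by fun_prop)
  have b' := b.comp (show Continuous fun x : ℝ × ℝ × ℝ × ℝ × ℝ => (x.2.1, x.2.2.2.1) by fun_prop)
  exact (((c.comp continuous_fst).mul a').add ((d.comp continuous_fst).mul b')).sub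
    ((e.comp continuous_fst).mul (by fun_prop))

theorem Valid.continuous_path_sel {i j : ℕ} (hj : j ≤ P.n) :
    Continuous fun x : ℝ × ℝ × ℝ × ℝ × ℝ =>
      (P.path D x.1).sel (P.blend D x.1).D i x.2.1 x.2.2 j := by
  have hn : P.n - 1 < P.n := by have := hP.two_le_n; omega
  change Continuous fun x : ℝ × ℝ × ℝ × ℝ × ℝ => if j = P.n then (P.path D x.1).lastVal
    (P.blend D x.1).D ((P.path D x.1).chain i (P.n - 1) x.2.1) x.2.2
    else (P.path D x.1).chain i j x.2.1
  split_ifs with h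
  · exact (hP.continuous_path_lastVal D).comp (continuous_fst.prodMk
      (((hP.continuous_path_chain D hn).comp (continuous_fst.prodMk
      (continuous_fst.comp continuous_snd))).prodMk (continuous_snd.comp continuous_snd)))
  · exact (hP.continuous_path_chain D (lt_of_le_of_ne hj h)).comp (continuous_fst.prodMk
      (continuous_fst.comp continuous_snd))

/-- A point of the path of systems together with a state. -/
abbrev Pt := ℝ × (ℕ → ℝ) × (ℕ → ℝ) × ℝ × ℝ × ℝ

theorem Valid.continuous_path_num (kt : ℕ → ℝ) {i : ℕ} (hi : 1 ≤ i) : Continuous fun x : Pt =>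
    (P.path D x.1).num (P.blend D x.1).D kt i x.2.1 x.2.2.1 x.2.2.2 := by
  simp only [num, show ∀ τ, (P.path D τ).n = P.n from fun _ => rfl]
  refine continuous_finsetSum _ fun j hj => ?_
  obtain ⟨h2, h3⟩ := Finset.mem_Icc.1 hj
  have f1 : Continuous fun x : Pt => (x.1, x.2.1 (j - 1), x.2.2.1 (j - 1)) := by fun_prop
  have f2 : Continuous fun x : Pt => (x.1, x.2.1 j, x.2.2.1 j) := by fun_prop
  have f3 : Continuous fun x : Pt => (x.1, x.2.1 i, x.2.2.2) := by fun_prop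
  have f4 : Continuous fun x : Pt => x.2.1 (j + 1) := by fun_prop
  have c1 := (hP.continuous_path_sp D (j := j - 1) (by omega) (by omega)).comp f1
  have c2 := (hP.continuous_path_sg D (j := j) (by omega) h3).comp f2
  have c3 := (hP.continuous_path_sel D (i := i) h3).comp f3
  exact ((c1.add c2).const_mul (kt j)).mul (f4.sub c3)

theorem Valid.continuous_path_full (kt : ℕ → ℝ) {i : ℕ} (hi : 1 ≤ i) : Continuous fun x : Pt =>
    (P.path D x.1).full (P.blend D x.1).D kt i x.2.1 x.2.2.1 x.2.2.2 := by
  simp only [full, show ∀ τ, (P.path D τ).n = P.n from fun _ => rfl]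
  refine continuous_finsetSum _ fun j hj => ?_
  obtain ⟨h2, h3⟩ := Finset.mem_Icc.1 hj
  have f1 : Continuous fun x : Pt => (x.1, x.2.1 (j - 1), x.2.2.1 (j - 1)) := by fun_prop
  have f2 : Continuous fun x : Pt => (x.1, x.2.1 j, x.2.2.1 j) := by fun_prop
  have f3 : Continuous fun x : Pt => (x.1, x.2.1 i, x.2.2.2) := by fun_prop
  have f4 : Continuous fun x : Pt => x.2.1 (j + 1) := by fun_prop
  have c1 : Continuous fun x : Pt => if j = i then 0 else
      (P.path D x.1).sp (j - 1) (x.2.1 (j - 1)) (x.2.2.1 (j - 1)) := by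
    split_ifs with hji
    · exact continuous_const
    · exact (hP.continuous_path_sp D (j := j - 1) (by omega) (by omega)).comp f1
  have c2 := (hP.continuous_path_sg D (j := j) (by omega) h3).comp f2
  have c3 := (hP.continuous_path_sel D (i := i) h3).comp f3
  exact ((c1.add c2).const_mul (kt j)).mul (f4.sub c3)

theorem Valid.continuous_path_den {i : ℕ} (hi : 1 ≤ i) (hn : i < P.n) : Continuous fun x : Pt =>
    (P.path D x.1).den i x.2.1 x.2.2.1 := by
  have f1 : Continuous fun x : Pt => (x.1, x.2.1 i, x.2.2.1 i) := by fun_prop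
  have f2 : Continuous fun x : Pt => (x.1, x.2.1 i) := by fun_prop
  have f3 : Continuous fun x : Pt => x.2.1 (i + 1) := by fun_prop
  exact ((hP.continuous_path_sg D hi hn.le).comp f1).mul
    (((hP.continuous_path_phi D hi hn).comp f2).sub f3)

theorem Valid.continuous_path_sum_Zxi : Continuous fun x : Pt =>
    ∑ j ∈ Finset.Icc 1 P.n, (P.path D x.1).Zxi j (x.2.1 j) (x.2.2.1 j) := by
  refine continuous_finsetSum _ fun j hj => ?_
  obtain ⟨h2, h3⟩ := Finset.mem_Icc.1 hj
  have f1 : Continuous fun x : Pt => (x.1, x.2.1 j, x.2.2.1 j) := by fun_prop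
  have := (hP.continuous_path_Zxi D h2 h3).comp f1
  simpa only [Function.comp_def] using this

end

end DiffParams

/-- On a compact set, `N` is bounded by a multiple of `G ≥ 0` if `N` is negative where `G`
vanishes. -/
theorem IsCompact.exists_le_mul {X : Type*} [TopologicalSpace X] {S : Set X} (hS : IsCompact S)
    {N G : X → ℝ} (hN : Continuous N) (hG : Continuous G) (hG0 : ∀ x ∈ S, 0 ≤ G x)
    (h : ∀ x ∈ S, G x = 0 → N x < 0) : ∃ c, ∀ x ∈ S, N x ≤ c * G x := by
  have hS' : IsCompact (S ∩ {x | 0 ≤ N x}) := hS.inter_right (isClosed_le continuous_const hN)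
  rcases (S ∩ {x | 0 ≤ N x}).eq_empty_or_nonempty with he | hne
  · refine ⟨0, fun x hx => ?_⟩
    by_contra hcon
    have : x ∈ S ∩ {x | 0 ≤ N x} := ⟨hx, by simp only [mem_ofPred_eq]; linarith⟩
    rw [he] at this
    exact this
  obtain ⟨a, ha, hmin⟩ := hS'.exists_isMinOn hne hG.continuousOn
  obtain ⟨b, hb, hmax⟩ := hS'.exists_isMaxOn hne hN.continuousOn
  have hGa : 0 < G a := lt_of_le_of_ne (hG0 a ha.1) fun h0 =>
    absurd (h a ha.1 h0.symm) (not_lt.2 ha.2)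
  have hNb : 0 ≤ N b := hb.2
  refine ⟨N b / G a, fun x hx => ?_⟩
  rcases lt_or_ge (N x) 0 with hx0 | hx0
  · exact hx0.le.trans (mul_nonneg (div_nonneg hNb hGa.le) (hG0 x hx))
  · calc N x ≤ N b := hmax ⟨hx, hx0⟩
      _ = N b / G a * G a := by field_simp
      _ ≤ N b / G a * G x := mul_le_mul_of_nonneg_left (hmin ⟨hx, hx0⟩) (div_nonneg hNb hGa.le)

/-- Anisotropic normalization of finitely many nonnegative numbers, not all zero. -/
theorem exists_rpow_scale {s : Finset ℕ} {v r : ℕ → ℝ} (hv : ∀ j ∈ s, 0 ≤ v j)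
    (hr : ∀ j ∈ s, 0 < r j) (hne : ∃ j ∈ s, 0 < v j) :
    ∃ t > 0, (∀ j ∈ s, v j ≤ t ^ r j) ∧ ∃ j ∈ s, v j = t ^ r j := by
  obtain ⟨j0, hj0, hj0v⟩ := hne
  obtain ⟨j, hj, hmax⟩ := s.exists_max_image (fun j => v j ^ (1 / r j)) ⟨j0, hj0⟩
  have hroot : ∀ k ∈ s, (v k ^ (1 / r k)) ^ r k = v k := fun k hk => by
    rw [← Real.rpow_mul (hv k hk), one_div_mul_cancel (hr k hk).ne', Real.rpow_one]
  refine ⟨v j ^ (1 / r j), (Real.rpow_pos_of_pos hj0v _).trans_le (hmax j0 hj0), fun k hk => ?_,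
    j, hj, (hroot j hj).symm⟩
  calc v k = (v k ^ (1 / r k)) ^ r k := (hroot k hk).symm
    _ ≤ _ := Real.rpow_le_rpow (Real.rpow_nonneg (hv k hk) _) (hmax k hk) (hr k hk).le

namespace DiffParams

variable {P : DiffParams}

variable (P) in
/-- The states of the path of systems on the unit sphere. -/
def sphere (D : ℝ) (i : ℕ) : Set Pt :=
  {x | x.1 ∈ Icc (-1 : ℝ) 1 ∧ x.2.1 ∈ Set.pi univ (fun _ => Icc (-1 : ℝ) 1) ∧
    x.2.2.1 ∈ Set.pi univ (fun _ => Icc (-1 : ℝ) 1) ∧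
    (P.path D x.1).IsState i x.2.1 x.2.2.1 x.2.2.2 ∧
    1 ≤ ∑ j ∈ Finset.Icc i P.n, (|x.2.1 j| + |x.2.2.1 j|)}

theorem Valid.isCompact_sphere {Δ : ℝ} (hP : P.Valid Δ) (D : ℝ) {i : ℕ} (hi : 1 ≤ i) :
    IsCompact (P.sphere D i) := by
  have hK : IsCompact (Icc (-1 : ℝ) 1 ×ˢ (Set.pi univ fun _ : ℕ => Icc (-1 : ℝ) 1) ×ˢ
      (Set.pi univ fun _ : ℕ => Icc (-1 : ℝ) 1) ×ˢ
      Icc (-1 : ℝ) 1 ×ˢ Icc (-1 : ℝ) 1 ×ˢ Icc (-1 : ℝ) 1) :=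
    isCompact_Icc.prod ((isCompact_univ_pi fun _ => isCompact_Icc).prod
      ((isCompact_univ_pi fun _ => isCompact_Icc).prod
      (isCompact_Icc.prod (isCompact_Icc.prod isCompact_Icc))))
  have hC : IsClosed {x : Pt | x.2.2.1 P.n = 0 ∧ x.2.1 (P.n + 1) = 0 ∧
      (∀ j, i ≤ j → j < P.n → x.2.1 (j + 1) = (P.path D x.1).phi j (x.2.2.1 j)) ∧
      (P.e0 P.n = 0 → x.2.2.2.1 * x.2.1 i = |x.2.1 i|) ∧
      (P.eInf P.n = 0 → x.2.2.2.2.1 * x.2.1 i = |x.2.1 i|) ∧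
      1 ≤ ∑ j ∈ Finset.Icc i P.n, (|x.2.1 j| + |x.2.2.1 j|)} := by
    refine IsClosed.and (isClosed_eq (by fun_prop) (by fun_prop)) (IsClosed.and
      (isClosed_eq (by fun_prop) (by fun_prop)) (IsClosed.and ?_ (IsClosed.and ?_ (IsClosed.and ?_
      (isClosed_le (by fun_prop) (by fun_prop))))))
    · simp only [ofPred_forall]
      refine isClosed_iInter fun j => isClosed_iInter fun hij => isClosed_iInter fun hj =>
        isClosed_eq (by fun_prop) ?_
      have f : Continuous fun x : Pt => (x.1, x.2.2.1 j) := by fun_prop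
      exact (hP.continuous_path_phi D (by omega) hj).comp f
    · simp only [ofPred_forall]
      exact isClosed_iInter fun _ => isClosed_eq (by fun_prop) (by fun_prop)
    · simp only [ofPred_forall]
      exact isClosed_iInter fun _ => isClosed_eq (by fun_prop) (by fun_prop)
  convert hK.inter_right hC using 1
  ext x
  constructor
  · rintro ⟨h1, h2, h3, h4, h5⟩
    exact ⟨⟨h1, h2, h3, h4.w1, h4.w2, h4.w3⟩, h4.xi_last, h4.z_last, h4.eq_phi, h4.sel0,
      h4.selInf, h5⟩
  · rintro ⟨⟨h1, h2, h3, a, b, c⟩, d, e, f, g, k, h5⟩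
    exact ⟨h1, h2, h3, ⟨d, e, f, a, b, c, g, k⟩, h5⟩

theorem exists_ne_zero_of_mem_sphere {Δ : ℝ} (hP : P.Valid Δ) {D : ℝ} {i : ℕ} (hi : 1 ≤ i)
    {x : Pt} (hx : x ∈ P.sphere D i) : ∃ j, i ≤ j ∧ j ≤ P.n ∧ x.2.1 j ≠ 0 := by
  by_contra! hcon
  obtain ⟨-, -, -, hs, h1⟩ := hx
  have hξ := hs.xi_eq_zero (hP.regular_path D x.1) hi hcon
  rw [Finset.sum_eq_zero fun j hj => by
    obtain ⟨a, b⟩ := Finset.mem_Icc.1 hj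
    rw [hcon j a b, hξ j a b]; simp] at h1
  linarith

/-- Every nonzero state is a rescaled element of the unit sphere. -/
theorem IsState.exists_mem_sphere {Δ : ℝ} (hP : P.Valid Δ) {D : ℝ} (hD : P.d0 ≠ -1 → D = 0)
    {i : ℕ} (hi : 1 ≤ i) (hn : i ≤ P.n) {z ξ : ℕ → ℝ} {w : ℝ × ℝ × ℝ} (hs : P.IsState i z ξ w)
    (hne : ∃ j, i ≤ j ∧ j ≤ P.n ∧ z j ≠ 0) :
    ∃ τ ρ l c, ∃ z' ξ' : ℕ → ℝ, Scaling P (P.coeffs D) (P.blend D τ) ρ l c ∧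
      (τ, z', ξ', w) ∈ P.sphere D i ∧ (∀ j, i ≤ j → j ≤ P.n + 1 → z j = ρ j * z' j) ∧
      (∀ j, i ≤ j → j ≤ P.n → ξ j = ρ j * ξ' j) ∧
      ∃ t : ℝ, (0 < t ∧ t ≤ 1 ∧ l = t ^ P.p0 ∧ c = t ^ P.d0 ∧ ρ = fun j => t ^ P.r0 j) ∨
        (1 ≤ t ∧ l = t ^ P.pInf ∧ c = t ^ P.dInf ∧ ρ = fun j => t ^ P.rInf j) := by
  have hE := hP.exponents
  set v : ℕ → ℝ := fun j => max |z j| |ξ j| with hv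
  have hv0 : ∀ j ∈ Finset.Icc i P.n, 0 ≤ v j := fun j _ => le_max_of_le_left (abs_nonneg _)
  have hvne : ∃ j ∈ Finset.Icc i P.n, 0 < v j := by
    obtain ⟨j, h1, h2, h3⟩ := hne
    exact ⟨j, Finset.mem_Icc.2 ⟨h1, h2⟩, lt_max_of_lt_left (abs_pos.2 h3)⟩
  have key : ∀ (τ : ℝ) (ρ : ℕ → ℝ) (l c : ℝ), τ ∈ Icc (-1 : ℝ) 1 →
      Scaling P (P.coeffs D) (P.blend D τ) ρ l c → (∀ j ∈ Finset.Icc i P.n, v j ≤ ρ j) →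
      (∃ j ∈ Finset.Icc i P.n, v j = ρ j) → ∃ z' ξ' : ℕ → ℝ, (τ, z', ξ', w) ∈ P.sphere D i ∧
      (∀ j, i ≤ j → j ≤ P.n + 1 → z j = ρ j * z' j) ∧
      (∀ j, i ≤ j → j ≤ P.n → ξ j = ρ j * ξ' j) := by
    intro τ ρ l c hτ hS hle ⟨k, hk, hkv⟩
    have hρ := hS.rho_pos
    set z' : ℕ → ℝ := fun j => if j ∈ Finset.Icc i P.n then (ρ j)⁻¹ * z j else 0 with hz'
    set ξ' : ℕ → ℝ := fun j => if j ∈ Finset.Icc i P.n then (ρ j)⁻¹ * ξ j else 0 with hξ'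
    have ez : ∀ j, i ≤ j → j ≤ P.n + 1 → z' j = (ρ j)⁻¹ * z j := by
      intro j h1 h2
      simp only [hz', Finset.mem_Icc]
      split_ifs with h
      · rfl
      · obtain rfl : j = P.n + 1 := by omega
        rw [hs.z_last, mul_zero]
    have eξ : ∀ j, i ≤ j → j ≤ P.n → ξ' j = (ρ j)⁻¹ * ξ j := by
      intro j h1 h2
      simp only [hξ', Finset.mem_Icc, h1, h2, and_self, if_true]
    have bd : ∀ (y : ℕ → ℝ) (j : ℕ), (∀ j, |y j| ≤ v j) →
        (if j ∈ Finset.Icc i P.n then (ρ j)⁻¹ * y j else 0) ∈ Icc (-1 : ℝ) 1 := by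
      intro y j hy
      rw [mem_Icc, ← abs_le]
      split_ifs with h
      · rw [abs_mul, abs_of_pos (inv_pos.2 (hρ j)), inv_mul_le_iff₀ (hρ j), mul_one]
        exact (hy j).trans (hle j h)
      · simp
    refine ⟨z', ξ', ⟨hτ, fun j _ => bd z j fun j => le_max_left _ _,
      fun j _ => bd ξ j fun j => le_max_right _ _,
      hS.symm.isState_of ez eξ hi hn hs, ?_⟩, ?_, ?_⟩
    · refine le_trans ?_ (Finset.single_le_sum (f := fun j => |z' j| + |ξ' j|)
        (fun j _ => by positivity) hk)
      obtain ⟨h1, h2⟩ := Finset.mem_Icc.1 hk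
      simp only [ez k h1 (by omega), eξ k h1 h2, abs_mul, abs_of_pos (inv_pos.2 (hρ k))]
      rw [← mul_add, ← div_eq_inv_mul, le_div_iff₀ (hρ k), one_mul, ← hkv]
      exact max_le_add_of_nonneg (abs_nonneg _) (abs_nonneg _)
    · intro j h1 h2
      rw [ez j h1 h2, mul_inv_cancel_left₀ (hρ j).ne']
    · intro j h1 h2
      rw [eξ j h1 h2, mul_inv_cancel_left₀ (hρ j).ne']
  by_cases hsmall : ∀ j ∈ Finset.Icc i P.n, v j ≤ 1
  · obtain ⟨t, ht, hle, k, hk, heq⟩ := exists_rpow_scale hv0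
      (fun j hj => hE.r0_pos j (hi.trans (Finset.mem_Icc.1 hj).1) (Finset.mem_Icc.1 hj).2) hvne
    have hk0 := hE.r0_pos k (hi.trans (Finset.mem_Icc.1 hk).1) (Finset.mem_Icc.1 hk).2
    have ht1 : t ≤ 1 := by
      by_contra! h
      have := Real.one_lt_rpow h hk0
      linarith [hsmall k hk]
    have hS := scaling_blend_of_le_one hE hD ht ht1
    obtain ⟨z', ξ', h1, h2, h3⟩ := key (t - 1) _ _ _ ⟨by linarith, by linarith⟩ hS hle ⟨k, hk, heq⟩
    exact ⟨_, _, _, _, z', ξ', hS, h1, h2, h3, t, Or.inl ⟨ht, ht1, rfl, rfl, rfl⟩⟩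
  · push Not at hsmall
    obtain ⟨m, hm, hm1⟩ := hsmall
    obtain ⟨t, ht, hle, k, hk, heq⟩ := exists_rpow_scale hv0
      (fun j hj => hE.rInf_pos j (hi.trans (Finset.mem_Icc.1 hj).1) (Finset.mem_Icc.1 hj).2) hvne
    have hm0 := hE.rInf_pos m (hi.trans (Finset.mem_Icc.1 hm).1) (Finset.mem_Icc.1 hm).2
    have ht1 : 1 ≤ t := by
      by_contra! h
      have := Real.rpow_lt_one ht.le h hm0
      linarith [hle m hm]
    have hS := scaling_blend_of_one_le hE hD ht1
    have hi1 := inv_le_one_of_one_le₀ ht1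
    have hi0 := inv_pos.2 ht
    obtain ⟨z', ξ', h1, h2, h3⟩ := key (1 - t⁻¹) _ _ _ ⟨by linarith, by linarith⟩ hS hle
      ⟨k, hk, heq⟩
    exact ⟨_, _, _, _, z', ξ', hS, h1, h2, h3, t, Or.inr ⟨ht1, rfl, rfl, rfl⟩⟩


/-! ### The set of ratios in terms of states -/

variable (P) in
/-- `w` is an admissible selection at `s`. -/
structure IsSelection (s : ℝ) (w : ℝ × ℝ × ℝ) : Prop where
  w1 : w.1 ∈ Icc (-1 : ℝ) 1
  w2 : w.2.1 ∈ Icc (-1 : ℝ) 1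
  w3 : w.2.2 ∈ Icc (-1 : ℝ) 1
  sel0 : P.e0 P.n = 0 → w.1 * s = |s|
  selInf : P.eInf P.n = 0 → w.2.1 * s = |s|

theorem mem_chainSet_of_lt (hE : P.Exponents) {Δ K : ℝ} {i j : ℕ} (hi : 1 ≤ i) (hij : i ≤ j)
    (hj : j < P.n) {s u : ℝ} : u ∈ P.chainSet Δ K i j s ↔ u = P.chain i j s := by
  obtain ⟨k, rfl⟩ := Nat.exists_eq_add_of_le' (hi.trans hij)
  have ha := hE.e0_pos (k + 1) (by omega) hj
  have hb := hE.eInf_pos (i := k + 1) (by omega) hj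
  simp only [chainSet, phiSet, Nat.add_sub_cancel, mem_ofPred_eq, hj.ne, if_false, sub_zero,
    spowSet_of_ne (Or.inr ha.ne'), spowSet_of_ne (Or.inr hb.ne'), mem_singleton_iff]
  rw [chain_succ hij]
  constructor
  · rintro ⟨a, rfl, b, rfl, -, -, rfl⟩; rfl
  · rintro rfl
    exact ⟨_, rfl, _, rfl, 0, by norm_num, rfl⟩

theorem mem_chainSet_last (hR : P.Regular) {Δ K : ℝ} {i : ℕ} {s u : ℝ} :
    u ∈ P.chainSet Δ K i P.n s ↔
      ∃ w, P.IsSelection s w ∧ u = P.lastVal (Δ / K) (P.chain i (P.n - 1) s) w := by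
  have hn : P.n - 1 < P.n := by have := hR.two_le_n; omega
  simp only [chainSet, phiSet, mem_ofPred_eq, if_true]
  constructor
  · rintro ⟨a, ha, b, hb, d, hd, rfl⟩
    obtain ⟨w1, h1, h2, rfl⟩ := mem_spowSet_iff.1 ha
    obtain ⟨w2, h3, h4, rfl⟩ := mem_spowSet_iff.1 hb
    exact ⟨(w1, w2, d), ⟨h1, h3, hd, fun h => (hR.mul_abs_chain_iff i hn _ _).1 (h2 h),
      fun h => (hR.mul_abs_chain_iff i hn _ _).1 (h4 h)⟩, rfl⟩
  · rintro ⟨w, hw, rfl⟩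
    exact ⟨_, mem_spowSet_iff.2 ⟨w.1, hw.w1, fun h => (hR.mul_abs_chain_iff i hn _ _).2 (hw.sel0 h),
      rfl⟩, _, mem_spowSet_iff.2 ⟨w.2.1, hw.w2,
      fun h => (hR.mul_abs_chain_iff i hn _ _).2 (hw.selInf h), rfl⟩, w.2.2, hw.w3, rfl⟩

theorem coord_of_seq (z : ℕ → ℝ) {j : ℕ} (h1 : 1 ≤ j) (hj : j ≤ P.n) :
    coord (P := P) (fun k => z (k + 1)) j = z j := by
  rw [coord, dif_pos ⟨h1, hj⟩]
  simp only [Nat.sub_add_cancel h1]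

theorem coord_succ_n (z : Fin P.n → ℝ) : coord z (P.n + 1) = 0 := by
  rw [coord, dif_neg (by omega)]

theorem isState_coord (hR : P.Regular) {i : ℕ} (hi : 1 ≤ i) (z : Fin P.n → ℝ) {w : ℝ × ℝ × ℝ}
    (hw : P.IsSelection (coord z i) w) :
    P.IsState i (coord z) (fun j => P.xi j (coord z (j + 1))) w :=
  ⟨P.xi_last _, coord_succ_n z, fun _ hij hj => (hR.phi_xi (hi.trans hij) hj _).symm, hw.w1, hw.w2,
    hw.w3, hw.sel0, hw.selInf⟩

theorem IsState.xi_eq (hR : P.Regular) {i j : ℕ} (hi : 1 ≤ i) (hij : i ≤ j) (hj : j ≤ P.n)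
    {z ξ : ℕ → ℝ} {w : ℝ × ℝ × ℝ} (h : P.IsState i z ξ w) : P.xi j (z (j + 1)) = ξ j := by
  rcases hj.eq_or_lt with rfl | hj
  · rw [P.xi_last, h.xi_last]
  · rw [h.eq_phi j hij hj, hR.xi_phi (hi.trans hij) hj]

theorem Valid.ratio_eq {Δ : ℝ} (hP : P.Valid Δ) (K : ℝ) (kt : ℕ → ℝ) {i : ℕ} (hi : 1 ≤ i)
    (hn : i < P.n) {y : Fin P.n → ℝ} {u z ξ : ℕ → ℝ} {w : ℝ × ℝ × ℝ}
    (hz : ∀ j, i ≤ j → j ≤ P.n + 1 → coord y j = z j)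
    (hξ : ∀ j, i ≤ j → j ≤ P.n → P.xi j (z (j + 1)) = ξ j)
    (hu : ∀ j ∈ Finset.Icc (i + 1) P.n, u j = P.sel (Δ / K) i (z i) w j) :
    (∑ j ∈ Finset.Icc (i + 1) P.n,
          kt j * (P.sPart (j - 1) (coord y (j - 1)) (coord y j) +
              P.sigma j (coord y j) (coord y (j + 1))) * (coord y (j + 1) - u j)) /
        (P.sigma i (coord y i) (coord y (i + 1)) * (P.phi i (coord y i) - coord y (i + 1))) =
      P.num (Δ / K) kt i z ξ w / P.den i z ξ := by
  have hE := hP.exponents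
  rw [num, den, hz i le_rfl (by omega), hz (i + 1) (by omega) (by omega), hE.sigma_eq hi hn.le,
    hξ i le_rfl hn.le]
  congr 1
  refine Finset.sum_congr rfl fun j hj => ?_
  obtain ⟨h1, h2⟩ := Finset.mem_Icc.1 hj
  rw [hu j hj, hz j (by omega) (by omega), hz (j - 1) (by omega) (by omega),
    hz (j + 1) (by omega) (by omega), hE.sigma_eq (by omega) h2, hξ j (by omega) h2,
    hP.sPart_eq (by omega) (by omega)]
  have := hξ (j - 1) (by omega) (by omega)
  rw [Nat.sub_add_cancel (by omega)] at this
  rw [this]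

theorem Valid.mem_ratioSet {Δ : ℝ} (hP : P.Valid Δ) {K : ℝ} {kt : ℕ → ℝ} {i : ℕ} (hi : 1 ≤ i)
    (hn : i < P.n) {q : ℝ} : q ∈ P.ratioSet Δ K kt i ↔ ∃ z ξ w, P.IsState i z ξ w ∧ z i ≠ ξ i ∧
      q = P.num (Δ / K) kt i z ξ w / P.den i z ξ := by
  have hR := hP.regular
  constructor
  · rintro ⟨y, u, hne, hu, rfl⟩
    obtain ⟨w, hw, hun⟩ := (mem_chainSet_last hR).1 (hu P.n (Finset.mem_Icc.2 ⟨hn, le_rfl⟩))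
    refine ⟨coord y, fun j => P.xi j (coord y (j + 1)), w, isState_coord hR hi y hw, ?_,
      hP.ratio_eq K kt hi hn (fun _ _ _ => rfl) (fun _ _ _ => rfl) ?_⟩
    · intro h0
      rw [h0, hR.phi_xi hi hn] at hne
      exact hne rfl
    · intro j hj
      obtain ⟨h1, h2⟩ := Finset.mem_Icc.1 hj
      rw [sel]
      split_ifs with hjn
      · rw [hjn, hun]
      · exact (mem_chainSet_of_lt hR.toExponents hi (by omega) (by omega)).1 (hu j hj)
  · rintro ⟨z, ξ, w, hs, hne, rfl⟩
    have hz : ∀ j, i ≤ j → j ≤ P.n + 1 → coord (P := P) (fun k => z (k + 1)) j = z j := by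
      intro j h1 h2
      rcases h2.eq_or_lt with rfl | h2
      · rw [coord_succ_n, hs.z_last]
      · exact coord_of_seq z (by omega) (by omega)
    refine ⟨fun k => z (k + 1), P.sel (Δ / K) i (z i) w, ?_, ?_, (hP.ratio_eq K kt hi hn hz
      (fun j h1 h2 => hs.xi_eq hR hi h1 h2) fun _ _ => rfl).symm⟩
    · rw [hz i le_rfl (by omega), hz (i + 1) (by omega) (by omega), hs.eq_phi i le_rfl hn]
      exact fun h => hne ((hR.strictMono_phi hi hn).injective h)
    · intro j hj
      obtain ⟨h1, h2⟩ := Finset.mem_Icc.1 hj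
      rw [hz i le_rfl (by omega), sel]
      split_ifs with hjn
      · rw [hjn]
        exact (mem_chainSet_last hR).2 ⟨w, ⟨hs.w1, hs.w2, hs.w3, hs.sel0, hs.selInf⟩, rfl⟩
      · exact (mem_chainSet_of_lt hR.toExponents hi (by omega) (by omega)).2 rfl

theorem isState_single {i : ℕ} (hn : i < P.n) : P.IsState i (Pi.single i 1) 0 (1, 1, 0) := by
  have zj : ∀ j, j ≠ i → (Pi.single i 1 : ℕ → ℝ) j = 0 := fun j hj => by simp [hj]
  refine ⟨rfl, zj _ (by omega), fun j h1 h2 => ?_, ?_, ?_, ?_, ?_, ?_⟩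
  · rw [zj _ (by omega), Pi.zero_apply, phi_zero]
  all_goals simp

/-! ### Backward induction -/

theorem num_den_congr (C : Coeffs) (kt : ℕ → ℝ) {i : ℕ} (hi : 1 ≤ i) (hn : i ≤ P.n)
    {z z' ξ : ℕ → ℝ} (hz : ∀ j, i ≤ j → j ≤ P.n + 1 → z j = z' j) (w : ℝ × ℝ × ℝ) :
    (P.withCoeffs C).num C.D kt i z ξ w = (P.withCoeffs C).num C.D kt i z' ξ w ∧
      (P.withCoeffs C).den i z ξ = (P.withCoeffs C).den i z' ξ := by
  have hS : Scaling P C C (fun _ => 1) 1 1 := by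
    constructor <;> simp
  have h1 := hS.num (by omega) hi (z := z) (z' := z') (ξ := ξ) (ξ' := ξ) (by simpa using hz)
    (by simp) kt hn w
  have h2 := hS.den hi (z := z) (z' := z') (ξ := ξ) (ξ' := ξ) (by simpa using hz)
    (by simp) hn
  simp only [one_mul] at h1 h2
  exact ⟨h1, h2⟩

variable (P) in
/-- The derivative along the tails of the error dynamics starting at the index `i` is negative, for
all members of the path of systems. -/
def TailNeg (D : ℝ) (kt : ℕ → ℝ) (i : ℕ) : Prop :=
  ∀ τ ∈ Icc (-1 : ℝ) 1, ∀ z ξ w, (P.path D τ).IsState i z ξ w →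
    (∃ j, i ≤ j ∧ j ≤ P.n ∧ z j ≠ 0) → (P.path D τ).full (P.blend D τ).D kt i z ξ w < 0

section

variable {Δ : ℝ} (hP : P.Valid Δ)
include hP

theorem Admissible.tailNeg_last {D : ℝ} (hD : P.Admissible D) {kt : ℕ → ℝ} (hkt : 0 < kt P.n) :
    P.TailNeg D kt P.n := by
  intro τ _ z ξ w hs ⟨j, h1, h2, hz⟩
  have hn : 1 ≤ P.n := (by norm_num : 1 ≤ 2).trans hP.two_le_n
  obtain rfl : j = P.n := le_antisymm h2 h1
  have hξ : ξ P.n = 0 := hs.xi_last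
  have hzl : z (P.n + 1) = 0 := hs.z_last
  have e := full_last (P := P.path D τ) (P.blend D τ).D kt z ξ w hn
  change (P.path D τ).full (P.blend D τ).D kt P.n z ξ w = kt P.n * (P.path D τ).sg P.n (z P.n)
    (ξ P.n) * (z (P.n + 1) - (P.path D τ).lastVal (P.blend D τ).D (z P.n) w) at e
  rw [e, hξ, hzl, zero_sub]
  have h3 := hD.mul_lastVal_pos hP τ hz hs.sel0 hs.selInf hs.w3
  have h4 := (hP.regular_path D τ).mul_sg_pos (i := P.n) hn le_rfl hz
  rw [sub_zero] at h4
  have h5 : 0 < z P.n ^ 2 := by positivity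
  have h6 : 0 < z P.n ^ 2 * (kt P.n * (P.path D τ).sg P.n (z P.n) 0 *
      (P.path D τ).lastVal (P.blend D τ).D (z P.n) w) := by
    calc 0 < kt P.n * ((z P.n * (P.path D τ).sg P.n (z P.n) 0) *
        (z P.n * (P.path D τ).lastVal (P.blend D τ).D (z P.n) w)) :=
          mul_pos hkt (mul_pos h4 h3)
      _ = _ := by ring
  have := (pos_iff_pos_of_mul_pos h6).1 h5
  linarith

theorem TailNeg.num_neg {D : ℝ} {kt : ℕ → ℝ} {i : ℕ} (hi : 1 ≤ i) (hn : i < P.n)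
    (h : P.TailNeg D kt (i + 1)) {τ : ℝ} (hτ : τ ∈ Icc (-1 : ℝ) 1) {z ξ : ℕ → ℝ} {w : ℝ × ℝ × ℝ}
    (hs : (P.path D τ).IsState i z ξ w) (hne : ∃ j, i ≤ j ∧ j ≤ P.n ∧ z j ≠ 0) (hz : z i = ξ i) :
    (P.path D τ).num (P.blend D τ).D kt i z ξ w < 0 := by
  have hR := hP.regular_path D τ
  have hξ := hs.eq_phi i le_rfl hn
  rw [num_eq_full_succ _ kt hi w hz hξ]
  refine h τ hτ z ξ w (hs.succ hR hi hn hz) ?_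
  by_contra! hcon
  obtain ⟨j, h1, h2, h3⟩ := hne
  rcases h1.eq_or_lt with rfl | h1
  · rw [hcon (i + 1) le_rfl hn, eq_comm, hR.phi_eq_zero hi hn, ← hz] at hξ
    exact h3 hξ
  · exact h3 (hcon j h1 h2)

theorem TailNeg.exists_num_le {D : ℝ} (hD : P.d0 ≠ -1 → D = 0) {kt : ℕ → ℝ} {i : ℕ} (hi : 1 ≤ i)
    (hn : i < P.n) (h : P.TailNeg D kt (i + 1)) : ∃ b, ∀ z ξ w, P.IsState i z ξ w → z i ≠ ξ i →
      P.num D kt i z ξ w ≤ b * P.den i z ξ := by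
  have h0 : ∀ x ∈ P.sphere D i, 0 ≤ (P.path D x.1).den i x.2.1 x.2.2.1 := fun x hx =>
    hx.2.2.2.1.den_nonneg (hP.regular_path D x.1) hi hn
  have h1 : ∀ x ∈ P.sphere D i, (P.path D x.1).den i x.2.1 x.2.2.1 = 0 →
      (P.path D x.1).num (P.blend D x.1).D kt i x.2.1 x.2.2.1 x.2.2.2 < 0 := fun x hx h0 =>
    h.num_neg hP hi hn hx.1 hx.2.2.2.1 (exists_ne_zero_of_mem_sphere hP hi hx)
      (hx.2.2.2.1.eq_of_den_eq_zero (hP.regular_path D x.1) hi hn h0)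
  obtain ⟨b, hb⟩ := (hP.isCompact_sphere D hi).exists_le_mul (hP.continuous_path_num D kt hi)
    (hP.continuous_path_den D hi hn) h0 h1
  refine ⟨b, fun z ξ w hs hne => ?_⟩
  have hne' : ∃ j, i ≤ j ∧ j ≤ P.n ∧ z j ≠ 0 := by
    by_contra! hcon
    have := hs.xi_eq_zero hP.regular hi hcon i le_rfl hn.le
    rw [hcon i le_rfl hn.le, this] at hne
    exact hne rfl
  obtain ⟨τ, ρ, l, c, z', ξ', hS, hx, hz, hξ, -⟩ := hs.exists_mem_sphere hP hD hi hn.le hne'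
  have h1 := hS.num (by omega) hi hz hξ kt hn.le w
  have h2 := hS.den hi hz hξ hn.le
  change P.num D kt i z ξ w = _ at h1
  change P.den i z ξ = _ at h2
  have h3 : (P.path D τ).num (P.blend D τ).D kt i z' ξ' w ≤ b * (P.path D τ).den i z' ξ' :=
    hb (τ, z', ξ', w) hx
  have h4 := mul_le_mul_of_nonneg_left h3 (mul_pos hS.l_pos hS.c_pos).le
  rw [h1, h2, mul_left_comm]
  exact h4

theorem TailNeg.bddAbove {K : ℝ} (hD : P.d0 ≠ -1 → Δ / K = 0) {kt : ℕ → ℝ} {i : ℕ} (hi : 1 ≤ i)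
    (hn : i < P.n) (h : P.TailNeg (Δ / K) kt (i + 1)) : BddAbove (P.ratioSet Δ K kt i) := by
  obtain ⟨b, hb⟩ := h.exists_num_le hP hD hi hn
  refine ⟨b, fun q hq => ?_⟩
  obtain ⟨z, ξ, w, hs, hne, rfl⟩ := (hP.mem_ratioSet hi hn).1 hq
  have hpos : 0 < P.den i z ξ := hs.den_eq hn ▸ hP.regular.den_pos hi hn hne
  exact (div_le_iff₀ hpos).2 (hb z ξ w hs hne)

/-- The bound on the ratios extends to the whole path of systems, including its end points. -/
theorem Valid.num_le_omega_mul_den {K : ℝ} (hD : P.d0 ≠ -1 → Δ / K = 0) {kt : ℕ → ℝ} {i : ℕ}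
    (hi : 1 ≤ i) (hn : i < P.n) (hb : BddAbove (P.ratioSet Δ K kt i)) {τ : ℝ}
    (hτ : τ ∈ Icc (-1 : ℝ) 1) {z ξ : ℕ → ℝ} {w : ℝ × ℝ × ℝ}
    (hs : (P.path (Δ / K) τ).IsState i z ξ w) (hne : z i ≠ ξ i) :
    (P.path (Δ / K) τ).num (P.blend (Δ / K) τ).D kt i z ξ w ≤
      P.omega Δ K kt i * (P.path (Δ / K) τ).den i z ξ := by
  set D := Δ / K with hDdef
  set y : ℝ → ℕ → ℝ := fun t j => if j ≤ i then z j else if j ≤ P.n then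
    (P.path D t).phi (j - 1) (ξ (j - 1)) else 0 with hy
  have hyi : ∀ t, y t i = z i := fun t => by simp [hy]
  have hyc : Continuous y := by
    refine continuous_pi fun j => ?_
    simp only [hy]
    split_ifs with h1 h2
    · exact continuous_const
    · have f : Continuous fun t : ℝ => (t, ξ (j - 1)) := by fun_prop
      exact (hP.continuous_path_phi D (j := j - 1) (by omega) (by omega)).comp f
    · exact continuous_const
  have hyτ : ∀ j, i ≤ j → j ≤ P.n + 1 → z j = y τ j := by
    intro j h1 h2
    simp only [hy]
    split_ifs with h3 h4
    · rfl
    · obtain ⟨k, rfl⟩ := Nat.exists_eq_add_of_le' (hi.trans h1)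
      exact hs.eq_phi k (by omega) (by change k < P.n; omega)
    · obtain rfl : j = P.n + 1 := by omega
      exact hs.z_last
  have hstate : ∀ t, (P.path D t).IsState i (y t) ξ w := by
    intro t
    refine ⟨hs.xi_last, ?_, ?_, hs.w1, hs.w2, hs.w3, ?_, ?_⟩
    · change y t (P.n + 1) = 0
      simp only [hy]
      rw [if_neg (by omega), if_neg (by omega)]
    · intro j h1 h2
      change j < P.n at h2
      simp only [hy]
      rw [if_neg (by omega), if_pos (by omega)]
      rfl
    · rw [hyi]; exact hs.sel0
    · rw [hyi]; exact hs.selInf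
  have hint : ∀ t ∈ Ioo (-1 : ℝ) 1, (P.path D t).num (P.blend D t).D kt i (y t) ξ w ≤
      P.omega Δ K kt i * (P.path D t).den i (y t) ξ := by
    intro t ht
    obtain ⟨ρ, l, c, hS⟩ := exists_scaling_blend hP.exponents hD ht
    have hst : P.IsState i (fun j => ρ j * y t j) (fun j => ρ j * ξ j) w :=
      hS.isState_of (fun _ _ _ => rfl) (fun _ _ _ => rfl) hi hn.le (hstate t)
    have h1 := hS.num (by omega) hi (z := fun j => ρ j * y t j) (ξ := fun j => ρ j * ξ j)
      (fun _ _ _ => rfl) (fun _ _ _ => rfl) kt hn.le w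
    have h2 := hS.den hi (z := fun j => ρ j * y t j) (ξ := fun j => ρ j * ξ j)
      (fun _ _ _ => rfl) (fun _ _ _ => rfl) hn.le
    change P.num D kt i _ _ w = _ at h1
    change P.den i _ _ = _ at h2
    have hne' : ρ i * y t i ≠ ρ i * ξ i := by
      rw [hyi]
      exact fun h => hne (mul_left_cancel₀ (hS.rho_pos i).ne' h)
    have hpos : 0 < P.den i (fun j => ρ j * y t j) (fun j => ρ j * ξ j) :=
      hst.den_eq hn ▸ hP.regular.den_pos hi hn hne'
    have hle := le_csSup hb ((hP.mem_ratioSet hi hn).2 ⟨_, _, w, hst, hne', rfl⟩)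
    rw [div_le_iff₀ hpos, ← hDdef, h1, h2, mul_left_comm] at hle
    exact le_of_mul_le_mul_left hle (mul_pos hS.l_pos hS.c_pos)
  obtain ⟨e1, e2⟩ := num_den_congr (P.blend D τ) kt hi hn.le (ξ := ξ) hyτ w
  rw [e1, e2]
  have : (𝓝[Ioo (-1 : ℝ) 1] τ).NeBot := by
    rw [← mem_closure_iff_nhdsWithin_neBot, closure_Ioo (by norm_num)]
    exact hτ
  have hx : Continuous fun t : ℝ => ((t, y t, ξ, w) : Pt) := by fun_prop
  have c1 := ((hP.continuous_path_num D kt hi).comp hx).continuousAt (x := τ)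
  have c2 := (((hP.continuous_path_den D hi hn).comp hx).continuousAt (x := τ)).const_mul
    (P.omega Δ K kt i)
  exact le_of_tendsto_of_tendsto (c1.mono_left nhdsWithin_le_nhds)
    (c2.mono_left nhdsWithin_le_nhds) (eventually_mem_nhdsWithin.mono hint)

theorem TailNeg.pred {K : ℝ} (hD : P.d0 ≠ -1 → Δ / K = 0) {kt : ℕ → ℝ} {i : ℕ} (hi : 1 ≤ i)
    (hn : i < P.n) (h : P.TailNeg (Δ / K) kt (i + 1)) (hω : P.omega Δ K kt i < kt i) :
    P.TailNeg (Δ / K) kt i := by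
  intro τ hτ z ξ w hs hne
  have e := full_eq (P := P.path (Δ / K) τ) (P.blend (Δ / K) τ).D kt hi hn z ξ w
  rw [e]
  rcases eq_or_ne (z i) (ξ i) with hz | hz
  · have h1 := h.num_neg hP hi hn hτ hs hne hz
    have h2 : (P.path (Δ / K) τ).den i z ξ = 0 := by rw [den, hz, sg_self, zero_mul]
    rw [h2, mul_zero, sub_zero]
    exact h1
  · have h1 := hP.num_le_omega_mul_den hD hi hn (h.bddAbove hP hD hi hn) hτ hs hz
    have hpos : 0 < (P.path (Δ / K) τ).den i z ξ :=
      IsState.den_eq (P := P.path (Δ / K) τ) hn hs ▸ (hP.regular_path (Δ / K) τ).den_pos hi hn hz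
    have := mul_lt_mul_of_pos_right hω hpos
    linarith

theorem Admissible.tailNeg {K : ℝ} (hD : P.Admissible (Δ / K)) {kt : ℕ → ℝ} (hkt : 0 < kt P.n)
    {i : ℕ} (hi : 1 ≤ i) (hn : i ≤ P.n)
    (hω : ∀ j ∈ Finset.Icc i (P.n - 1), P.omega Δ K kt j < kt j) : P.TailNeg (Δ / K) kt i := by
  induction hn using Nat.decreasingInduction with
  | self => exact hD.tailNeg_last hP hkt
  | of_succ k hk ih =>
    refine TailNeg.pred hP hD.eq_zero hi hk (ih (by omega) fun j hj => hω j ?_)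
      (hω k (Finset.mem_Icc.2 ⟨le_rfl, by omega⟩))
    obtain ⟨h1, h2⟩ := Finset.mem_Icc.1 hj
    exact Finset.mem_Icc.2 ⟨by omega, h2⟩

theorem Valid.admissible {K : ℝ} (hK : Δ < K * P.kappa P.n) : 0 < K ∧ P.Admissible (Δ / K) := by
  have hκ := hP.kappa_pos P.n (Finset.mem_Icc.2 ⟨by linarith [hP.two_le_n], le_rfl⟩)
  have hK0 : 0 < K := by
    by_contra! h
    have := hP.Delta_nonneg
    nlinarith
  refine ⟨hK0, div_nonneg hP.Delta_nonneg hK0.le, ?_, fun h => ?_⟩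
  · rw [div_lt_iff₀ hK0]; linarith
  · rw [hP.Delta_eq_zero h, zero_div]

theorem Valid.slope_nonneg {i : ℕ} (h1 : 1 ≤ i) (hn : i ≤ P.n) (ξ : ℝ) : 0 ≤ P.slope i ξ := by
  have hi := Finset.mem_Icc.2 ⟨h1, hn⟩
  have := hP.kappa_pos i hi
  have := hP.theta_pos i hi
  have := hP.beta0_pos i hi
  have := hP.betaInf_pos i hi
  have hE := hP.exponents
  have h0 := hE.e0_nonneg i h1 hn
  have := h0.trans (hE.e0_le i h1 hn)
  have := hE.m0_pos i h1 hn
  have := hE.mInf_pos h1 hn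
  exact div_nonneg (by positivity) (by positivity)

/-- A point at which the ratio is nonnegative. -/
theorem Valid.exists_mem_ratioSet_nonneg {K : ℝ} {kt : ℕ → ℝ} {i : ℕ} (hi : 1 ≤ i) (hn : i < P.n)
    (hkt : 0 ≤ kt (i + 1)) : ∃ q ∈ P.ratioSet Δ K kt i, 0 ≤ q := by
  have hR := hP.regular
  have hs := isState_single hn
  refine ⟨_, (hP.mem_ratioSet hi hn).2 ⟨_, _, _, hs, by simp, rfl⟩,
    div_nonneg ?_ (hs.den_nonneg hR hi hn)⟩
  have zi : (Pi.single i 1 : ℕ → ℝ) i = 1 := by simp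
  have zj : ∀ j, j ≠ i → (Pi.single i 1 : ℕ → ℝ) j = 0 := fun j hj => by simp [hj]
  refine Finset.sum_nonneg fun j hj => ?_
  obtain ⟨h1, h2⟩ := Finset.mem_Icc.1 hj
  rw [zj j (by omega), zj (j + 1) (by omega), Pi.zero_apply, Pi.zero_apply, sg_self, add_zero,
    zero_sub]
  rcases h1.eq_or_lt with rfl | h1
  · rw [Nat.add_sub_cancel, zi, sp, sub_zero, neg_one_mul, mul_neg, mul_neg, neg_mul, neg_neg]
    refine mul_nonneg (mul_nonneg hkt (hP.slope_nonneg hi hn.le _)) ?_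
    have hc : ∀ j, j < P.n → 0 < P.chain i j 1 := fun j hj => by
      have := hR.strictMono_chain i hj zero_lt_one
      rwa [chain_zero] at this
    rw [sel]
    split_ifs with hin
    · have hss : ∀ p : ℝ, 0 ≤ ssel p (P.chain i (P.n - 1) 1) 1 := fun p => by
        rw [ssel]; split_ifs
        · exact zero_le_one
        · exact (spow_pos p (hc _ (by omega))).le
      have := hP.kappa_pos P.n (Finset.mem_Icc.2 ⟨by omega, le_rfl⟩)
      have := hP.theta_pos P.n (Finset.mem_Icc.2 ⟨by omega, le_rfl⟩)
      have a := hss (P.e0 P.n)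
      have b := hss (P.eInf P.n)
      rw [lastVal, mul_zero, sub_zero]
      exact add_nonneg (mul_nonneg (by positivity) a) (mul_nonneg (by positivity) b)
    · exact (hc _ (by omega)).le
  · rw [zj (j - 1) (by omega), sp_self, mul_zero, zero_mul]

theorem Valid.ratioSet_nonempty {K : ℝ} {kt : ℕ → ℝ} {i : ℕ} (hi : 1 ≤ i) (hn : i < P.n) :
    (P.ratioSet Δ K kt i).Nonempty :=
  ⟨_, (hP.mem_ratioSet hi hn).2 ⟨_, _, _, isState_single hn, by simp, rfl⟩⟩

/-- Well-posedness of the backward selection. -/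
theorem Valid.isLUB_omega {K : ℝ} {kt : ℕ → ℝ} (hK : Δ < K * P.kappa P.n) (hkt : 0 < kt P.n)
    {i : ℕ} (hi : i ∈ Finset.Icc 1 (P.n - 1))
    (hω : ∀ j ∈ Finset.Icc (i + 1) (P.n - 1), P.omega Δ K kt j < kt j) :
    IsLUB (P.ratioSet Δ K kt i) (P.omega Δ K kt i) := by
  obtain ⟨h1, h2⟩ := Finset.mem_Icc.1 hi
  have hn := hP.two_le_n
  have hD := (hP.admissible hK).2
  exact isLUB_csSup (hP.ratioSet_nonempty h1 (by omega))
    ((hD.tailNeg hP hkt (by omega) (by omega) hω).bddAbove hP hD.eq_zero h1 (by omega))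

theorem Valid.omega_nonneg {K : ℝ} {kt : ℕ → ℝ} {i : ℕ} (hi : 1 ≤ i) (hn : i < P.n)
    (hkt : 0 ≤ kt (i + 1)) (h : IsLUB (P.ratioSet Δ K kt i) (P.omega Δ K kt i)) :
    0 ≤ P.omega Δ K kt i := by
  obtain ⟨q, hq, hq0⟩ := hP.exists_mem_ratioSet_nonneg (K := K) hi hn hkt
  exact hq0.trans (h.1 hq)

theorem Valid.kt_pos {K : ℝ} {kt : ℕ → ℝ} (hS : P.Selection Δ K kt) {i : ℕ} (hi : 1 ≤ i)
    (hn : i ≤ P.n) : 0 < kt i := by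
  induction hn using Nat.decreasingInduction with
  | self => exact hS.last_pos
  | of_succ k hk ih =>
    have hk' : k ∈ Finset.Icc 1 (P.n - 1) := Finset.mem_Icc.2 ⟨hi, by omega⟩
    refine (hP.omega_nonneg hi hk (ih (by omega)).le (hP.isLUB_omega hS.lt_last hS.last_pos hk'
      fun j hj => hS.omega_lt j ?_)).trans_lt (hS.omega_lt k hk')
    obtain ⟨h1, h2⟩ := Finset.mem_Icc.1 hj
    exact Finset.mem_Icc.2 ⟨by omega, h2⟩

end

end DiffParams

theorem IsCompact.exists_pos_le {X : Type*} [TopologicalSpace X] {S : Set X} (hS : IsCompact S)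
    {f : X → ℝ} (hf : Continuous f) (h : ∀ x ∈ S, 0 < f x) : ∃ m > 0, ∀ x ∈ S, m ≤ f x := by
  rcases S.eq_empty_or_nonempty with rfl | hne
  · exact ⟨1, one_pos, fun x hx => hx.elim⟩
  · obtain ⟨a, ha, hmin⟩ := hS.exists_isMinOn hne hf.continuousOn
    exact ⟨f a, h a ha, fun x hx => hmin hx⟩

namespace DiffParams

variable {P : DiffParams}

/-! ### The derivative of the Lyapunov function -/

variable (P) in
/-- The coordinate functions as continuous linear maps. -/
noncomputable def coordL (j : ℕ) : (Fin P.n → ℝ) →L[ℝ] ℝ :=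
  if h : 1 ≤ j ∧ j ≤ P.n then ContinuousLinearMap.proj ⟨j - 1, by omega⟩ else 0

theorem coordL_apply (j : ℕ) (z : Fin P.n → ℝ) : P.coordL j z = coord z j := by
  unfold coordL coord
  split_ifs <;> rfl

theorem coord_zero (j : ℕ) : coord (P := P) 0 j = 0 := by
  rw [← coordL_apply, map_zero]

theorem coord_fin (z : Fin P.n → ℝ) (k : Fin P.n) : coord z (k + 1) = z k := by
  rw [coord, dif_pos ⟨by omega, by omega⟩]
  rfl

theorem exists_coord_ne_zero {z : Fin P.n → ℝ} (hz : z ≠ 0) :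
    ∃ j, 1 ≤ j ∧ j ≤ P.n ∧ coord z j ≠ 0 := by
  obtain ⟨k, hk⟩ := Function.ne_iff.1 hz
  exact ⟨k + 1, by omega, by omega, by rwa [coord_fin]⟩

theorem sum_Icc_shift (F : ℕ → ℝ) {n : ℕ} (hn : 1 ≤ n) :
    ∑ j ∈ Finset.Icc 1 n, F (j + 1) =
      (∑ j ∈ Finset.Icc 1 n, if j = 1 then 0 else F j) + F (n + 1) := by
  induction n, hn using Nat.le_induction with
  | base => simp
  | succ n hn ih =>
    rw [Finset.sum_Icc_succ_top (by omega), Finset.sum_Icc_succ_top (by omega), ih,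
      if_neg (by omega)]

/-- The set-valued term shrinks if `K` grows. -/
theorem chainSet_mono {Δ K k : ℝ} (hK : 0 < K) (hk : K ≤ k) (i j : ℕ) (s : ℝ) :
    P.chainSet Δ k i j s ⊆ P.chainSet Δ K i j s := by
  have hk0 := hK.trans_le hk
  rintro u ⟨a, ha, b, hb, d, hd, rfl⟩
  refine ⟨a, ha, b, hb, K / k * d, ?_, ?_⟩
  · rw [mem_Icc, ← abs_le] at hd ⊢
    rw [abs_mul, abs_of_pos (div_pos hK hk0)]
    exact mul_le_one₀ ((div_le_one hk0).2 hk) (abs_nonneg d) hd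
  · split_ifs
    · rw [show Δ / K * (K / k * d) = Δ / k * d by field_simp]
    · rfl

section

variable {Δ : ℝ} (hP : P.Valid Δ)
include hP

theorem Valid.hasFDerivAt_Z {i : ℕ} (h1 : 1 ≤ i) (hn : i ≤ P.n) (x y : ℝ) :
    ∃ f' : ℝ × ℝ →L[ℝ] ℝ, HasFDerivAt (fun w : ℝ × ℝ => P.Z i w.1 w.2) f' (x, y) ∧
      (∀ a, f' (a, 0) = P.sg i x (P.xi i y) * a) ∧
      (i < P.n → ∀ b, f' (0, b) = P.sp i x (P.xi i y) * b) := by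
  have hd := ((hP.contDiff_Z h1 hn).differentiable one_ne_zero (x, y)).hasFDerivAt
  refine ⟨_, hd, fun a => ?_, fun hi b => ?_⟩
  · have hl : HasDerivAt (fun t : ℝ => (t, y)) ((1 : ℝ), (0 : ℝ)) x :=
      (hasDerivAt_id x).prodMk (hasDerivAt_const x y)
    have hc := HasFDerivAt.comp_hasDerivAt (l := fun w : ℝ × ℝ => P.Z i w.1 w.2) x hd hl
    have := hc.unique (hP.exponents.hasDerivAt_Z_left h1 hn x y)
    rw [show ((a, 0) : ℝ × ℝ) = a • ((1 : ℝ), (0 : ℝ)) by simp, map_smul, this, smul_eq_mul,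
      mul_comm]
  · have hl : HasDerivAt (fun t : ℝ => (x, t)) ((0 : ℝ), (1 : ℝ)) y :=
      (hasDerivAt_const y x).prodMk (hasDerivAt_id y)
    have hc := HasFDerivAt.comp_hasDerivAt (l := fun w : ℝ × ℝ => P.Z i w.1 w.2) y hd hl
    have := hc.unique (hP.hasDerivAt_Z_right h1 hi x y)
    rw [show ((0, b) : ℝ × ℝ) = b • ((0 : ℝ), (1 : ℝ)) by simp, map_smul, this, smul_eq_mul,
      mul_comm]

theorem Valid.contDiff_V : ContDiff ℝ 1 P.V := by
  unfold V
  refine ContDiff.sum fun j hj => ?_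
  obtain ⟨h1, h2⟩ := Finset.mem_Icc.1 hj
  have := (hP.contDiff_Z h1 h2).comp ((P.coordL j).contDiff.prodMk (P.coordL (j + 1)).contDiff)
  simpa only [Function.comp_def, coordL_apply] using this

theorem Valid.fderiv_V (z v : Fin P.n → ℝ) : fderiv ℝ P.V z v =
    ∑ j ∈ Finset.Icc 1 P.n, ((if j = 1 then 0 else P.sp (j - 1) (coord z (j - 1))
      (P.xi (j - 1) (coord z j))) + P.sg j (coord z j) (P.xi j (coord z (j + 1)))) *
      coord v j := by
  have hn : 1 ≤ P.n := (by norm_num : 1 ≤ 2).trans hP.two_le_n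
  have key : ∀ j ∈ Finset.Icc 1 P.n, ∃ g' : (Fin P.n → ℝ) →L[ℝ] ℝ,
      HasFDerivAt (fun y => P.Z j (coord y j) (coord y (j + 1))) g' z ∧
      g' v = P.sg j (coord z j) (P.xi j (coord z (j + 1))) * coord v j +
        P.sp j (coord z j) (P.xi j (coord z (j + 1))) * coord v (j + 1) := by
    intro j hj
    obtain ⟨h1, h2⟩ := Finset.mem_Icc.1 hj
    obtain ⟨f', hf, ha, hb⟩ := hP.hasFDerivAt_Z h1 h2 (coord z j) (coord z (j + 1))
    have hL := ((P.coordL j).prod (P.coordL (j + 1))).hasFDerivAt (x := z)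
    have hf2 : HasFDerivAt (fun w : ℝ × ℝ => P.Z j w.1 w.2) f'
        (((P.coordL j).prod (P.coordL (j + 1))) z) := by
      simpa only [ContinuousLinearMap.prod_apply, coordL_apply] using hf
    have hc := hf2.comp z hL
    refine ⟨_, by simpa only [Function.comp_def, ContinuousLinearMap.prod_apply, coordL_apply]
      using hc, ?_⟩
    rw [ContinuousLinearMap.comp_apply, ContinuousLinearMap.prod_apply, coordL_apply,
      coordL_apply, ← ha]
    rcases h2.eq_or_lt with rfl | h2
    · rw [coord_succ_n, mul_zero, add_zero]
    · rw [← hb h2, ← map_add, Prod.mk_add_mk, add_zero, zero_add]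
  choose! g' hg hv using key
  have hV : HasFDerivAt P.V (∑ j ∈ Finset.Icc 1 P.n, g' j) z := HasFDerivAt.fun_sum hg
  rw [hV.fderiv, _root_.sum_apply, Finset.sum_congr rfl hv, Finset.sum_add_distrib]
  have hs := sum_Icc_shift (fun j => P.sp (j - 1) (coord z (j - 1)) (P.xi (j - 1) (coord z j)) *
    coord v j) hn
  simp only [Nat.add_sub_cancel, coord_succ_n, mul_zero, add_zero] at hs
  rw [hs, ← Finset.sum_add_distrib]
  refine Finset.sum_congr rfl fun j hj => ?_
  split_ifs <;> ring

theorem Valid.V_zero : P.V 0 = 0 := by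
  refine Finset.sum_eq_zero fun j hj => ?_
  obtain ⟨h1, h2⟩ := Finset.mem_Icc.1 hj
  have hξ : P.xi j 0 = 0 := by
    rcases h2.eq_or_lt with rfl | h2
    · exact P.xi_last 0
    · have := hP.regular.xi_phi h1 h2 0
      rwa [phi_zero] at this
  rw [coord_zero, coord_zero]
  change P.Zxi j 0 (P.xi j 0) = 0
  rw [hξ, hP.exponents.Zxi_self h1 h2]

theorem Valid.exists_fderiv_V_eq {K : ℝ} (hK : 0 < K) {kt : ℕ → ℝ} (hk : K ≤ gain kt P.n)
    {z v : Fin P.n → ℝ} (hv : v ∈ P.errorField Δ kt z) :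
    ∃ w, P.IsState 1 (coord z) (fun j => P.xi j (coord z (j + 1))) w ∧ fderiv ℝ P.V z v =
      P.full (Δ / K) kt 1 (coord z) (fun j => P.xi j (coord z (j + 1))) w := by
  have hR := hP.regular
  have hn : 1 ≤ P.n := (by norm_num : 1 ≤ 2).trans hP.two_le_n
  have hv' : ∀ j, 1 ≤ j → j ≤ P.n → ∃ u ∈ P.chainSet Δ K 1 j (coord z 1),
      coord v j = -kt j * (u - coord z (j + 1)) := by
    intro j h1 h2
    obtain ⟨u, hu, hvu⟩ := hv ⟨j - 1, by omega⟩
    simp only [Nat.sub_add_cancel h1, show j - 1 + 2 = j + 1 by omega] at hu hvu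
    refine ⟨u, chainSet_mono hK hk _ _ _ hu, ?_⟩
    rw [← hvu, coord, dif_pos ⟨h1, h2⟩]
  obtain ⟨un, hun, hvn⟩ := hv' P.n hn le_rfl
  obtain ⟨w, hw, rfl⟩ := (mem_chainSet_last hR).1 hun
  refine ⟨w, isState_coord hR le_rfl z hw, ?_⟩
  rw [hP.fderiv_V]
  refine Finset.sum_congr rfl fun j hj => ?_
  obtain ⟨h1, h2⟩ := Finset.mem_Icc.1 hj
  have hvj : coord v j = kt j * (coord z (j + 1) - P.sel (Δ / K) 1 (coord z 1) w j) := by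
    rw [sel]
    split_ifs with hjn
    · rw [hjn, hvn]; ring
    · obtain ⟨u, hu, hvu⟩ := hv' j h1 h2
      rw [hvu, (mem_chainSet_of_lt hR.toExponents le_rfl h1 (by omega)).1 hu]; ring
  rw [hvj]
  simp only [Nat.sub_add_cancel h1]
  ring

/-- Homogeneous estimates of the Lyapunov function and its derivative. -/
theorem TailNeg.exists_estimates {D : ℝ} (hD : P.d0 ≠ -1 → D = 0) {kt : ℕ → ℝ}
    (h : P.TailNeg D kt 1) : ∃ m > 0, ∃ a > 0, ∃ M > 0, ∀ z ξ w, P.IsState 1 z ξ w →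
      (∃ j, 1 ≤ j ∧ j ≤ P.n ∧ z j ≠ 0) → ∃ (t p d : ℝ) (r : ℕ → ℝ),
      ((0 < t ∧ t ≤ 1 ∧ p = P.p0 ∧ d = P.d0 ∧ r = P.r0) ∨
        (1 ≤ t ∧ p = P.pInf ∧ d = P.dInf ∧ r = P.rInf)) ∧
      P.full D kt 1 z ξ w ≤ -m * (t ^ p * t ^ d) ∧
      a * t ^ p ≤ ∑ j ∈ Finset.Icc 1 P.n, P.Zxi j (z j) (ξ j) ∧
      ∑ j ∈ Finset.Icc 1 P.n, P.Zxi j (z j) (ξ j) ≤ M * t ^ p ∧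
      ∀ j, 1 ≤ j → j ≤ P.n → |z j| ≤ t ^ r j := by
  have hn : 1 ≤ P.n := (by norm_num : 1 ≤ 2).trans hP.two_le_n
  have hS := hP.isCompact_sphere D le_rfl
  have cF := hP.continuous_path_full D kt le_rfl
  have cW := hP.continuous_path_sum_Zxi D
  have hF : ∀ x ∈ P.sphere D 1, 0 < -(P.path D x.1).full (P.blend D x.1).D kt 1 x.2.1 x.2.2.1
      x.2.2.2 := fun x hx => neg_pos.2
    (h x.1 hx.1 _ _ _ hx.2.2.2.1 (exists_ne_zero_of_mem_sphere hP le_rfl hx))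
  have hW : ∀ x ∈ P.sphere D 1,
      0 < ∑ j ∈ Finset.Icc 1 P.n, (P.path D x.1).Zxi j (x.2.1 j) (x.2.2.1 j) := by
    intro x hx
    have hR := hP.regular_path D x.1
    have hnn : ∀ j ∈ Finset.Icc 1 P.n, 0 ≤ (P.path D x.1).Zxi j (x.2.1 j) (x.2.2.1 j) :=
      fun j hj => hR.Zxi_nonneg (Finset.mem_Icc.1 hj).1 (Finset.mem_Icc.1 hj).2 _ _
    refine (Finset.sum_nonneg hnn).lt_of_ne fun h0 => ?_
    have hzero := (Finset.sum_eq_zero_iff_of_nonneg hnn).1 h0.symm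
    have heq : ∀ j, 1 ≤ j → j ≤ P.n → x.2.1 j = x.2.2.1 j := by
      intro j h1 h2
      by_contra hne
      exact (hR.Zxi_pos h1 h2 hne).ne' (hzero j (Finset.mem_Icc.2 ⟨h1, h2⟩))
    have hs := hx.2.2.2.1
    have hz : ∀ j, 1 ≤ j → j ≤ P.n → x.2.1 j = 0 := by
      intro j h1 h2
      induction h2 using Nat.decreasingInduction with
      | self => rw [heq _ h1 le_rfl]; exact hs.xi_last
      | of_succ k hk ih =>
        rw [heq k h1 hk.le, ← hR.phi_eq_zero h1 hk, ← hs.eq_phi k h1 hk]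
        exact ih (by omega)
    obtain ⟨j, h1, h2, h3⟩ := exists_ne_zero_of_mem_sphere hP le_rfl hx
    exact h3 (hz j h1 h2)
  obtain ⟨m, hm, hmF⟩ := hS.exists_pos_le cF.neg hF
  obtain ⟨a, ha, haW⟩ := hS.exists_pos_le cW hW
  obtain ⟨M, hM⟩ := (hS.image cW).bddAbove
  refine ⟨m, hm, a, ha, max M 1, by positivity, fun z ξ w hs hne => ?_⟩
  obtain ⟨τ, ρ, l, c, z', ξ', hSc, hx, hz, hξ, t, ht⟩ := hs.exists_mem_sphere hP hD le_rfl hn hne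
  have e1 := hSc.full hn le_rfl hz hξ kt hn w
  change P.full D kt 1 z ξ w = _ at e1
  have e2 : ∑ j ∈ Finset.Icc 1 P.n, P.Zxi j (z j) (ξ j) =
      l * ∑ j ∈ Finset.Icc 1 P.n, (P.path D τ).Zxi j (z' j) (ξ' j) := by
    rw [Finset.mul_sum]
    refine Finset.sum_congr rfl fun j hj => ?_
    obtain ⟨h1, h2⟩ := Finset.mem_Icc.1 hj
    rw [hz j h1 (by omega), hξ j h1 h2]
    exact hSc.Zxi hP.exponents h1 h2 _ _
  have b1 := hmF (τ, z', ξ', w) hx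
  have b2 := haW (τ, z', ξ', w) hx
  have b3 := hM (mem_image_of_mem _ hx)
  dsimp only [Pi.neg_apply] at b1 b2 b3
  have hl := hSc.l_pos
  have hc := hSc.c_pos
  have f1 : P.full D kt 1 z ξ w ≤ -m * (l * c) := by
    rw [e1]
    have := mul_le_mul_of_nonneg_left b1 (mul_pos hl hc).le
    linarith
  have f2 : a * l ≤ ∑ j ∈ Finset.Icc 1 P.n, P.Zxi j (z j) (ξ j) := by
    rw [e2]
    have := mul_le_mul_of_nonneg_left b2 hl.le
    linarith
  have f3 : ∑ j ∈ Finset.Icc 1 P.n, P.Zxi j (z j) (ξ j) ≤ max M 1 * l := by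
    rw [e2]
    have := mul_le_mul_of_nonneg_left (b3.trans (le_max_left M 1)) hl.le
    linarith
  have f4 : ∀ j, 1 ≤ j → j ≤ P.n → |z j| ≤ ρ j := by
    intro j h1 h2
    rw [hz j h1 (by omega), abs_mul, abs_of_pos (hSc.rho_pos j)]
    exact mul_le_of_le_one_right (hSc.rho_pos j).le (abs_le.2 (hx.2.1 j (mem_univ j)))
  rcases ht with ⟨t0, t1, rfl, rfl, rfl⟩ | ⟨t1, rfl, rfl, rfl⟩
  · exact ⟨t, _, _, _, Or.inl ⟨t0, t1, rfl, rfl, rfl⟩, f1, f2, f3, f4⟩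
  · exact ⟨t, _, _, _, Or.inr ⟨t1, rfl, rfl, rfl⟩, f1, f2, f3, f4⟩

end


/-! ### The Lyapunov function -/

/-- Decay estimate in terms of a value bounded by a power. -/
theorem neg_mul_rpow_le {m M t p d W : ℝ} (hm : 0 ≤ m) (hM : 0 < M) (ht : 0 < t) (hp : 0 < p)
    (hpd : 0 ≤ p + d) (hW : 0 ≤ W) (h : W ≤ M * t ^ p) :
    -m * (t ^ p * t ^ d) ≤ -(m * M⁻¹ ^ ((p + d) / p)) * W ^ ((p + d) / p) := by
  have h1 : M⁻¹ * W ≤ t ^ p := by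
    rw [inv_mul_le_iff₀ hM]; exact h
  have h2 := Real.rpow_le_rpow (mul_nonneg (inv_pos.2 hM).le hW) h1 (div_nonneg hpd hp.le)
  rw [Real.mul_rpow (inv_pos.2 hM).le hW, ← Real.rpow_mul ht.le, mul_div_cancel₀ _ hp.ne',
    Real.rpow_add ht] at h2
  have := mul_le_mul_of_nonneg_left h2 hm
  linarith

/-- A decay rate valid for small values and one valid for large values add up if the exponents are
ordered. -/
theorem exists_decay_add {α₀ αInf η a M : ℝ} (hα : α₀ ≤ αInf) (hη : 0 < η) (ha : 0 < a)
    (hM : 0 < M) : ∃ η0 > 0, ∃ ηInf > 0, ∀ W D : ℝ, 0 < W →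
      ((W ≤ M ∧ D ≤ -η * W ^ α₀) ∨ (a ≤ W ∧ D ≤ -η * W ^ αInf)) →
      D ≤ -η0 * W ^ α₀ - ηInf * W ^ αInf := by
  set x := M ^ (αInf - α₀)
  set y := a ^ (αInf - α₀)
  have hx : 0 < x := Real.rpow_pos_of_pos hM _
  have hy : 0 < y := Real.rpow_pos_of_pos ha _
  have hδ := sub_nonneg.2 hα
  refine ⟨min (η / 2) (η / 2 * y), by positivity, min (η / 2) (η / 2 * x⁻¹), by positivity,
    fun W D hW h => ?_⟩
  have hs : W ^ αInf = W ^ (αInf - α₀) * W ^ α₀ := by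
    rw [← Real.rpow_add hW, sub_add_cancel]
  have h0 : 0 < W ^ α₀ := Real.rpow_pos_of_pos hW _
  have hI : 0 < W ^ αInf := Real.rpow_pos_of_pos hW _
  rcases h with ⟨h1, h2⟩ | ⟨h1, h2⟩
  · have h3 : W ^ (αInf - α₀) ≤ x := Real.rpow_le_rpow hW.le h1 hδ
    have h4 : x⁻¹ * W ^ αInf ≤ W ^ α₀ := by
      rw [inv_mul_le_iff₀ hx, hs]
      exact mul_le_mul_of_nonneg_right h3 h0.le
    have h5 := mul_le_mul_of_nonneg_right (min_le_left (η / 2) (η / 2 * y)) h0.le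
    have h6 := mul_le_mul_of_nonneg_right (min_le_right (η / 2) (η / 2 * x⁻¹)) hI.le
    have h7 := mul_le_mul_of_nonneg_left h4 (half_pos hη).le
    linarith
  · have h3 : y ≤ W ^ (αInf - α₀) := Real.rpow_le_rpow ha.le h1 hδ
    have h4 : y * W ^ α₀ ≤ W ^ αInf := by
      rw [hs]
      exact mul_le_mul_of_nonneg_right h3 h0.le
    have h5 := mul_le_mul_of_nonneg_right (min_le_right (η / 2) (η / 2 * y)) h0.le
    have h6 := mul_le_mul_of_nonneg_right (min_le_left (η / 2) (η / 2 * x⁻¹)) hI.le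
    have h7 := mul_le_mul_of_nonneg_left h4 (half_pos hη).le
    linarith

theorem exists_isState (hR : P.Regular) (z : Fin P.n → ℝ) :
    ∃ w, P.IsState 1 (coord z) (fun j => P.xi j (coord z (j + 1))) w := by
  set s := Real.sign (coord z 1)
  have hs : s ∈ Icc (-1 : ℝ) 1 := by
    rcases Real.sign_apply_eq (coord z 1) with h | h | h <;> simp only [s, h] <;> norm_num
  have hm : s * coord z 1 = |coord z 1| := by
    rcases lt_trichotomy (coord z 1) 0 with h | h | h
    · simp [s, Real.sign_of_neg h, abs_of_neg h]
    · simp [h]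
    · simp [s, Real.sign_of_pos h, abs_of_pos h]
  exact ⟨(s, s, 0), isState_coord hR le_rfl z
    ⟨hs, hs, by norm_num, fun _ => hm, fun _ => hm⟩⟩

theorem Exponents.one_lt_p0 (hE : P.Exponents) : 1 < P.p0 := by
  have h := hE.m0_pos P.n (by linarith [hE.two_le_n]) le_rfl
  have h1 : P.r0 P.n = 1 := by simp [r0]
  simp only [m0, h1, div_one] at h
  linarith

theorem Exponents.one_lt_pInf (hE : P.Exponents) : 1 < P.pInf := by
  have h := hE.mInf_pos (i := P.n) (by linarith [hE.two_le_n]) le_rfl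
  have h1 : P.rInf P.n = 1 := by simp [rInf]
  simp only [mInf, h1, div_one] at h
  linarith

section

variable {Δ : ℝ} (hP : P.Valid Δ)
include hP

theorem Valid.p0_add_d0_pos : 0 < P.p0 + P.d0 := by
  linarith [hP.exponents.one_lt_p0, hP.neg_one_le_d0]

theorem Valid.pInf_add_dInf_pos : 0 < P.pInf + P.dInf := by
  linarith [hP.exponents.one_lt_pInf, hP.neg_one_le_d0, hP.d0_le_dInf]

theorem TailNeg.V_pos {D : ℝ} (hD : P.d0 ≠ -1 → D = 0) {kt : ℕ → ℝ} (h : P.TailNeg D kt 1)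
    {z : Fin P.n → ℝ} (hz : z ≠ 0) : 0 < P.V z := by
  obtain ⟨m, hm, a, ha, M, hM, key⟩ := h.exists_estimates hP hD
  obtain ⟨w, hw⟩ := exists_isState hP.regular z
  obtain ⟨t, p, d, r, ht, -, h2, -, -⟩ := key _ _ w hw (exists_coord_ne_zero hz)
  have ht0 : 0 < t := by rcases ht with ⟨h, -⟩ | ⟨h, -⟩ <;> linarith
  exact (mul_pos ha (Real.rpow_pos_of_pos ht0 p)).trans_le h2

theorem TailNeg.exists_norm_le {D : ℝ} (hD : P.d0 ≠ -1 → D = 0) {kt : ℕ → ℝ}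
    (h : P.TailNeg D kt 1) (b : ℝ) : ∃ C, ∀ z, P.V z ≤ b → ‖z‖ ≤ C := by
  obtain ⟨m, hm, a, ha, M, hM, key⟩ := h.exists_estimates hP hD
  have hE := hP.exponents
  set T := max 1 ((b / a) ^ P.pInf⁻¹)
  have hT : 1 ≤ T := le_max_left _ _
  have hT0 : 0 < T := one_pos.trans_le hT
  have hT' : ∀ j, 0 ≤ T ^ P.rInf j := fun j => (Real.rpow_pos_of_pos hT0 _).le
  refine ⟨∑ j ∈ Finset.Icc 1 P.n, T ^ P.rInf j, fun z hz => ?_⟩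
  rw [pi_norm_le_iff_of_nonneg (Finset.sum_nonneg fun j _ => hT' j)]
  intro k
  have hk : (k : ℕ) + 1 ∈ Finset.Icc 1 P.n := Finset.mem_Icc.2 ⟨by omega, by omega⟩
  refine le_trans ?_ (Finset.single_le_sum (fun j _ => hT' j) hk)
  obtain ⟨k1, k2⟩ := Finset.mem_Icc.1 hk
  rcases eq_or_ne z 0 with rfl | hne
  · simpa using hT' _
  obtain ⟨w, hw⟩ := exists_isState hP.regular z
  obtain ⟨t, p, d, r, ht, -, h2, -, h4⟩ := key _ _ w hw (exists_coord_ne_zero hne)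
  have h5 := h4 _ k1 k2
  rw [coord_fin] at h5
  refine h5.trans ?_
  rcases ht with ⟨t0, t1, rfl, rfl, rfl⟩ | ⟨t1, rfl, rfl, rfl⟩
  · exact (Real.rpow_le_one t0.le t1 (hE.r0_pos _ k1 k2).le).trans
      (Real.one_le_rpow hT (hE.rInf_pos _ k1 k2).le)
  · have t0 : 0 ≤ t := by linarith
    refine Real.rpow_le_rpow t0 (le_max_of_le_right ?_) (hE.rInf_pos _ k1 k2).le
    have h6 : t ^ P.pInf ≤ b / a := by
      rw [le_div_iff₀ ha, mul_comm]
      exact h2.trans hz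
    have h7 := Real.rpow_le_rpow (Real.rpow_nonneg t0 _) h6 (inv_pos.2 hE.pInf_pos).le
    rwa [Real.rpow_rpow_inv t0 hE.pInf_pos.ne'] at h7

theorem TailNeg.exists_rates {K : ℝ} (hK : 0 < K) (hD : P.d0 ≠ -1 → Δ / K = 0) {kt : ℕ → ℝ}
    (hk : K ≤ gain kt P.n) (h : P.TailNeg (Δ / K) kt 1) :
    ∃ η > 0, ∃ a > 0, ∃ M > 0, ∀ z, z ≠ 0 → ∀ v ∈ P.errorField Δ kt z,
      (P.V z ≤ M ∧ fderiv ℝ P.V z v ≤ -η * P.V z ^ ((P.p0 + P.d0) / P.p0)) ∨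
      (a ≤ P.V z ∧ fderiv ℝ P.V z v ≤ -η * P.V z ^ ((P.pInf + P.dInf) / P.pInf)) := by
  obtain ⟨m, hm, a, ha, M, hM, key⟩ := h.exists_estimates hP hD
  have hE := hP.exponents
  set x := m * M⁻¹ ^ ((P.p0 + P.d0) / P.p0)
  set y := m * M⁻¹ ^ ((P.pInf + P.dInf) / P.pInf)
  have hx : 0 < x := mul_pos hm (Real.rpow_pos_of_pos (inv_pos.2 hM) _)
  have hy : 0 < y := mul_pos hm (Real.rpow_pos_of_pos (inv_pos.2 hM) _)
  refine ⟨min x y, lt_min hx hy, a, ha, M, hM, fun z hz v hv => ?_⟩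
  obtain ⟨w, hw, e⟩ := hP.exists_fderiv_V_eq hK hk hv
  have hV := (h.V_pos hP hD hz).le
  obtain ⟨t, p, d, r, ht, h1, h2, h3, -⟩ := key _ _ w hw (exists_coord_ne_zero hz)
  change a * t ^ p ≤ P.V z at h2
  change P.V z ≤ M * t ^ p at h3
  rw [e]
  rcases ht with ⟨t0, t1, rfl, rfl, rfl⟩ | ⟨t1, rfl, rfl, rfl⟩
  · refine Or.inl ⟨h3.trans (mul_le_of_le_one_right hM.le
      (Real.rpow_le_one t0.le t1 hE.p0_pos.le)), h1.trans ?_⟩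
    refine (neg_mul_rpow_le hm.le hM t0 hE.p0_pos hP.p0_add_d0_pos.le hV h3).trans ?_
    exact mul_le_mul_of_nonneg_right (neg_le_neg (min_le_left _ _)) (Real.rpow_nonneg hV _)
  · refine Or.inr ⟨le_trans (le_mul_of_one_le_right ha.le
      (Real.one_le_rpow t1 hE.pInf_pos.le)) h2, h1.trans ?_⟩
    refine (neg_mul_rpow_le hm.le hM (by linarith) hE.pInf_pos hP.pInf_add_dInf_pos.le hV
      h3).trans ?_
    exact mul_le_mul_of_nonneg_right (neg_le_neg (min_le_right _ _)) (Real.rpow_nonneg hV _)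

theorem TailNeg.isLyapunov {K : ℝ} (hK : 0 < K) (hD : P.d0 ≠ -1 → Δ / K = 0) {kt : ℕ → ℝ}
    (hk : K ≤ gain kt P.n) (h : P.TailNeg (Δ / K) kt 1) : P.IsLyapunov Δ kt where
  contDiff := hP.contDiff_V
  zero := hP.V_zero
  pos _ hz := h.V_pos hP hD hz
  proper := by
    refine tendsto_atTop.2 fun b => ?_
    obtain ⟨C, hC⟩ := h.exists_norm_le hP hD b
    rw [← Metric.cobounded_eq_cocompact]
    filter_upwards [tendsto_norm_cobounded_atTop.eventually_gt_atTop C] with z hz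
    by_contra! hb
    exact (hC z hb.le).not_gt hz
  decrease z hz v hv := by
    obtain ⟨η, hη, a, -, M, -, key⟩ := h.exists_rates hP hK hD hk
    have hV := h.V_pos hP hD hz
    rcases key z hz v hv with ⟨-, h2⟩ | ⟨-, h2⟩
    · exact h2.trans_lt (mul_neg_of_neg_of_pos (neg_neg_of_pos hη) (Real.rpow_pos_of_pos hV _))
    · exact h2.trans_lt (mul_neg_of_neg_of_pos (neg_neg_of_pos hη) (Real.rpow_pos_of_pos hV _))
  decay hα := by
    have hE := hP.exponents
    obtain ⟨η, hη, a, ha, M, hM, key⟩ := h.exists_rates hP hK hD hk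
    have hle : (P.p0 + P.d0) / P.p0 ≤ (P.pInf + P.dInf) / P.pInf := by
      rw [div_le_div_iff₀ hE.p0_pos hE.pInf_pos]
      linarith
    obtain ⟨η0, h0, ηInf, hI, hdec⟩ := exists_decay_add hle hη ha hM
    refine ⟨η0, h0, ηInf, hI, fun z v hv => ?_⟩
    rcases eq_or_ne z 0 with rfl | hz
    · have hmin : IsLocalMin P.V 0 := Eventually.of_forall fun y => by
        rcases eq_or_ne y 0 with rfl | hy
        · rfl
        · rw [hP.V_zero]; exact (h.V_pos hP hD hy).le
      rw [hmin.fderiv_eq_zero, hP.V_zero,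
        Real.zero_rpow (div_pos hP.p0_add_d0_pos hE.p0_pos).ne',
        Real.zero_rpow (div_pos hP.pInf_add_dInf_pos hE.pInf_pos).ne']
      simp
    · exact hdec _ _ (h.V_pos hP hD hz) (key z hz v hv)

end

end DiffParams

theorem LipschitzOnWith.comp_absolutelyContinuousOnInterval {X Y : Type*} [PseudoMetricSpace X]
    [PseudoMetricSpace Y] {g : X → Y} {L : NNReal} {s : Set X} (hg : LipschitzOnWith L g s)
    {f : ℝ → X} {a b : ℝ} (hf : AbsolutelyContinuousOnInterval f a b)
    (hs : MapsTo f (uIcc a b) s) : AbsolutelyContinuousOnInterval (fun t => g (f t)) a b := by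
  rw [absolutelyContinuousOnInterval_iff] at hf ⊢
  intro ε hε
  obtain ⟨δ, hδ, h⟩ := hf (ε / (L + 1)) (by positivity)
  refine ⟨δ, hδ, fun E hE hlt => ?_⟩
  have h1 := h E hE hlt
  rw [lt_div_iff₀ (by positivity)] at h1
  refine lt_of_le_of_lt ?_ h1
  rw [Finset.sum_mul]
  refine Finset.sum_le_sum fun i hi => ?_
  have h2 := hg.dist_le_mul _ (hs (hE.1 i hi).1) _ (hs (hE.1 i hi).2)
  have h3 : 0 ≤ dist (f (E.2 i).1) (f (E.2 i).2) := dist_nonneg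
  linarith

theorem AbsolutelyContinuousOnInterval.sub_le_of_ae_hasDerivAt {f : ℝ → ℝ} {a b c : ℝ}
    (hab : a ≤ b) (hf : AbsolutelyContinuousOnInterval f a b)
    (h : ∀ᵐ t, t ∈ Icc a b → ∃ f', HasDerivAt f f' t ∧ f' ≤ c) : f b - f a ≤ c * (b - a) := by
  have h1 := intervalIntegral.integral_mono_ae_restrict hab hf.intervalIntegrable_deriv
    (intervalIntegrable_const (c := c)) (by
      refine (ae_restrict_iff' measurableSet_Icc).2 (h.mono fun t ht hmem => ?_)
      obtain ⟨f', hd, hle⟩ := ht hmem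
      rw [hd.deriv]
      exact hle)
  rw [hf.integral_deriv_eq_sub, intervalIntegral.integral_const, smul_eq_mul] at h1
  linarith

namespace DiffParams

variable {P : DiffParams}

/-! ### Convergence of the solutions -/

section

variable {Δ : ℝ} {kt : ℕ → ℝ} (hL : P.IsLyapunov Δ kt)
include hL

theorem IsLyapunov.nonneg (z : Fin P.n → ℝ) : 0 ≤ P.V z := by
  rcases eq_or_ne z 0 with rfl | hz
  · exact hL.zero.ge
  · exact (hL.pos z hz).le

theorem IsLyapunov.ne_zero {z : Fin P.n → ℝ} (hz : 0 < P.V z) : z ≠ 0 := by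
  rintro rfl
  exact hz.ne' hL.zero

theorem IsLyapunov.fderiv_nonpos {z v : Fin P.n → ℝ} (hv : v ∈ P.errorField Δ kt z) :
    fderiv ℝ P.V z v ≤ 0 := by
  rcases eq_or_ne z 0 with rfl | hz
  · have hmin : IsLocalMin P.V 0 := Eventually.of_forall fun y => hL.zero ▸ hL.nonneg y
    rw [hmin.fderiv_eq_zero]
    rfl
  · exact (hL.decrease z hz v hv).le

theorem IsLyapunov.exists_norm_le (b : ℝ) : ∃ C, ∀ z, P.V z ≤ b → ‖z‖ ≤ C := by
  have h := hL.proper.eventually_gt_atTop b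
  rw [← Metric.cobounded_eq_cocompact, ← comap_norm_atTop, eventually_comap] at h
  obtain ⟨C, hC⟩ := eventually_atTop.1 h
  exact ⟨C, fun z hz => by
    by_contra! hlt
    exact (hC _ hlt.le z rfl).not_ge hz⟩

theorem IsLyapunov.exists_norm_lt {ε : ℝ} (hε : 0 < ε) : ∃ c > 0, ∀ z, P.V z < c → ‖z‖ < ε := by
  obtain ⟨C, hC⟩ := hL.exists_norm_le 1
  have hS : IsCompact (Metric.closedBall (0 : Fin P.n → ℝ) C ∩ {z | ε ≤ ‖z‖}) :=
    (isCompact_closedBall 0 C).inter_right (isClosed_le continuous_const continuous_norm)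
  obtain ⟨m, hm, h⟩ := hS.exists_pos_le hL.contDiff.continuous
    fun z hz => hL.pos z (norm_pos_iff.1 (hε.trans_le hz.2))
  refine ⟨min m 1, by positivity, fun z hz => ?_⟩
  by_contra! hlt
  exact (h z ⟨mem_closedBall_zero_iff.2 (hC z (hz.trans_le (min_le_right _ _)).le), hlt⟩).not_gt
    (hz.trans_le (min_le_left _ _))

theorem IsLyapunov.comp_sub_le {T : ℝ} {z : ℝ → Fin P.n → ℝ} (hz : P.IsSolution Δ kt T z)
    {a b : ℝ} (ha : 0 ≤ a) (hab : a ≤ b) (hb : b ≤ T) {G G' : ℝ → ℝ} {s : Set ℝ} {L : NNReal}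
    (hG : LipschitzOnWith L G s) (hG' : ∀ x ∈ s, HasDerivAt G (G' x) x)
    (hs : ∀ t ∈ Icc a b, P.V (z t) ∈ s) {c : ℝ}
    (hc : ∀ t ∈ Icc a b, ∀ v ∈ P.errorField Δ kt (z t),
      G' (P.V (z t)) * fderiv ℝ P.V (z t) v ≤ c) :
    G (P.V (z b)) - G (P.V (z a)) ≤ c * (b - a) := by
  have hsub : Icc a b ⊆ Icc 0 T := Icc_subset_Icc ha hb
  have hac : AbsolutelyContinuousOnInterval z a b := hz.1.mono (by
    rwa [uIcc_of_le hab, uIcc_of_le (ha.trans (hab.trans hb))])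
  obtain ⟨C, hC⟩ := hac.exists_bound
  obtain ⟨L', hL'⟩ := (hL.contDiff.contDiffOn (s := Metric.closedBall 0 C)).exists_lipschitzOnWith
    (by decide) (convex_closedBall 0 C) (isCompact_closedBall 0 C)
  have hV := hL'.comp_absolutelyContinuousOnInterval hac
    fun t ht => mem_closedBall_zero_iff.2 (hC t ht)
  have hGV := hG.comp_absolutelyContinuousOnInterval hV (by rwa [uIcc_of_le hab])
  refine hGV.sub_le_of_ae_hasDerivAt hab ?_
  filter_upwards [hz.2] with t ht hmem
  obtain ⟨v, hv, hd⟩ := ht (hsub hmem)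
  have h1 := ((hL.contDiff.differentiable one_ne_zero (z t)).hasFDerivAt).comp_hasDerivAt t hd
  exact ⟨_, (hG' _ (hs t hmem)).comp t h1, hc t hmem v hv⟩

theorem IsLyapunov.sub_le {T : ℝ} {z : ℝ → Fin P.n → ℝ} (hz : P.IsSolution Δ kt T z)
    {a b : ℝ} (ha : 0 ≤ a) (hab : a ≤ b) (hb : b ≤ T) {c : ℝ}
    (hc : ∀ t ∈ Icc a b, ∀ v ∈ P.errorField Δ kt (z t), fderiv ℝ P.V (z t) v ≤ c) :
    P.V (z b) - P.V (z a) ≤ c * (b - a) :=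
  hL.comp_sub_le hz ha hab hb (G := id) (G' := fun _ => 1) (s := univ) (L := 1)
    (LipschitzWith.id.lipschitzOnWith) (fun x _ => hasDerivAt_id x) (fun _ _ => mem_univ _)
    fun t ht v hv => by rw [one_mul]; exact hc t ht v hv

theorem IsLyapunov.le_of_le {T : ℝ} {z : ℝ → Fin P.n → ℝ} (hz : P.IsSolution Δ kt T z)
    {a b : ℝ} (ha : 0 ≤ a) (hab : a ≤ b) (hb : b ≤ T) : P.V (z b) ≤ P.V (z a) := by
  have := hL.sub_le hz ha hab hb (c := 0) fun t _ v hv => hL.fderiv_nonpos hv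
  linarith

theorem IsLyapunov.rpow_sub_le {T : ℝ} {z : ℝ → Fin P.n → ℝ} (hz : P.IsSolution Δ kt T z)
    {a b : ℝ} (ha : 0 ≤ a) (hab : a ≤ b) (hb : b ≤ T) (hpos : 0 < P.V (z b)) {α η : ℝ}
    (hα : α ≠ 1) (hdec : ∀ z, ∀ v ∈ P.errorField Δ kt z, fderiv ℝ P.V z v ≤ -η * P.V z ^ α) :
    P.V (z b) ^ (1 - α) / (1 - α) - P.V (z a) ^ (1 - α) / (1 - α) ≤ -η * (b - a) := by
  have hmem : ∀ t ∈ Icc a b, P.V (z t) ∈ Icc (P.V (z b)) (P.V (z a)) := fun t ht =>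
    ⟨hL.le_of_le hz (ha.trans ht.1) ht.2 hb, hL.le_of_le hz ha ht.1 (ht.2.trans hb)⟩
  have hα' : 1 - α ≠ 0 := sub_ne_zero.2 hα.symm
  have hcd : ContDiffOn ℝ 1 (fun x : ℝ => x ^ (1 - α) / (1 - α)) (Icc (P.V (z b)) (P.V (z a))) :=
    (contDiffOn_id.rpow_const_of_ne fun x hx => (hpos.trans_le hx.1).ne').div_const _
  obtain ⟨L, hLip⟩ := hcd.exists_lipschitzOnWith (by decide) (convex_Icc _ _) isCompact_Icc
  refine hL.comp_sub_le hz ha hab hb (G' := fun x => x ^ (-α)) hLip (fun x hx => ?_) hmem ?_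
  · have h1 := (Real.hasDerivAt_rpow_const (x := x) (p := 1 - α)
      (Or.inl (hpos.trans_le hx.1).ne')).div_const (1 - α)
    refine h1.congr_deriv ?_
    rw [mul_div_cancel_left₀ _ hα']
    congr 1
    ring
  · intro t ht v hv
    have hpt := hpos.trans_le (hmem t ht).1
    have h1 := mul_le_mul_of_nonneg_left (hdec _ v hv) (Real.rpow_nonneg hpt.le (-α))
    rw [mul_left_comm, ← Real.rpow_add hpt, neg_add_cancel, Real.rpow_zero, mul_one] at h1
    exact h1

/-- Global asymptotic stability from a Lyapunov function whose decay is bounded away from zero on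
superlevel sets. -/
theorem IsLyapunov.isGAS (hdec : ∀ c > 0, ∃ η > 0, ∀ z, c ≤ P.V z →
    ∀ v ∈ P.errorField Δ kt z, fderiv ℝ P.V z v ≤ -η) : P.IsGAS Δ kt where
  stable ε hε := by
    obtain ⟨c, hc, h⟩ := hL.exists_norm_lt hε
    have hcont := (hL.contDiff.continuous.tendsto 0).eventually_lt_const (hL.zero.symm ▸ hc)
    obtain ⟨δ, hδ, hball⟩ := Metric.eventually_nhds_iff.1 hcont
    refine ⟨δ, hδ, fun T _ z hz h0 t ht => h _ ?_⟩
    exact (hL.le_of_le hz le_rfl ht.1 ht.2).trans_lt (hball (by rwa [dist_zero_right]))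
  bounded R _ := by
    obtain ⟨b, hb⟩ := ((isCompact_closedBall (0 : Fin P.n → ℝ) R).image
      hL.contDiff.continuous).bddAbove
    obtain ⟨C, hC⟩ := hL.exists_norm_le b
    exact ⟨C, fun T _ z hz h0 t ht => hC _ ((hL.le_of_le hz le_rfl ht.1 ht.2).trans
      (hb (mem_image_of_mem _ (mem_closedBall_zero_iff.2 h0))))⟩
  attractive z hz := by
    refine Metric.tendsto_atTop.2 fun ε hε => ?_
    obtain ⟨c, hc, h⟩ := hL.exists_norm_lt hε
    obtain ⟨η, hη, hrate⟩ := hdec c hc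
    have hV0 := hL.nonneg (z 0)
    refine ⟨P.V (z 0) / η + 1, fun t ht => ?_⟩
    rw [dist_zero_right]
    refine h _ ?_
    by_contra! hcon
    have ht0 : 0 < t := by linarith [div_nonneg hV0 hη.le]
    have h1 := hL.sub_le (hz t ht0) le_rfl ht0.le le_rfl (c := -η) fun s hs v hv =>
      hrate _ (hcon.trans (hL.le_of_le (hz t ht0) hs.1 hs.2 le_rfl)) v hv
    have h2 : P.V (z 0) < t * η := by
      rw [← div_lt_iff₀ hη]; linarith
    have := hL.nonneg (z t)
    linarith

/-- Fixed-time convergence from a decay estimate with exponents on both sides of one. -/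
theorem IsLyapunov.convergesInFixedTime {α₀ αInf η0 ηInf : ℝ} (hα₀ : α₀ < 1) (hαInf : 1 < αInf)
    (h0 : 0 < η0) (hInf : 0 < ηInf) (hdec : ∀ z, ∀ v ∈ P.errorField Δ kt z,
      fderiv ℝ P.V z v ≤ -η0 * P.V z ^ α₀ - ηInf * P.V z ^ αInf) :
    P.ConvergesInFixedTime Δ kt := by
  have dec0 : ∀ z, ∀ v ∈ P.errorField Δ kt z, fderiv ℝ P.V z v ≤ -η0 * P.V z ^ α₀ :=
    fun z v hv => by
      have := mul_nonneg hInf.le (Real.rpow_nonneg (hL.nonneg z) αInf)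
      linarith [hdec z v hv]
  have decInf : ∀ z, ∀ v ∈ P.errorField Δ kt z, fderiv ℝ P.V z v ≤ -ηInf * P.V z ^ αInf :=
    fun z v hv => by
      have := mul_nonneg h0.le (Real.rpow_nonneg (hL.nonneg z) α₀)
      linarith [hdec z v hv]
  have hβ : 0 < 1 - α₀ := by linarith
  have hγ : 0 < αInf - 1 := by linarith
  set T₁ := 1 / ((αInf - 1) * ηInf)
  set T₂ := 1 / ((1 - α₀) * η0)
  have hT₁ : 0 < T₁ := by positivity
  have hT₂ : 0 < T₂ := by positivity
  refine ⟨T₁ + T₂ + 1, by positivity, fun T _ z hz t ht => ?_⟩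
  by_contra hne
  have hpos := hL.pos _ hne
  have hT₁t : T₁ ≤ t := by linarith [ht.1]
  have hpos₁ : 0 < P.V (z T₁) := hpos.trans_le (hL.le_of_le hz hT₁.le hT₁t ht.2)
  have hle : P.V (z T₁) ≤ 1 := by
    by_contra! hgt
    have h1 := hL.rpow_sub_le hz le_rfl hT₁.le (hT₁t.trans ht.2) hpos₁ hαInf.ne' decInf
    rw [← neg_sub αInf 1, div_neg, div_neg, sub_zero] at h1
    have h2 : P.V (z T₁) ^ (-(αInf - 1)) < 1 := Real.rpow_lt_one_of_one_lt_of_neg hgt (by linarith)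
    have h3 : 0 ≤ P.V (z 0) ^ (-(αInf - 1)) := Real.rpow_nonneg (hL.nonneg _) _
    have h4 : ηInf * T₁ = 1 / (αInf - 1) := by simp only [T₁]; field_simp
    have h5 := div_lt_div_of_pos_right h2 hγ
    have h6 := div_nonneg h3 hγ.le
    linarith
  have h1 := hL.rpow_sub_le hz hT₁.le hT₁t ht.2 hpos hα₀.ne dec0
  have h2 : P.V (z T₁) ^ (1 - α₀) ≤ 1 := Real.rpow_le_one hpos₁.le hle hβ.le
  have h3 : 0 < P.V (z t) ^ (1 - α₀) := Real.rpow_pos_of_pos hpos _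
  have h4 : η0 * T₂ = 1 / (1 - α₀) := by simp only [T₂]; field_simp
  have h5 := div_le_div_of_nonneg_right h2 hβ.le
  have h6 := div_pos h3 hβ
  have h7 : η0 * T₂ ≤ η0 * (t - T₁) := mul_le_mul_of_nonneg_left (by linarith [ht.1]) h0.le
  linarith

end

section

variable {Δ : ℝ} (hP : P.Valid Δ)
include hP

theorem TailNeg.stabilizing {K : ℝ} (hK : 0 < K) (hD : P.d0 ≠ -1 → Δ / K = 0) {kt : ℕ → ℝ}
    (hk : K ≤ gain kt P.n) (h : P.TailNeg (Δ / K) kt 1) : P.Stabilizing Δ kt := by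
  have hE := hP.exponents
  have hL := h.isLyapunov hP hK hD hk
  refine ⟨hL, hL.isGAS fun c hc => ?_, fun h0 hI => ?_⟩
  · obtain ⟨η, hη, a, -, M, -, key⟩ := h.exists_rates hP hK hD hk
    have x0 := Real.rpow_pos_of_pos hc ((P.p0 + P.d0) / P.p0)
    have y0 := Real.rpow_pos_of_pos hc ((P.pInf + P.dInf) / P.pInf)
    refine ⟨min (η * c ^ ((P.p0 + P.d0) / P.p0)) (η * c ^ ((P.pInf + P.dInf) / P.pInf)),
      by positivity, fun z hz v hv => ?_⟩
    rcases key z (hL.ne_zero (hc.trans_le hz)) v hv with ⟨-, h2⟩ | ⟨-, h2⟩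
    · have h3 := mul_le_mul_of_nonneg_left (Real.rpow_le_rpow hc.le hz
        (div_pos hP.p0_add_d0_pos hE.p0_pos).le) hη.le
      have h4 := min_le_left (η * c ^ ((P.p0 + P.d0) / P.p0))
        (η * c ^ ((P.pInf + P.dInf) / P.pInf))
      linarith
    · have h3 := mul_le_mul_of_nonneg_left (Real.rpow_le_rpow hc.le hz
        (div_pos hP.pInf_add_dInf_pos hE.pInf_pos).le) hη.le
      have h4 := min_le_right (η * c ^ ((P.p0 + P.d0) / P.p0))
        (η * c ^ ((P.pInf + P.dInf) / P.pInf))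
      linarith
  · have h1 := mul_neg_of_neg_of_pos h0 hE.pInf_pos
    have h2 := mul_pos hI hE.p0_pos
    obtain ⟨η0, e0, ηInf, eI, hdec⟩ := hL.decay (h1.trans h2).le
    refine hL.convergesInFixedTime ?_ ?_ e0 eI hdec
    · rw [div_lt_one hE.p0_pos]; linarith
    · rw [one_lt_div hE.pInf_pos]; linarith

end


/-! ### The backward selection can be carried out -/

theorem ratioSet_congr {Δ K : ℝ} {kt kt' : ℕ → ℝ} {i : ℕ}
    (h : ∀ j, i < j → j ≤ P.n → kt j = kt' j) : P.ratioSet Δ K kt i = P.ratioSet Δ K kt' i := by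
  have e : ∀ F : ℕ → ℝ, ∀ u : ℕ → ℝ, ∑ j ∈ Finset.Icc (i + 1) P.n, kt j * F j * u j =
      ∑ j ∈ Finset.Icc (i + 1) P.n, kt' j * F j * u j := fun F u =>
    Finset.sum_congr rfl fun j hj => by
      obtain ⟨h1, h2⟩ := Finset.mem_Icc.1 hj
      rw [h j h1 h2]
  simp only [ratioSet, e]

theorem omega_congr {Δ K : ℝ} {kt kt' : ℕ → ℝ} {i : ℕ}
    (h : ∀ j, i < j → j ≤ P.n → kt j = kt' j) : P.omega Δ K kt i = P.omega Δ K kt' i := by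
  rw [omega, omega, ratioSet_congr h]

theorem ratioSet_mono {Δ K k : ℝ} (hK : 0 < K) (hk : K ≤ k) (kt : ℕ → ℝ) (i : ℕ) :
    P.ratioSet Δ k kt i ⊆ P.ratioSet Δ K kt i := by
  rintro q ⟨z, u, hne, hu, rfl⟩
  exact ⟨z, u, hne, fun j hj => chainSet_mono hK hk i j _ (hu j hj), rfl⟩

section

variable {Δ : ℝ} (hP : P.Valid Δ)
include hP

theorem Valid.gain_pos {K : ℝ} {kt : ℕ → ℝ} (hS : P.Selection Δ K kt) {i : ℕ} (hn : i ≤ P.n) :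
    0 < gain kt i :=
  Finset.prod_pos fun _ hj =>
    hP.kt_pos hS (Finset.mem_Icc.1 hj).1 ((Finset.mem_Icc.1 hj).2.trans hn)

theorem Valid.stabilizing {K : ℝ} {kt : ℕ → ℝ} (hS : P.Selection Δ K kt)
    (hk : K ≤ gain kt P.n) : P.Stabilizing Δ kt := by
  obtain ⟨hK, hD⟩ := hP.admissible hS.lt_last
  exact (hD.tailNeg hP hS.last_pos le_rfl (by linarith [hP.two_le_n]) hS.omega_lt).stabilizing hP
    hK hD.eq_zero hk

theorem Valid.selection_mono {K k : ℝ} {kt : ℕ → ℝ} (hS : P.Selection Δ K kt) (hk : K ≤ k) :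
    P.Selection Δ k kt := by
  have hn := hP.two_le_n
  refine ⟨hS.lt_last.trans_le (mul_le_mul_of_nonneg_right hk
    (hP.kappa_pos P.n (Finset.mem_Icc.2 ⟨by omega, le_rfl⟩)).le), hS.last_pos, fun i hi => ?_⟩
  refine lt_of_le_of_lt ?_ (hS.omega_lt i hi)
  obtain ⟨h1, h2⟩ := Finset.mem_Icc.1 hi
  have hlub := hP.isLUB_omega hS.lt_last hS.last_pos hi fun j hj => hS.omega_lt j
    (Finset.mem_Icc.2 ⟨by have := (Finset.mem_Icc.1 hj).1; omega, (Finset.mem_Icc.1 hj).2⟩)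
  exact csSup_le_csSup ⟨_, hlub.1⟩ (hP.ratioSet_nonempty h1 (by omega))
    (ratioSet_mono (hP.admissible hS.lt_last).1 hk kt i)

theorem Valid.exists_selection {K c : ℝ} (hK : Δ < K * P.kappa P.n) (hc : 0 < c) :
    ∃ kt : ℕ → ℝ, kt P.n = c ∧ P.Selection Δ K kt := by
  have key : ∀ i, i ≤ P.n → ∃ kt : ℕ → ℝ, kt P.n = c ∧
      ∀ j ∈ Finset.Icc i (P.n - 1), P.omega Δ K kt j < kt j := by
    intro i hi
    induction hi using Nat.decreasingInduction with
    | self =>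
      refine ⟨fun _ => c, rfl, fun j hj => ?_⟩
      obtain ⟨h1, h2⟩ := Finset.mem_Icc.1 hj
      have := hP.two_le_n
      omega
    | of_succ k hk ih =>
      obtain ⟨kt, h1, h2⟩ := ih
      have hcongr : ∀ j, k ≤ j → P.omega Δ K (Function.update kt k (P.omega Δ K kt k + 1)) j =
          P.omega Δ K kt j := fun j hj => omega_congr fun l hl _ =>
        Function.update_of_ne (by omega) _ _
      refine ⟨Function.update kt k (P.omega Δ K kt k + 1), ?_, fun j hj => ?_⟩
      · rw [Function.update_of_ne hk.ne', h1]
      · obtain ⟨h3, h4⟩ := Finset.mem_Icc.1 hj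
        rw [hcongr j h3]
        rcases h3.eq_or_lt with rfl | h3
        · rw [Function.update_self]
          exact lt_add_one _
        · rw [Function.update_of_ne h3.ne']
          exact h2 j (Finset.mem_Icc.2 ⟨h3, h4⟩)
  obtain ⟨kt, h1, h2⟩ := key 1 (by linarith [hP.two_le_n])
  exact ⟨kt, h1, hK, h1 ▸ hc, h2⟩

theorem Valid.exists_selection_le_gain {K c : ℝ} (hK : Δ < K * P.kappa P.n) (hc : 0 < c) :
    ∃ kt : ℕ → ℝ, kt P.n = c ∧ K ≤ gain kt P.n ∧ P.Selection Δ K kt := by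
  have hn := hP.two_le_n
  obtain ⟨kt, h1, hS⟩ := hP.exists_selection hK hc
  set Q := ∏ j ∈ Finset.Ioc 1 P.n, kt j
  have hQ : 0 < Q := Finset.prod_pos fun j hj => by
    obtain ⟨h3, h4⟩ := Finset.mem_Ioc.1 hj
    exact hP.kt_pos hS h3.le h4
  set x := max (kt 1) (K / Q)
  refine ⟨Function.update kt 1 x, ?_, ?_, hS.lt_last, ?_, fun i hi => ?_⟩
  · rw [Function.update_of_ne (by omega), h1]
  · have e : gain (Function.update kt 1 x) P.n = x * Q := by
      rw [gain, ← Finset.mul_prod_Ioc_eq_prod_Icc (by omega), Function.update_self]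
      congr 1
      refine Finset.prod_congr rfl fun j hj => Function.update_of_ne ?_ _ _
      exact (Finset.mem_Ioc.1 hj).1.ne'
    rw [e, ← div_le_iff₀ hQ]
    exact le_max_right _ _
  · rw [Function.update_of_ne (by omega)]
    exact hS.last_pos
  · have h2 := hS.omega_lt i hi
    obtain ⟨h3, -⟩ := Finset.mem_Icc.1 hi
    rw [omega_congr (kt' := kt) fun j hj _ => Function.update_of_ne (by omega) _ _]
    rcases h3.eq_or_lt with rfl | h3
    · rw [Function.update_self]
      exact h2.trans_le (le_max_left _ _)
    · rwa [Function.update_of_ne h3.ne']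

end

end DiffParams

theorem proposition2 (P : DiffParams) (Δ : ℝ) (hP : P.Valid Δ) :
    (∀ (K : ℝ) (kt : ℕ → ℝ), Δ < K * P.kappa P.n → 0 < kt P.n →
      ∀ i ∈ Finset.Icc 1 (P.n - 1),
        (∀ j ∈ Finset.Icc (i + 1) (P.n - 1), P.omega Δ K kt j < kt j) →
        IsLUB (P.ratioSet Δ K kt i) (P.omega Δ K kt i)) ∧
    (∀ (K : ℝ) (kt : ℕ → ℝ), P.Selection Δ K kt → K ≤ DiffParams.gain kt P.n →
      (∀ i ∈ Finset.Icc 1 P.n, 0 < DiffParams.gain kt i) ∧ P.Stabilizing Δ kt) ∧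
    (∀ K c : ℝ, Δ < K * P.kappa P.n → 0 < c →
      ∃ kt : ℕ → ℝ, kt P.n = c ∧ K ≤ DiffParams.gain kt P.n ∧
        P.Selection Δ K kt ∧ P.Selection Δ (DiffParams.gain kt P.n) kt) := by
  refine ⟨fun K kt hK hkt i hi hω => hP.isLUB_omega hK hkt hi hω, fun K kt hS hk =>
    ⟨fun i hi => hP.gain_pos hS (Finset.mem_Icc.1 hi).2, hP.stabilizing hS hk⟩,
    fun K c hK hc => ?_⟩
  obtain ⟨kt, h1, h2, h3⟩ := hP.exists_selection_le_gain hK hc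
  exact ⟨kt, h1, h2, h3, hP.selection_mono h3 h2⟩
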